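/- **Setting.** Let $\Psi^A$ be bosonic and fermionic fields of definite Grassmann parity and ghost number on an $n$-dimensional space-time chart with coordinates $x^\mu$. Let $\theta^\mu$ be Grassmann odd variables of ghost number $1$ (standing for $dx^\mu$). Local functions are functions of $x$, $\theta$, the fields and finitely many of their $x$-derivatives (smooth in the even variables, polynomial in the odd ones), with total derivatives $\partial_\mu$. Let $s$ be a nilpotent BRST differential, $s\Psi^A=S^A[x,\Psi]$, $[s,\partial_\mu]=0$, $sx=s\theta=0$, odd and of ghost number $1$, and put $\tilde s=\theta^\mu\partial_\mu+s$. *Parent theory.* Its fields are $\Psi^A_{(\lambda)[\nu]}$, with $(\lambda)$ a symmetric and $[\nu]=\nu_1\dots\nu_l$ a skew-symmetric multi-index, of ghost number $\mathrm{gh}(\Psi^A)-l$ and parity $|\Psi^A|+l$. They have jet coordinates $\Psi^A_{(\mu)(\lambda)[\nu]}$ and total derivatives $\partial_\mu=\frac{\partial}{\partial x^\mu}+\frac{\partial^F}{\partial x^\mu}$. The vector fields $\frac{\partial^F}{\partial x^\mu}$ and $\frac{\partial^F}{\partial y^\mu}$ add an index $\mu$ to $(\mu)$, respectively to $(\lambda)$;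 $\frac{\partial^F}{\partial\theta^\nu}\Psi^A_{(\mu)(\lambda)\nu_1\dots\nu_l}=(-1)^{|\Psi^A|}\Psi^A_{(\mu)(\lambda)\nu\nu_1\dots\nu_l}$; and $d^F$, respectively $\sigma^F$, maps $\Psi^A_{(\mu)(\lambda)\nu_1\dots\nu_p}$ to $(-1)^{|\Psi^A|}\sum_i(-1)^{i-1}$ times the coordinate with $\nu_i$ moved from $[\nu]$ to $(\mu)$, respectively to $(\lambda)$. For a local function $f[x,\theta,\Psi]$ let $\bar f$ be the function obtained by replacing $x$-derivatives of the fields with $y$-derivatives, $\Psi^A_{(\lambda)}\mapsto\Psi^A_{()(\lambda)[]}$; $\partial_\lambda$ then becomes the total $y$-derivative $\partial^y_\lambda=\frac{\partial}{\partial x^\lambda}+\frac{\partial^F}{\partial y^\lambda}$, which is $\frac{\partial^F}{\partial y^\lambda}$ on functions without explicit $x$-dependence. Let $\bar s$ be the vector field with $\bar sx=\bar s\theta=0$, $\bar s\Psi^A=\bar S^A$ which commutes in the graded sense with $\partial_\mu$, $\partial^y_\lambda$ and $\frac{\partial^F}{\partial\theta^\nu}$. The *extended parent theory* is the theory of the fields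 $\Psi^A_{(\lambda)[\nu]}$, with explicit $\theta$-dependence allowed, with differential $$(\tilde s)^P=\theta^\mu\Big(\frac{\partial}{\partial x^\mu}+\frac{\partial^F}{\partial y^\mu}\Big)+d^F-\sigma^F+\bar s .$$ Let $\partial^\theta_\nu=\frac{\partial}{\partial\theta^\nu}+\frac{\partial^F}{\partial\theta^\nu}$. *Trivial pairs.* In an invertible change of coordinates $x,\theta$ are kept and the new coordinates have definite parity and ghost number. Functions $w^a,v^a$ are *trivial pairs* for $\tilde s$ if, together with further functions $\varphi^i$ and $x,\theta$, they form a coordinate system on the space with coordinates $x,\theta,\Psi^A_{(\mu)}$ such that $\tilde sw^a=v^a$ and $\tilde s\varphi^i$ is a function of $x,\theta,\varphi$ only. They are *algebraically trivial pairs* if $w^a,v^a,\varphi^i$ are local functions such that $x,\theta$ and all total derivatives $\partial_{(\mu)}w^a,\partial_{(\mu)}v^a,\partial_{(\mu)}\varphi^i$ form such a coordinate system, $\tilde sw^a=v^a$, and $\tilde s\varphi^i$ is a function of $x,\theta$ and the $\varphi$'s and their derivatives only. *Generalized auxiliary fields.* For a theory with differential $Q$, fields $w^a,v^a$ are *generalized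 auxiliary fields* if there is an invertible local change of fields, possibly involving derivatives, from the given fields to $\varphi^i,w^a,v^a$, such that the equations $Qw^a|_{w=0}=0$ and their total derivatives are equivalent (generate the same ideal of local functions) to $v^a=V^a[\varphi]$ and its total derivatives, for some local functions $V^a$. **Proposition 2.8.** 1. If $w^a,v^a$ are algebraically trivial pairs for $\tilde s$, with remaining fields $\varphi^i$, then in the extended parent theory the descendants $$\partial^\theta_{\nu_1}\cdots\partial^\theta_{\nu_k}\,\partial^y_{\lambda_1}\cdots\partial^y_{\lambda_l}\bar w^a,\qquad \partial^\theta_{\nu_1}\cdots\partial^\theta_{\nu_k}\,\partial^y_{\lambda_1}\cdots\partial^y_{\lambda_l}\bar v^a$$ (all $k,l\ge0$, $\nu_1<\dots<\nu_k$, $\lambda_1\le\dots\le\lambda_l$) are generalized auxiliary fields, the remaining fields being the same descendants of $\bar\varphi^i$. 2. If $w^a,v^a$ are trivial pairs for $\tilde s$, not necessarily algebraic, with remaining coordinates $\varphi^i$, then in the extended parent theory the descendants $$\partial^\theta_{\nu_1}\cdots\partial^\theta_{\nu_k}\bar w^a,\qquad \partial^\theta_{\nu_1}\cdots\partial^\theta_{\nu_k}\bar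 v^a\qquad(k\ge0,\ \nu_1<\dots<\nu_k)$$ are generalized auxiliary fields, the remaining fields being the same descendants of $\bar\varphi^i$. -/

import Mathlib

open scoped TensorProduct ContDiff

noncomputable section

/-! ### Superfunctions -/

/-- Smooth real functions on `ℝ^E` that depend on finitely many of the coordinates. -/
def SmoothFun (E : Type*) : Subalgebra ℝ ((E → ℝ) → ℝ) where
  carrier := {f | ∃ (F : Finset E) (g : (F → ℝ) → ℝ), ContDiff ℝ ∞ g ∧ ∀ p, f p = g (fun i => p i)}
  mul_mem' := by
    classical
    rintro f₁ f₂ ⟨F₁, g₁, h₁, e₁⟩ ⟨F₂, g₂, h₂, e₂⟩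
    refine ⟨F₁ ∪ F₂, fun q => g₁ (fun i => q ⟨i, Finset.mem_union_left _ i.2⟩) *
      g₂ (fun i => q ⟨i, Finset.mem_union_right _ i.2⟩), ?_, ?_⟩
    · exact (h₁.comp (by fun_prop)).mul (h₂.comp (by fun_prop))
    · intro p; simp [e₁, e₂]
  add_mem' := by
    classical
    rintro f₁ f₂ ⟨F₁, g₁, h₁, e₁⟩ ⟨F₂, g₂, h₂, e₂⟩
    refine ⟨F₁ ∪ F₂, fun q => g₁ (fun i => q ⟨i, Finset.mem_union_left _ i.2⟩) +
      g₂ (fun i => q ⟨i, Finset.mem_union_right _ i.2⟩), ?_, ?_⟩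
    · exact (h₁.comp (by fun_prop)).add (h₂.comp (by fun_prop))
    · intro p; simp [e₁, e₂]
  algebraMap_mem' := fun r => ⟨∅, fun _ => r, contDiff_const, fun _ => rfl⟩

namespace SmoothFun

/-- The coordinate function `p ↦ p e`. -/
def coord {E : Type*} (e : E) : SmoothFun E :=
  ⟨fun p => p e, {e}, fun q => q ⟨e, Finset.mem_singleton_self e⟩, by fun_prop, fun _ => rfl⟩

/-- The value of `∂f/∂e`, the derivative in the single variable `e`, at the point `p`. -/
def pdFun {E : Type*} (e : E) (f : (E → ℝ) → ℝ) (p : E → ℝ) : ℝ :=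
  letI := Classical.decEq E
  deriv (fun t => f (Function.update p e t)) (p e)

theorem update_hasDerivAt {E : Type*} [DecidableEq E] (F : Finset E) (p : E → ℝ) (e : E) (t : ℝ) :
    HasDerivAt (fun t => fun i : F => Function.update p e t (i : E))
      (fun i : F => if (i : E) = e then (1 : ℝ) else 0) t := by
  rw [hasDerivAt_pi]
  intro i
  by_cases h : (i : E) = e
  · simp only [h, Function.update_self, if_true]; exact hasDerivAt_id t
  · simp only [h, ne_eq, not_false_eq_true, Function.update_of_ne, if_false]
    exact hasDerivAt_const _ _

theorem hasDerivAt_of_rep {E : Type*} [DecidableEq E] {f : (E → ℝ) → ℝ} {F : Finset E}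
    {g : (F → ℝ) → ℝ} (hg : ContDiff ℝ ∞ g) (hf : ∀ p, f p = g (fun i => p i)) (e : E)
    (p : E → ℝ) :
    HasDerivAt (fun t => f (Function.update p e t))
      (fderiv ℝ g (fun i => p i) (fun i : F => if (i : E) = e then (1 : ℝ) else 0)) (p e) := by
  have h1 := update_hasDerivAt F p e (p e)
  have h2 : HasFDerivAt g (fderiv ℝ g (fun i : F => p i))
      (fun i : F => Function.update p e (p e) (i : E)) := by
    rw [Function.update_eq_self]
    exact (hg.differentiable (by simp)).differentiableAt.hasFDerivAt
  have h3 := h2.comp_hasDerivAt (p e) h1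
  simp only [hf]
  exact h3

theorem pdFun_of_rep {E : Type*} [DecidableEq E] {f : (E → ℝ) → ℝ} {F : Finset E}
    {g : (F → ℝ) → ℝ} (hg : ContDiff ℝ ∞ g) (hf : ∀ p, f p = g (fun i => p i)) (e : E)
    (p : E → ℝ) :
    pdFun e f p =
      fderiv ℝ g (fun i => p i) (fun i : F => if (i : E) = e then (1 : ℝ) else 0) := by
  rw [← (hasDerivAt_of_rep hg hf e p).deriv]
  unfold pdFun
  congr!

/-- The partial derivative `∂/∂e`. -/
def pd {E : Type*} (e : E) : SmoothFun E →ₗ[ℝ] SmoothFun E where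
  toFun f := ⟨pdFun e f.1, by
    classical
    obtain ⟨F, g, hg, hf⟩ := f.2
    refine ⟨F, fun q => fderiv ℝ g q (fun i : F => if (i : E) = e then (1 : ℝ) else 0), ?_,
      fun p => pdFun_of_rep hg hf e p⟩
    exact (hg.fderiv_right (m := ∞) (by simp)).clm_apply contDiff_const⟩
  map_add' f₁ f₂ := by
    classical
    obtain ⟨F₁, g₁, h₁, e₁⟩ := f₁.2
    obtain ⟨F₂, g₂, h₂, e₂⟩ := f₂.2
    ext p
    have := ((hasDerivAt_of_rep h₁ e₁ e p).add (hasDerivAt_of_rep h₂ e₂ e p)).deriv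
    change pdFun e (f₁.1 + f₂.1) p = pdFun e f₁.1 p + pdFun e f₂.1 p
    rw [pdFun_of_rep h₁ e₁, pdFun_of_rep h₂ e₂, ← this]
    unfold pdFun
    congr!
  map_smul' c f := by
    classical
    obtain ⟨F, g, hg, hf⟩ := f.2
    ext p
    have := ((hasDerivAt_of_rep hg hf e p).const_mul c).deriv
    change pdFun e (c • f.1) p = c * pdFun e f.1 p
    rw [pdFun_of_rep hg hf, ← this]
    unfold pdFun
    congr!

/-- The pullback along the projection `ℝ^E' → ℝ^E` induced by a map of index sets `E → E'`. -/
def rename {E E' : Type*} (i : E → E') : SmoothFun E →ₐ[ℝ] SmoothFun E' where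
  toFun f := ⟨fun p => f.1 (p ∘ i), by
    classical
    obtain ⟨F, g, hg, hf⟩ := f.2
    exact ⟨F.image i, fun q => g (fun e => q ⟨i e, Finset.mem_image_of_mem i e.2⟩),
      hg.comp (by fun_prop), fun p => hf _⟩⟩
  map_one' := rfl
  map_mul' _ _ := rfl
  map_zero' := rfl
  map_add' _ _ := rfl
  commutes' _ := rfl

theorem finite_pd {E : Type*} (f : SmoothFun E) : {e | pd e f ≠ 0}.Finite := by
  classical
  obtain ⟨F, g, hg, hf⟩ := f.2
  refine F.finite_toSet.subset fun e he => ?_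
  by_contra hF
  refine he (Subtype.ext (funext fun p => ?_))
  change pdFun e f.1 p = 0
  rw [pdFun_of_rep hg hf]
  have : (fun i : F => if (i : E) = e then (1 : ℝ) else 0) = 0 := by
    funext i
    have : (i : E) ≠ e := fun h => hF (h ▸ i.2)
    simp [this]
  rw [this, map_zero]

end SmoothFun

/-- Grassmann parity and ghost number of a family of variables. -/
structure Degrees (Z : Type*) where
  par : Z → ZMod 2
  gh : Z → ℤ

/-- The superalgebra of functions of the variables `Z`: smooth functions of (finitely many of) the
even variables, tensored with the Grassmann algebra generated by the odd variables. -/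
def SuperFun {Z : Type*} (d : Degrees Z) : Type _ :=
  SmoothFun {z : Z // d.par z = 0} ⊗[ℝ] ExteriorAlgebra ℝ ({z : Z // d.par z = 1} →₀ ℝ)

instance {Z : Type*} (d : Degrees Z) : Ring (SuperFun d) :=
  inferInstanceAs (Ring (SmoothFun {z : Z // d.par z = 0} ⊗[ℝ]
    ExteriorAlgebra ℝ ({z : Z // d.par z = 1} →₀ ℝ)))

instance {Z : Type*} (d : Degrees Z) : Algebra ℝ (SuperFun d) :=
  inferInstanceAs (Algebra ℝ (SmoothFun {z : Z // d.par z = 0} ⊗[ℝ]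
    ExteriorAlgebra ℝ ({z : Z // d.par z = 1} →₀ ℝ)))

namespace SuperFun

variable {Z Z' : Type*}

theorem par_eq_one (d : Degrees Z) {z : Z} (h : ¬ d.par z = 0) : d.par z = 1 := by
  revert h
  generalize d.par z = a
  revert a
  decide

/-- A superfunction as an element of the tensor product (the identity map). -/
def toTensor (d : Degrees Z) : SuperFun d ≃ₐ[ℝ]
    SmoothFun {z : Z // d.par z = 0} ⊗[ℝ] ExteriorAlgebra ℝ ({z : Z // d.par z = 1} →₀ ℝ) :=
  AlgEquiv.refl

/-- The variable `z` as a superfunction. -/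
def coord (d : Degrees Z) (z : Z) : SuperFun d :=
  (toTensor d).symm (if h : d.par z = 0 then SmoothFun.coord ⟨z, h⟩ ⊗ₜ[ℝ] 1
    else 1 ⊗ₜ[ℝ] ExteriorAlgebra.ι ℝ (Finsupp.single ⟨z, par_eq_one d h⟩ 1))

/-- The (left) partial derivative `∂/∂z`. -/
def pd (d : Degrees Z) (z : Z) : SuperFun d →ₗ[ℝ] SuperFun d :=
  (toTensor d).symm.toLinearMap ∘ₗ
    (if h : d.par z = 0 then TensorProduct.map (SmoothFun.pd ⟨z, h⟩) LinearMap.id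
      else TensorProduct.map LinearMap.id
        (CliffordAlgebra.contractLeft (Finsupp.lapply ⟨z, par_eq_one d h⟩))) ∘ₗ
    (toTensor d).toLinearMap

theorem finite_contract {O : Type*} (a : ExteriorAlgebra ℝ (O →₀ ℝ)) :
    {o : O | CliffordAlgebra.contractLeft (Finsupp.lapply o : Module.Dual ℝ (O →₀ ℝ)) a
      ≠ 0}.Finite := by
  classical
  induction a using CliffordAlgebra.left_induction with
  | algebraMap r => simp [CliffordAlgebra.contractLeft_algebraMap]
  | add x y hx hy =>
    refine (hx.union hy).subset fun o ho => ?_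
    by_contra hc
    simp only [Set.mem_union, Set.mem_ofPred_eq, not_or, not_not] at hc
    exact ho (by rw [map_add, hc.1, hc.2, add_zero])
  | ι_mul x m hx =>
    refine (hx.union m.support.finite_toSet).subset fun o ho => ?_
    by_contra hc
    simp only [Set.mem_union, Set.mem_ofPred_eq, not_or, not_not, Finset.mem_coe,
      Finsupp.mem_support_iff] at hc
    exact ho (by rw [CliffordAlgebra.contractLeft_ι_mul, hc.1, Finsupp.lapply_apply, hc.2,
      zero_smul, mul_zero, sub_zero])

theorem finite_pd (d : Degrees Z) (f : SuperFun d) : {z | pd d z f ≠ 0}.Finite := by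
  obtain ⟨t, rfl⟩ := (toTensor d).symm.surjective f
  induction t using TensorProduct.induction_on with
  | zero => simp only [map_zero, ne_eq, not_true_eq_false]; exact Set.finite_empty
  | add x y hx hy =>
    refine (hx.union hy).subset fun o ho => ?_
    by_contra hc
    simp only [Set.mem_union, Set.mem_ofPred_eq, not_or, not_not] at hc
    exact ho (by rw [map_add, map_add, hc.1, hc.2, add_zero])
  | tmul g a =>
    refine (((SmoothFun.finite_pd g).image Subtype.val).union
      ((finite_contract a).image Subtype.val)).subset fun z hz => ?_
    by_contra hc
    refine hz ?_
    simp only [Set.mem_union, Set.mem_image, Set.mem_ofPred_eq, not_or, not_exists, not_and] at hc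
    simp only [pd, LinearMap.comp_apply, AlgEquiv.toLinearMap_apply, AlgEquiv.apply_symm_apply,
      EmbeddingLike.map_eq_zero_iff]
    split_ifs with h
    · have : SmoothFun.pd ⟨z, h⟩ g = 0 := by
        by_contra h0
        exact hc.1 ⟨z, h⟩ h0 rfl
      rw [TensorProduct.map_tmul, this, TensorProduct.zero_tmul]
    · have : CliffordAlgebra.contractLeft
          (Finsupp.lapply ⟨z, par_eq_one d h⟩ : Module.Dual ℝ _) a = 0 := by
        by_contra h0
        exact hc.2 ⟨z, par_eq_one d h⟩ h0 rfl
      rw [TensorProduct.map_tmul, this, TensorProduct.tmul_zero]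

theorem finite_mul_pd (d : Degrees Z) (X : Z → SuperFun d) (f : SuperFun d) :
    (Function.support fun z => X z * pd d z f).Finite :=
  (finite_pd d f).subset fun z hz h0 => hz (by simp only [h0, mul_zero])

/-- The vector field `∑_z X^z ∂/∂z` with components `X`, a derivation acting from the left (the
sum is finite on every superfunction). -/
def vectorField (d : Degrees Z) (X : Z → SuperFun d) : SuperFun d →ₗ[ℝ] SuperFun d where
  toFun f := ∑ᶠ z, X z * pd d z f
  map_add' f g := by
    rw [← finsum_add_distrib (finite_mul_pd d X f) (finite_mul_pd d X g)]
    simp only [map_add, mul_add]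
  map_smul' c f := by
    rw [RingHom.id_apply, smul_finsum' c (finite_mul_pd d X f)]
    simp only [map_smul, mul_smul_comm]

/-- The involution that is `1` on even and `-1` on odd superfunctions. -/
def parityInv (d : Degrees Z) : SuperFun d →ₐ[ℝ] SuperFun d :=
  (toTensor d).symm.toAlgHom.comp
    ((Algebra.TensorProduct.map (AlgHom.id ℝ _) CliffordAlgebra.involute).comp
      (toTensor d).toAlgHom)

/-- `f` has Grassmann parity `a` and ghost number `g`; the latter says that `f` is an eigenvector
of the Euler vector field `∑_z gh(z) z ∂/∂z`. -/
def IsHomog (d : Degrees Z) (a : ZMod 2) (g : ℤ) (f : SuperFun d) : Prop :=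
  parityInv d f = (-1 : ℝ) ^ a.val • f ∧
    vectorField d (fun z => (d.gh z : ℝ) • coord d z) f = (g : ℝ) • f

/-- Functions of the variables `Z`, read as functions of the variables `Z'`, by means of a
parity-preserving map `i : Z → Z'`. -/
def rename (d : Degrees Z) (d' : Degrees Z') (i : Z → Z') (h : ∀ z, d'.par (i z) = d.par z) :
    SuperFun d →ₐ[ℝ] SuperFun d' :=
  (toTensor d').symm.toAlgHom.comp ((Algebra.TensorProduct.map
    (SmoothFun.rename fun z : {z // d.par z = 0} => ⟨i z, (h z).trans z.2⟩)
    (ExteriorAlgebra.map (Finsupp.lmapDomain ℝ ℝ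
      fun z : {z // d.par z = 1} => (⟨i z, (h z).trans z.2⟩ : {z // d'.par z = 1})))).comp
    (toTensor d).toAlgHom)

end SuperFun

/-! ### Spaces over the superspace with coordinates `x`, `θ` -/

/-- The independent variables `x^μ` (even, ghost number `0`) and `θ^μ` (odd, ghost number `1`),
together with fibre coordinates labelled by `J`. -/
inductive BaseFib (n : ℕ) (J : Type*)
  | x (μ : Fin n)
  | th (μ : Fin n)
  | fib (j : J)

/-- Multi-indices: `m μ` is the number of occurrences of `μ`. -/
abbrev MultiIdx (n : ℕ) := Fin n → ℕ

/-- The labels of the splitting of a set of fields into `φ^i`, `w^a`, `v^a`. -/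
inductive Split (I K : Type*)
  | phi (i : I)
  | w (a : K)
  | v (a : K)

namespace Degrees

variable {J I K : Type*}

/-- Degrees of the variables `x`, `θ` and the fibre coordinates. -/
def withBase (n : ℕ) (d : Degrees J) : Degrees (BaseFib n J) where
  par
    | .x _ => 0
    | .th _ => 1
    | .fib j => d.par j
  gh
    | .x _ => 0
    | .th _ => 1
    | .fib j => d.gh j

/-- Degrees of the derivatives `ψ_(μ)` of the fields `ψ`. -/
def jet (n : ℕ) (d : Degrees J) : Degrees (J × MultiIdx n) where
  par z := d.par z.1
  gh z := d.gh z.1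

/-- Degrees of the `θ`-descendants `ψ_[ν]`. -/
def theta (n : ℕ) (d : Degrees J) : Degrees (J × Finset (Fin n)) where
  par z := d.par z.1 + (z.2.card : ZMod 2)
  gh z := d.gh z.1 - z.2.card

/-- Degrees of `φ, w, v`: those of `v^a` exceed those of `w^a` by one. -/
def split (dI : Degrees I) (dK : Degrees K) : Degrees (Split I K) where
  par
    | .phi i => dI.par i
    | .w a => dK.par a
    | .v a => dK.par a + 1
  gh
    | .phi i => dI.gh i
    | .w a => dK.gh a
    | .v a => dK.gh a + 1

end Degrees

/-- Functions of `x`, `θ` and the fibre coordinates `J`. -/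
abbrev FibFun (n : ℕ) {J : Type*} (d : Degrees J) : Type _ := SuperFun (d.withBase n)

/-- Local functions of the fields `F`: functions of `x`, `θ`, the fields and finitely many of
their `x`-derivatives. -/
abbrev LocFun (n : ℕ) {F : Type*} (d : Degrees F) : Type _ := FibFun n (d.jet n)

section Coordinates

variable {n : ℕ} {J J' F F' I K : Type*}

/-- The functions `x^μ`. -/
def xVar (d : Degrees J) (μ : Fin n) : FibFun n d := SuperFun.coord _ (.x μ)

/-- The functions `θ^μ`. -/
def thVar (d : Degrees J) (μ : Fin n) : FibFun n d := SuperFun.coord _ (.th μ)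

/-- The fibre coordinates. -/
def fibVar (n : ℕ) (d : Degrees J) (j : J) : FibFun n d := SuperFun.coord _ (.fib j)

/-- The inclusion of functions induced by a parity-preserving map of the fibre coordinates. -/
def fibRename (n : ℕ) (d : Degrees J) (d' : Degrees J') (i : J → J')
    (h : ∀ j, d'.par (i j) = d.par j) : FibFun n d →ₐ[ℝ] FibFun n d' :=
  SuperFun.rename _ _
    (fun | .x μ => .x μ | .th μ => .th μ | .fib j => .fib (i j))
    (fun | .x _ => rfl | .th _ => rfl | .fib j => h j)

/-- The vector field with components `a μ` along `x^μ`, `b μ` along `θ^μ` and `c j` along the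
fibre coordinate `j`. -/
def fibVF (d : Degrees J) (a b : Fin n → FibFun n d) (c : J → FibFun n d) :
    FibFun n d →ₗ[ℝ] FibFun n d :=
  SuperFun.vectorField _ (fun | .x μ => a μ | .th μ => b μ | .fib j => c j)

/-- `∂^(m)`, for (commuting) operators `∂_μ` and a symmetric multi-index `m`. -/
def symPow {V : Type*} [AddCommMonoid V] [Module ℝ V] (D : Fin n → V →ₗ[ℝ] V) (m : MultiIdx n) :
    V →ₗ[ℝ] V :=
  ((List.finRange n).map fun μ => (D μ ^ m μ : Module.End ℝ V)).prod

/-- `∂_{ν_1} ⋯ ∂_{ν_k}`, for (anticommuting) operators `∂_ν` and the skew-symmetric multi-index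
given by the set `N = {ν_1 < ⋯ < ν_k}`. -/
def skewPow {V : Type*} [AddCommMonoid V] [Module ℝ V] (D : Fin n → V →ₗ[ℝ] V)
    (N : Finset (Fin n)) : V →ₗ[ℝ] V :=
  (((List.finRange n).filter (· ∈ N)).map fun ν => (D ν : Module.End ℝ V)).prod

/-- The total derivative `∂_μ = ∂/∂x^μ + ψ_{(μ)}∂/∂ψ + ⋯` on local functions. -/
def totalD (d : Degrees F) (μ : Fin n) : LocFun n d →ₗ[ℝ] LocFun n d :=
  fibVF (d.jet n) (Pi.single μ 1) 0 fun z => fibVar n (d.jet n) (z.1, z.2 + Pi.single μ 1)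

/-- An invertible change of coordinates: an isomorphism of the superalgebras of functions which
leaves `x`, `θ` unchanged. The new fibre coordinates, labelled by `J'` and of definite degrees, are
the functions `T.equiv (fibVar n d' j)` of the old coordinates. -/
structure CoordChange (n : ℕ) (d' : Degrees J') (d : Degrees J) where
  equiv : FibFun n d' ≃ₐ[ℝ] FibFun n d
  map_x : ∀ μ, equiv (xVar d' μ) = xVar d μ
  map_th : ∀ μ, equiv (thVar d' μ) = thVar d μ
  map_homog : ∀ j, SuperFun.IsHomog (d.withBase n) (d'.par j) (d'.gh j) (equiv (fibVar n d' j))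

/-- The new coordinate labelled by `j`, as a function of the old coordinates. -/
def CoordChange.new {d' : Degrees J'} {d : Degrees J} (T : CoordChange n d' d) (j : J') :
    FibFun n d := T.equiv (fibVar n d' j)

/-- An invertible local change of fields, possibly involving derivatives: local functions, one for
each new field, which together with all their total derivatives (and `x`, `θ`) form a coordinate
system on the jet space of the old fields. -/
structure FieldChange (n : ℕ) (d' : Degrees F') (d : Degrees F) extends
    CoordChange n (d'.jet n) (d.jet n) where
  map_jet : ∀ f m, equiv (fibVar n (d'.jet n) (f, m)) =
    symPow (totalD d) m (equiv (fibVar n (d'.jet n) (f, 0)))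

/-- The new field `f`, as a local function of the old fields. -/
def FieldChange.field {d' : Degrees F'} {d : Degrees F} (T : FieldChange n d' d) (f : F') :
    LocFun n d := T.equiv (fibVar n (d'.jet n) (f, 0))

/-- Functions of `x`, `θ`, `φ` as functions of `x`, `θ`, `φ`, `w`, `v`. -/
def phiIncl (n : ℕ) (dI : Degrees I) (dK : Degrees K) :
    FibFun n dI →ₐ[ℝ] FibFun n (dI.split dK) :=
  fibRename n dI (dI.split dK) Split.phi fun _ => rfl

/-- Local functions of `φ` as local functions of `φ`, `w`, `v`. -/
def phiInclLoc (n : ℕ) (dI : Degrees I) (dK : Degrees K) :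
    LocFun n dI →ₐ[ℝ] LocFun n (dI.split dK) :=
  fibRename n (dI.jet n) ((dI.split dK).jet n) (fun z => (.phi z.1, z.2)) fun _ => rfl

/-- In the coordinates `φ, w, v`, the `w^a` and `v^a` are trivial pairs for `Q`: `Q w^a = v^a` and
`Q φ^i` depends on `x`, `θ`, `φ` only. If the old coordinates are jet coordinates, the separation
need not respect the total derivatives. -/
def IsTrivialPairs {d : Degrees J} (Q : FibFun n d →ₗ[ℝ] FibFun n d) {dI : Degrees I}
    {dK : Degrees K} (T : CoordChange n (dI.split dK) d) : Prop :=
  (∀ a, Q (T.new (.w a)) = T.new (.v a)) ∧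
    ∀ i, ∃ R : FibFun n dI, Q (T.new (.phi i)) = T.equiv (phiIncl n dI dK R)

/-- In terms of the fields `φ, w, v`, the `w^a` and `v^a` are algebraically trivial pairs for `Q`:
`Q w^a = v^a` and `Q φ^i` is a local function of the `φ` only. -/
def IsAlgTrivialPairs {d : Degrees F} (Q : LocFun n d →ₗ[ℝ] LocFun n d) {dI : Degrees I}
    {dK : Degrees K} (T : FieldChange n (dI.split dK) d) : Prop :=
  (∀ a, Q (T.field (.w a)) = T.field (.v a)) ∧
    ∀ i, ∃ R : LocFun n dI, Q (T.field (.phi i)) = T.equiv (phiInclLoc n dI dK R)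

/-- In terms of the fields `φ, w, v`, the `w^a` and `v^a` are generalized auxiliary fields of the
theory with differential `Q`: at `w = 0` the equations `Q w^a = 0` are equivalent to `v^a = V^a[φ]`
for local functions `V^a`. Equations, together with their total derivatives, are equivalent if they
generate the same ideal of local functions. -/
def IsGenAuxiliary {d : Degrees F} (Q : LocFun n d →ₗ[ℝ] LocFun n d) {dI : Degrees I}
    {dK : Degrees K} (T : FieldChange n (dI.split dK) d) : Prop :=
  ∃ V : K → LocFun n dI,
    (∀ a, SuperFun.IsHomog _ (dK.par a + 1) (dK.gh a + 1) (V a)) ∧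
    Ideal.span (Set.range (fun z : K × MultiIdx n => symPow (totalD d) z.2 (T.field (.w z.1))) ∪
        Set.range (fun z : K × MultiIdx n => symPow (totalD d) z.2 (Q (T.field (.w z.1))))) =
      Ideal.span (Set.range (fun z : K × MultiIdx n => symPow (totalD d) z.2 (T.field (.w z.1))) ∪
        Set.range (fun z : K × MultiIdx n => symPow (totalD d) z.2
          (T.field (.v z.1) - T.equiv (phiInclLoc n dI dK (V z.1)))))

end Coordinates

/-! ### The theory, its parent theory and the extended parent theory -/

/-- A gauge field theory on an `n`-dimensional space-time with fields `Ψ^A`: the local functions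
`S^A[x,Ψ]` that define a nilpotent BRST differential of ghost number one. -/
structure BRSTTheory (n : ℕ) (A : Type*) where
  deg : Degrees A
  S : A → LocFun n deg
  S_homog : ∀ A, SuperFun.IsHomog _ (deg.par A + 1) (deg.gh A + 1) (S A)
  /-- The `S^A` do not depend on `θ`. -/
  S_theta : ∀ A μ, SuperFun.pd _ (.th μ) (S A) = 0
  /-- The vector field with `s Ψ^A = S^A`, `s x = s θ = 0`, `[s, ∂_μ] = 0` squares to zero. -/
  nilpotent : ∀ f : LocFun n deg,
    fibVF (deg.jet n) 0 0 (fun z => symPow (totalD deg) z.2 (S z.1))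
      (fibVF (deg.jet n) 0 0 (fun z => symPow (totalD deg) z.2 (S z.1)) f) = 0

namespace BRSTTheory

variable {n : ℕ} {A : Type*} (B : BRSTTheory n A)

/-- The BRST differential `s`. -/
def s : LocFun n B.deg →ₗ[ℝ] LocFun n B.deg :=
  fibVF (B.deg.jet n) 0 0 fun z => symPow (totalD B.deg) z.2 (B.S z.1)

/-- The extended BRST differential `s̃ = θ^μ ∂_μ + s`. -/
def sTilde : LocFun n B.deg →ₗ[ℝ] LocFun n B.deg :=
  (∑ μ, LinearMap.mulLeft ℝ (thVar (B.deg.jet n) μ) ∘ₗ totalD B.deg μ) + B.s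

/-- Degrees of the fields `Ψ^A_{(λ)[ν]}` of the parent theory, labelled by `((A, λ), ν)`. -/
def parentDeg : Degrees ((A × MultiIdx n) × Finset (Fin n)) := (B.deg.jet n).theta n

/-- Local functions of the (extended) parent theory: functions of `x`, `θ` and the
`Ψ^A_{(μ)(λ)[ν]}`, labelled by `(((A, λ), ν), μ)`. -/
abbrev ParentFun : Type _ := LocFun n B.parentDeg

/-- The coordinate `Ψ^A_{(m)(l)[N]}`. -/
def psi (A : A) (m l : MultiIdx n) (N : Finset (Fin n)) : B.ParentFun :=
  fibVar n (B.parentDeg.jet n) (((A, l), N), m)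

/-- A vector field on the parent jet space that does not act on `x`, `θ`. -/
def parentVF (c : A → MultiIdx n → MultiIdx n → Finset (Fin n) → B.ParentFun) :
    B.ParentFun →ₗ[ℝ] B.ParentFun :=
  fibVF (B.parentDeg.jet n) 0 0 fun z => c z.1.1.1 z.2 z.1.1.2 z.1.2

/-- Replacement of `x`-derivatives by `y`-derivatives: functions of `x`, `θ` and the `Ψ^A_(λ)` are
read as functions of `x`, `θ` and the `Ψ^A_{()(λ)[]}`. -/
def bar : LocFun n B.deg →ₐ[ℝ] B.ParentFun :=
  fibRename n (B.deg.jet n) (B.parentDeg.jet n) (fun z => ((z, ∅), 0)) fun z => by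
    simp [Degrees.jet, parentDeg, Degrees.theta]

/-- The sign `(-1)^{|Ψ^A|}`. -/
def fieldSign (A : A) : ℝ := (-1) ^ (B.deg.par A).val

/-- The sign `(-1)^k` with `k` the number of elements of `N` below `ν`. -/
def orderSign (ν : Fin n) (N : Finset (Fin n)) : ℝ := (-1) ^ (N.filter (· < ν)).card

/-- `∂^F/∂y^μ`. -/
def dyF (μ : Fin n) : B.ParentFun →ₗ[ℝ] B.ParentFun :=
  B.parentVF fun A m l N => B.psi A m (l + Pi.single μ 1) N

/-- `∂/∂x^μ`, acting on the explicit `x`-dependence only. -/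
def dxExplicit (μ : Fin n) : B.ParentFun →ₗ[ℝ] B.ParentFun := SuperFun.pd _ (.x μ)

/-- `∂/∂θ^ν`, acting on the explicit `θ`-dependence only. -/
def dthExplicit (ν : Fin n) : B.ParentFun →ₗ[ℝ] B.ParentFun := SuperFun.pd _ (.th ν)

/-- The total `y`-derivative `∂/∂x^μ + ∂^F/∂y^μ`, to which the total derivative `∂_μ` of the
original theory turns when `x`-derivatives of the fields are replaced by `y`-derivatives. On
functions without explicit `x`-dependence it is `∂^F/∂y^μ`. -/
def dyTotal (μ : Fin n) : B.ParentFun →ₗ[ℝ] B.ParentFun := B.dxExplicit μ + B.dyF μ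

/-- `∂^F/∂θ^ν`, which acts by `Ψ^A_{(μ)(λ)ν_1…ν_k} ↦ (-1)^{|Ψ^A|} Ψ^A_{(μ)(λ)νν_1…ν_k}`. -/
def dthF (ν : Fin n) : B.ParentFun →ₗ[ℝ] B.ParentFun :=
  B.parentVF fun A m l N =>
    if ν ∈ N then 0 else (B.fieldSign A * orderSign ν N) • B.psi A m l (insert ν N)

/-- The total `θ`-derivative `∂^θ_ν = ∂/∂θ^ν + ∂^F/∂θ^ν`. -/
def dthTotal (ν : Fin n) : B.ParentFun →ₗ[ℝ] B.ParentFun := B.dthExplicit ν + B.dthF ν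

/-- `d^F`, which acts by
`Ψ^A_{(μ)(λ)ν_1…ν_p} ↦ (-1)^{|Ψ^A|} ∑_i (-1)^{i-1} Ψ^A_{(μ)ν_i(λ)ν_1…ν̂_i…ν_p}`. -/
def dF : B.ParentFun →ₗ[ℝ] B.ParentFun :=
  B.parentVF fun A m l N =>
    ∑ ν ∈ N, (B.fieldSign A * orderSign ν N) • B.psi A (m + Pi.single ν 1) l (N.erase ν)

/-- `σ^F`, which acts by
`Ψ^A_{(μ)(λ)ν_1…ν_p} ↦ (-1)^{|Ψ^A|} ∑_i (-1)^{i-1} Ψ^A_{(μ)(λ)ν_iν_1…ν̂_i…ν_p}`. -/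
def sigmaF : B.ParentFun →ₗ[ℝ] B.ParentFun :=
  B.parentVF fun A m l N =>
    ∑ ν ∈ N, (B.fieldSign A * orderSign ν N) • B.psi A m (l + Pi.single ν 1) (N.erase ν)

/-- `s̄`: the vector field with `s̄ x = s̄ θ = 0` and `s̄ Ψ^A = S̄^A` that commutes with the
total derivatives `∂_μ`, `∂/∂x^λ + ∂^F/∂y^λ` and, in the graded sense, with `∂^F/∂θ^ν`. Since
`Ψ^A_{(m)(l)[N]} = (-1)^{|N||Ψ^A|} ∂_(m) ∂^F_[N] Ψ^A_{()(l)[]}`, this determines its components. -/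
def sBar : B.ParentFun →ₗ[ℝ] B.ParentFun :=
  B.parentVF fun A m l N => (-B.fieldSign A) ^ N.card •
    symPow (totalD B.parentDeg) m (skewPow B.dthF N (symPow B.dyTotal l (B.bar (B.S A))))

/-- The parent differential `s^P = d^F - σ^F + s̄`. -/
def sParent : B.ParentFun →ₗ[ℝ] B.ParentFun := B.dF - B.sigmaF + B.sBar

/-- The differential of the extended parent theory,
`(s̃)^P = θ^μ (∂/∂x^μ + ∂^F/∂y^μ) + d^F - σ^F + s̄`. -/
def sTildeParent : B.ParentFun →ₗ[ℝ] B.ParentFun :=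
  (∑ μ, LinearMap.mulLeft ℝ (thVar (B.parentDeg.jet n) μ) ∘ₗ B.dyTotal μ) + B.sParent

end BRSTTheory

end

/-! ### Parameter integrals and Hadamard's lemma. -/

noncomputable section

open SuperFun

/-! Two identities for the parent differential carry the result. On functions read through `bar` it
is `s̃` (`sTildeParent_bar`), and its anticommutator with `∂^θ_ν` is the total derivative `∂_ν`
(`sTildeParent_dthTotal`): the term `θ^μ ∂^y_μ` yields `∂/∂x^ν + ∂^F/∂y^ν`, `-σ^F` removes the
second summand, `d^F` supplies `∂^F/∂x^ν`, and `s̄` anticommutes with `∂^θ_ν`. So if `s̃ w = v`,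
moving the differential through a product of `∂^θ`'s turns a descendant of `w̄` into plus or minus
the same descendant of `v̄`, up to total derivatives of descendants of `w̄`
(`skewPow_commutator_mem`). Modulo the descendants of `w̄` and their total derivatives, the
equations thus say that the descendants of `v̄` vanish, and `V = 0` serves
(`exists_isGenAuxiliary`).

It must also be shown that the descendants of new coordinates are new fields. Every jet coordinate
of the parent theory is, up to sign, `∂_(μ) ∂^θ_N` of a coordinate without these indices. Hence an
algebra map over `x`, `θ` has exactly one prolongation that commutes with `∂_μ` and `∂^θ_ν`, and the
prolongations of a coordinate change and of its inverse are mutually inverse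
(`CoordChange.exists_prolongation`).

The algebraic case is the same argument applied to jet coordinates: `s̃` commutes with `∂_μ`, so it
also sends `∂_(λ) w` to `∂_(λ) v`, and `bar` turns `∂_λ` into `∂^y_λ`.

All operator identities are checked on coordinates. For smooth, not merely polynomial, functions
this needs two facts about `C^∞ ⊗ Λ`. Derivations and algebra maps are determined by their values on
coordinates (`twistedDer_eq_zero`, `algHom_ext`); this follows from Hadamard's lemma and the
separatedness of the degree filtration of the Grassmann algebra. Conversely, values of the right
parity can be prescribed (`exists_subst`): an even superfunction is a smooth body plus a sum of
central elements of square zero, and a shift by such an element is a first-order Taylor expansion.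
-/

theorem hasFDerivAt_intervalIntegral_of_contDiff {V : Type*} [NormedAddCommGroup V]
    [NormedSpace ℝ V] [FiniteDimensional ℝ V] {G : V × ℝ → ℝ} (hG : ContDiff ℝ ∞ G) (x₀ : V) :
    HasFDerivAt (fun x => ∫ t in (0 : ℝ)..1, G (x, t))
      (∫ t in (0 : ℝ)..1, (fderiv ℝ G (x₀, t)).comp (ContinuousLinearMap.inl ℝ V ℝ)) x₀ := by
  have hc : Continuous fun z : V × ℝ =>
      (fderiv ℝ G z).comp (ContinuousLinearMap.inl ℝ V ℝ) :=
    (hG.continuous_fderiv (by simp)).clm_comp continuous_const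
  have : ProperSpace V := FiniteDimensional.proper ℝ V
  -- Compactness of the closed unit ball times `[0,1]` bounds the derivative of the integrand, so a
  -- constant dominates it.
  obtain ⟨C, hC⟩ := ((isCompact_closedBall x₀ 1).prod
    (isCompact_Icc (a := (0 : ℝ)) (b := 1))).exists_bound_of_continuousOn hc.continuousOn
  refine (intervalIntegral.hasFDerivAt_integral_of_dominated_of_fderiv_le
    (F' := fun x t => (fderiv ℝ G (x, t)).comp (ContinuousLinearMap.inl ℝ V ℝ))
    (bound := fun _ => C)
    (Metric.closedBall_mem_nhds x₀ one_pos) ?_ ?_ ?_ ?_ ?_ ?_)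
  · exact Filter.Eventually.of_forall fun x =>
      (hG.continuous.comp (by fun_prop : Continuous fun t : ℝ => (x, t))).aestronglyMeasurable
  · exact (hG.continuous.comp (by fun_prop : Continuous fun t : ℝ => (x₀, t))).intervalIntegrable _ _
  · exact (hc.comp (by fun_prop : Continuous fun t : ℝ => (x₀, t))).aestronglyMeasurable
  · refine Filter.Eventually.of_forall fun t ht x hx => hC (x, t) ⟨hx, ?_⟩
    rw [Set.uIoc_of_le zero_le_one] at ht
    exact ⟨ht.1.le, ht.2⟩
  · exact intervalIntegrable_const
  · refine Filter.Eventually.of_forall fun t _ x _ => ?_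
    exact ((hG.differentiable (by simp)).differentiableAt.hasFDerivAt).comp x
      (hasFDerivAt_prodMk_left x t)

/-- A directional derivative of the integral is again a parameter integral of a smooth integrand, so
induction on the order works once the integrand is allowed to vary. Finite dimension makes it enough
to treat one direction at a time. -/
theorem contDiff_intervalIntegral {V : Type*} [NormedAddCommGroup V]
    [NormedSpace ℝ V] [FiniteDimensional ℝ V] {G : V × ℝ → ℝ} (hG : ContDiff ℝ ∞ G) :
    ContDiff ℝ ∞ fun x => ∫ t in (0 : ℝ)..1, G (x, t) := by
  rw [contDiff_infty]
  intro n
  induction n generalizing G with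
  | zero =>
    exact contDiff_zero.2 (intervalIntegral.continuous_parametric_intervalIntegral_of_continuous'
      (f := fun x t => G (x, t)) hG.continuous 0 1)
  | succ n ih =>
    have key : ContDiff ℝ ((n : WithTop ℕ∞) + 1) fun x => ∫ t in (0 : ℝ)..1, G (x, t) := by
      rw [contDiff_succ_iff_fderiv_apply]
      refine ⟨fun x => (hasFDerivAt_intervalIntegral_of_contDiff hG x).differentiableAt,
        fun h => absurd h (by simp), fun y => ?_⟩
      have : ContDiff ℝ ∞ fun z : V × ℝ => fderiv ℝ G z (y, 0) :=
        (hG.fderiv_right (m := ∞) (by simp)).clm_apply contDiff_const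
      convert ih this using 2 with x
      rw [(hasFDerivAt_intervalIntegral_of_contDiff hG x).fderiv,
        ContinuousLinearMap.intervalIntegral_apply]
      · rfl
      · refine Continuous.intervalIntegrable ?_ _ _
        exact ((hG.continuous_fderiv (by simp)).comp (by fun_prop)).clm_comp continuous_const
    exact_mod_cast key

/-- Hadamard's lemma. -/
theorem exists_hadamard {ι : Type*} [Fintype ι] {g : (ι → ℝ) → ℝ} (hg : ContDiff ℝ ∞ g)
    (p : ι → ℝ) : ∃ h : ι → (ι → ℝ) → ℝ, (∀ i, ContDiff ℝ ∞ (h i)) ∧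
      ∀ q, g q = g p + ∑ i, (q i - p i) * h i q := by
  classical
  -- The coefficients average the partial derivatives of `g` over the segment from `p` to `q`; the
  -- expansion is the fundamental theorem of calculus along that segment.
  refine ⟨fun i q => ∫ t in (0 : ℝ)..1, fderiv ℝ g (p + t • (q - p)) (Pi.single i 1),
    fun i => ?_, fun q => ?_⟩
  · refine contDiff_intervalIntegral
      (G := fun z : (ι → ℝ) × ℝ => fderiv ℝ g (p + z.2 • (z.1 - p)) (Pi.single i 1)) ?_
    exact ((hg.fderiv_right (m := ∞) (by simp)).comp (by fun_prop)).clm_apply contDiff_const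
  · have hc : Continuous fun t : ℝ => fderiv ℝ g (p + t • (q - p)) :=
      (hg.continuous_fderiv (by simp)).comp (by fun_prop)
    have h1 : ∫ t in (0 : ℝ)..1, fderiv ℝ g (p + t • (q - p)) (q - p) = g q - g p := by
      have hd : ∀ t ∈ Set.uIcc (0 : ℝ) 1, HasDerivAt (fun t : ℝ => g (p + t • (q - p)))
          (fderiv ℝ g (p + t • (q - p)) (q - p)) t := fun t _ => by
        have h2 : HasDerivAt (fun t : ℝ => p + t • (q - p)) (q - p) t := by
          simpa using ((hasDerivAt_id t).smul_const (q - p)).const_add p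
        exact ((hg.differentiable (by simp)).differentiableAt.hasFDerivAt).comp_hasDerivAt t h2
      rw [intervalIntegral.integral_eq_sub_of_hasDerivAt hd
        ((hc.clm_apply continuous_const).intervalIntegrable _ _)]
      simp
    rw [← sub_eq_iff_eq_add', ← h1]
    simp only [← intervalIntegral.integral_const_mul]
    rw [← intervalIntegral.integral_finsetSum]
    · congr 1
      funext t
      have key : ∀ L : (ι → ℝ) →L[ℝ] ℝ, L (q - p) = ∑ i, (q i - p i) * L (Pi.single i 1) := by
        intro L
        conv_lhs => rw [← Finset.univ_sum_single (q - p), map_sum]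
        refine Finset.sum_congr rfl fun i _ => ?_
        rw [← smul_eq_mul, ← map_smul, ← Pi.single_smul]
        simp
      exact key _
    · intro i _
      exact (continuous_const.mul (hc.clm_apply continuous_const)).intervalIntegrable _ _

namespace SmoothFun

/-- Hadamard's lemma applies because `f` lives on finitely many coordinates. The point `p` is free;
later it is the body of the values that a map takes on the coordinates. -/
theorem exists_eq_add_sum {E : Type*} (f : SmoothFun E) (p : E → ℝ) :
    ∃ (F : Finset E) (g : E → SmoothFun E), f = algebraMap ℝ _ (f.1 p) +
      ∑ e ∈ F, (coord e - algebraMap ℝ _ (p e)) * g e := by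
  classical
  obtain ⟨F, g, hg, hf⟩ := f.2
  obtain ⟨h, hh, e⟩ := exists_hadamard hg (fun i : F => p i)
  refine ⟨F, fun e => if he : e ∈ F then ⟨fun q => h ⟨e, he⟩ (fun i => q i), F, _, hh _,
    fun _ => rfl⟩ else 0, Subtype.ext (funext fun q => ?_)⟩
  rw [hf q, e, hf p]
  have : ∀ s : Finset E, ∀ G : E → SmoothFun E, ((∑ e ∈ s, G e : SmoothFun E) : (E → ℝ) → ℝ) q
      = ∑ e ∈ s, (G e).1 q := fun s G => by
    rw [AddSubmonoidClass.coe_finsetSum, Finset.sum_apply]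
  change _ = g (fun i => p i) + ((∑ e ∈ F, _ : SmoothFun E) : (E → ℝ) → ℝ) q
  rw [this, ← Finset.sum_attach F]
  congr 1
  refine Finset.sum_congr rfl fun i _ => ?_
  simp only [dif_pos i.2]
  rfl

/-- Evaluation at a point. -/
def eval {E : Type*} (p : E → ℝ) : SmoothFun E →ₐ[ℝ] ℝ :=
  (Pi.evalAlgHom ℝ (fun _ : E → ℝ => ℝ) p).comp (SmoothFun E).val

end SmoothFun

/-! ### Exterior algebras -/

namespace ExteriorAlgebra

variable {M : Type*} [AddCommGroup M] [Module ℝ M]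

theorem mul_ι (a : ExteriorAlgebra ℝ M) (v : M) :
    a * ι ℝ v = ι ℝ v * CliffordAlgebra.involute a := by
  induction a using CliffordAlgebra.left_induction with
  | algebraMap r => rw [AlgHom.commutes, ← Algebra.commutes]
  | add x y hx hy => rw [map_add, add_mul, mul_add, hx, hy]
  | ι_mul x m hx =>
    have h := ι_add_mul_swap (R := ℝ) v m
    change ι ℝ m * x * ι ℝ v = _
    rw [mul_assoc, hx, map_mul, CliffordAlgebra.involute_ι, ← mul_assoc, ← mul_assoc,
      eq_neg_of_add_eq_zero_right h, mul_neg]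

/-- The sum is twice the even part of `a`, which is central. Doubling avoids splitting into
homogeneous components. -/
theorem add_involute_mul (a b : ExteriorAlgebra ℝ M) :
    (a + CliffordAlgebra.involute a) * b = b * (a + CliffordAlgebra.involute a) := by
  induction b using CliffordAlgebra.left_induction with
  | algebraMap r => exact (Algebra.commutes _ _).symm
  | add x y hx hy => rw [mul_add, hx, hy, ← add_mul]
  | ι_mul x m hx =>
    have h : (a + CliffordAlgebra.involute a) * ι ℝ m =
        ι ℝ m * (a + CliffordAlgebra.involute a) := by
      rw [mul_ι, map_add, CliffordAlgebra.involute_involute, add_comm]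
    change _ * (ι ℝ m * x) = ι ℝ m * x * _
    rw [← mul_assoc, h, mul_assoc, hx, mul_assoc]

/-- The difference is twice the odd part of `a`, which passes `b` at the cost of the grading sign.
-/
theorem sub_involute_mul (a b : ExteriorAlgebra ℝ M) :
    (a - CliffordAlgebra.involute a) * b =
      CliffordAlgebra.involute b * (a - CliffordAlgebra.involute a) := by
  induction b using CliffordAlgebra.left_induction with
  | algebraMap r => rw [AlgHom.commutes]; exact (Algebra.commutes _ _).symm
  | add x y hx hy => rw [mul_add, map_add, add_mul, hx, hy]
  | ι_mul x m hx =>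
    have h : (a - CliffordAlgebra.involute a) * ι ℝ m =
        CliffordAlgebra.involute (ι ℝ m) * (a - CliffordAlgebra.involute a) := by
      rw [mul_ι, map_sub, CliffordAlgebra.involute_involute]
      erw [CliffordAlgebra.involute_ι]
      rw [← neg_sub, mul_neg, neg_mul]
    change _ * (ι ℝ m * x) = CliffordAlgebra.involute (ι ℝ m * x) * _
    rw [← mul_assoc, h, mul_assoc, hx, map_mul, mul_assoc]

theorem contractLeft_mul (δ : Module.Dual ℝ M) (a b : ExteriorAlgebra ℝ M) :
    CliffordAlgebra.contractLeft δ (a * b) =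
      CliffordAlgebra.involute a * CliffordAlgebra.contractLeft δ b +
        CliffordAlgebra.contractLeft δ a * b := by
  induction a using CliffordAlgebra.left_induction with
  | algebraMap r =>
    rw [CliffordAlgebra.contractLeft_algebraMap_mul, AlgHom.commutes,
      CliffordAlgebra.contractLeft_algebraMap, zero_mul, add_zero]
  | add x y hx hy => simp only [add_mul, map_add, hx, hy]; abel
  | ι_mul x m hx =>
    rw [mul_assoc, CliffordAlgebra.contractLeft_ι_mul, CliffordAlgebra.contractLeft_ι_mul, hx,
      map_mul, CliffordAlgebra.involute_ι, mul_add, sub_mul, smul_mul_assoc]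
    simp only [neg_mul, mul_assoc]
    abel

/-- The augmentation ideal is `M · Λ`: apart from scalars, elements are sums of products that begin
with a generator. -/
theorem mem_range_mul_top {a : ExteriorAlgebra ℝ M} (h : algebraMapInv a = 0) :
    a ∈ LinearMap.range (ι ℝ : M →ₗ[ℝ] ExteriorAlgebra ℝ M) * ⊤ := by
  suffices ∀ a : ExteriorAlgebra ℝ M, a - algebraMap ℝ _ (algebraMapInv a) ∈
      LinearMap.range (ι ℝ : M →ₗ[ℝ] ExteriorAlgebra ℝ M) * ⊤ by
    simpa [h] using this a
  intro a
  induction a using CliffordAlgebra.left_induction with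
  | algebraMap r =>
    have : algebraMapInv (algebraMap ℝ (ExteriorAlgebra ℝ M) r) = r :=
      algebraMap_leftInverse M r
    erw [this, sub_self]
    exact Submodule.zero_mem _
  | add x y hx hy =>
    rw [map_add, map_add, add_sub_add_comm]
    exact Submodule.add_mem _ hx hy
  | ι_mul x m hx =>
    have : algebraMapInv (ι ℝ m : ExteriorAlgebra ℝ M) = 0 := by simp [algebraMapInv]
    change ι ℝ m * x - algebraMap ℝ _ (algebraMapInv (ι ℝ m * x)) ∈ _
    rw [map_mul, this, zero_mul, map_zero, sub_zero]
    exact Submodule.mul_mem_mul ⟨m, rfl⟩ Submodule.mem_top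

/-- By `mul_ι` a generator moves to the left of any element, which only suffers the involution. So
the right ideals `M^N · Λ` are stable under left multiplication too. -/
theorem top_mul_range_pow_le (N : ℕ) :
    ⊤ * LinearMap.range (ι ℝ : M →ₗ[ℝ] ExteriorAlgebra ℝ M) ^ N ≤
      LinearMap.range (ι ℝ : M →ₗ[ℝ] ExteriorAlgebra ℝ M) ^ N * ⊤ := by
  induction N with
  | zero => simp
  | succ N ih =>
    rw [pow_succ, ← mul_assoc]
    refine (mul_le_mul_left ih _).trans ?_
    rw [mul_assoc, mul_assoc]
    refine mul_le_mul_right ?_ _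
    rw [Submodule.mul_le]
    rintro a - _ ⟨v, rfl⟩
    rw [mul_ι]
    exact Submodule.mul_mem_mul ⟨v, rfl⟩ Submodule.mem_top

theorem mul_mem_range_pow {a b : ExteriorAlgebra ℝ M} {N : ℕ} (ha : algebraMapInv a = 0)
    (hb : b ∈ LinearMap.range (ι ℝ : M →ₗ[ℝ] ExteriorAlgebra ℝ M) ^ N * ⊤) :
    a * b ∈ LinearMap.range (ι ℝ : M →ₗ[ℝ] ExteriorAlgebra ℝ M) ^ (N + 1) * ⊤ := by
  have h := Submodule.mul_mem_mul (mem_range_mul_top ha) hb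
  refine (?_ : (_ : Submodule ℝ (ExteriorAlgebra ℝ M)) ≤ _) h
  rw [pow_succ', mul_assoc, mul_assoc]
  refine mul_le_mul_right ?_ _
  rw [← mul_assoc]
  refine (mul_le_mul_left (top_mul_range_pow_le N) _).trans ?_
  rw [mul_assoc]
  exact mul_le_mul_right le_top _

/-- Elements of `M^N · Λ` have no component of degree below `N`. `M` may be infinite-dimensional, so
the augmentation ideal need not be nilpotent; this separatedness replaces nilpotency. -/
theorem eq_zero_of_mem_range_pow {a : ExteriorAlgebra ℝ M}
    (h : ∀ N : ℕ, a ∈ LinearMap.range (ι ℝ : M →ₗ[ℝ] ExteriorAlgebra ℝ M) ^ N * ⊤) : a = 0 := by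
  classical
  let 𝒜 : ℕ → Submodule ℝ (ExteriorAlgebra ℝ M) := fun i => ⋀[ℝ]^i M
  suffices ∀ i, (DirectSum.decompose 𝒜 a i : ExteriorAlgebra ℝ M) = 0 by
    rw [← DirectSum.sum_support_decompose 𝒜 a]
    exact Finset.sum_eq_zero fun i _ => this i
  intro i
  have ha := h (i + 1)
  have : ∀ N, i < N → ∀ x ∈ LinearMap.range (ι ℝ : M →ₗ[ℝ] ExteriorAlgebra ℝ M) ^ N * ⊤,
      (DirectSum.decompose 𝒜 x i : ExteriorAlgebra ℝ M) = 0 := by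
    intro N hN x hx
    induction hx using Submodule.mul_induction_on' with
    | mem_mul_mem u hu c _ =>
      rw [← DirectSum.sum_support_decompose 𝒜 c, Finset.mul_sum, DirectSum.decompose_sum,
        DFinsupp.finsetSum_apply, AddSubmonoidClass.coe_finsetSum]
      refine Finset.sum_eq_zero fun k _ => ?_
      have hk : u * (DirectSum.decompose 𝒜 c k : ExteriorAlgebra ℝ M) ∈ 𝒜 (N + k) :=
        SetLike.mul_mem_graded (A := 𝒜) hu (SetLike.coe_mem _)
      exact DirectSum.decompose_of_mem_ne 𝒜 hk (by omega)
    | add x _ y _ hx hy =>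
      rw [DirectSum.decompose_add, DirectSum.add_apply, Submodule.coe_add, hx, hy, add_zero]
  exact this _ (Nat.lt_succ_self i) a ha

/-- The even part of an element, minus its scalar part, is a sum of central elements of square
zero. -/
theorem even_part_mem_closure (a : ExteriorAlgebra ℝ M) :
    ∃ r : ℝ, a + CliffordAlgebra.involute a - algebraMap ℝ _ r ∈
      AddSubmonoid.closure {c : ExteriorAlgebra ℝ M | (∀ b, c * b = b * c) ∧ c * c = 0} := by
  induction a using CliffordAlgebra.left_induction with
  | algebraMap r =>
    refine ⟨r + r, ?_⟩
    rw [AlgHom.commutes, map_add]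
    erw [sub_self]
    exact zero_mem _
  | add x y hx hy =>
    obtain ⟨r, hr⟩ := hx
    obtain ⟨t, ht⟩ := hy
    refine ⟨r + t, ?_⟩
    convert add_mem hr ht using 1
    simp only [map_add]
    abel
  | ι_mul x m hx =>
    refine ⟨0, ?_⟩
    rw [map_zero, sub_zero]
    refine AddSubmonoid.subset_closure ⟨add_involute_mul _, ?_⟩
    change (ι ℝ m * x + CliffordAlgebra.involute (ι ℝ m * x)) *
      (ι ℝ m * x + CliffordAlgebra.involute (ι ℝ m * x)) = 0
    have h1 : CliffordAlgebra.involute (ι ℝ m) = -(ι ℝ m : ExteriorAlgebra ℝ M) :=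
      CliffordAlgebra.involute_ι m
    -- The element is `ι m (x - involute x)`. Its second factor is odd, so in the square the two
    -- copies of `ι m` become adjacent and annihilate each other.
    rw [map_mul, h1, neg_mul, ← sub_eq_add_neg, ← mul_sub, mul_assoc, ← mul_assoc _ (ι ℝ m),
      sub_involute_mul, h1, neg_mul, neg_mul, mul_neg, ← mul_assoc, ← mul_assoc, ι_sq_zero,
      zero_mul, zero_mul, neg_zero]

end ExteriorAlgebra

/-! ### Twisted derivations -/

/-- `L` satisfies the Leibniz rule `L (f g) = φ(f) L(g) + L(f) ψ(g)`. -/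
def IsTwistedDer {S S' : Type*} [Ring S] [Algebra ℝ S] [Ring S'] [Algebra ℝ S']
    (φ ψ : S →ₐ[ℝ] S') (L : S →ₗ[ℝ] S') : Prop :=
  ∀ f g, L (f * g) = φ f * L g + L f * ψ g

namespace IsTwistedDer

variable {S S' S'' : Type*} [Ring S] [Algebra ℝ S] [Ring S'] [Algebra ℝ S'] [Ring S'']
  [Algebra ℝ S''] {φ ψ : S →ₐ[ℝ] S'} {L L' : S →ₗ[ℝ] S'}

theorem apply_one (h : IsTwistedDer φ ψ L) : L 1 = 0 := by
  have := h 1 1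
  rw [mul_one, map_one φ, map_one ψ, one_mul, mul_one] at this
  simpa using this

theorem apply_algebraMap (h : IsTwistedDer φ ψ L) (r : ℝ) : L (algebraMap ℝ S r) = 0 := by
  rw [Algebra.algebraMap_eq_smul_one, map_smul, h.apply_one, smul_zero]

theorem sub (h : IsTwistedDer φ ψ L) (h' : IsTwistedDer φ ψ L') : IsTwistedDer φ ψ (L - L') := by
  intro f g
  simp only [LinearMap.sub_apply, h f g, h' f g]
  noncomm_ring

theorem add (h : IsTwistedDer φ ψ L) (h' : IsTwistedDer φ ψ L') : IsTwistedDer φ ψ (L + L') := by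
  intro f g
  simp only [LinearMap.add_apply, h f g, h' f g]
  noncomm_ring

theorem smul (h : IsTwistedDer φ ψ L) (c : ℝ) : IsTwistedDer φ ψ (c • L) := by
  intro f g
  simp only [LinearMap.smul_apply, h f g, smul_add, mul_smul_comm, smul_mul_assoc]

theorem comp_algHom (h : IsTwistedDer φ ψ L) (T : S'' →ₐ[ℝ] S) :
    IsTwistedDer (φ.comp T) (ψ.comp T) (L ∘ₗ T.toLinearMap) := by
  intro f g
  simp [h (T f) (T g)]

theorem algHom_comp (h : IsTwistedDer φ ψ L) (T : S' →ₐ[ℝ] S'') :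
    IsTwistedDer (T.comp φ) (T.comp ψ) (T.toLinearMap ∘ₗ L) := by
  intro f g
  simp [h f g]

/-- With this, uniqueness of algebra maps becomes a case of uniqueness of twisted derivations. -/
theorem sub_algHom (φ ψ : S →ₐ[ℝ] S') : IsTwistedDer φ ψ (φ.toLinearMap - ψ.toLinearMap) := by
  intro f g
  simp only [LinearMap.sub_apply, AlgHom.toLinearMap_apply, map_mul]
  noncomm_ring

end IsTwistedDer

namespace SmoothFun

@[simp] theorem eval_apply {E : Type*} (p : E → ℝ) (f : SmoothFun E) : eval p f = f.1 p := rfl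

theorem pd_mul {E : Type*} (e : E) (f g : SmoothFun E) :
    pd e (f * g) = f * pd e g + pd e f * g := by
  classical
  obtain ⟨F₁, g₁, h₁, e₁⟩ := f.2
  obtain ⟨F₂, g₂, h₂, e₂⟩ := g.2
  ext p
  have d₁ := hasDerivAt_of_rep h₁ e₁ e p
  have d₂ := hasDerivAt_of_rep h₂ e₂ e p
  have := (d₁.mul d₂).deriv
  change pdFun e (f.1 * g.1) p = f.1 p * pdFun e g.1 p + pdFun e f.1 p * g.1 p
  rw [pdFun_of_rep h₁ e₁, pdFun_of_rep h₂ e₂]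
  simp only [Function.update_eq_self] at this
  rw [add_comm, ← this]
  unfold pdFun
  congr!

theorem pd_coord_self {E : Type*} (e : E) : pd e (coord e) = 1 := by
  classical
  ext p
  change pdFun e (fun p => p e) p = 1
  unfold pdFun
  simp

theorem pd_coord_of_ne {E : Type*} {e e' : E} (h : e' ≠ e) : pd e (coord e') = 0 := by
  classical
  ext p
  change pdFun e (fun p => p e') p = 0
  unfold pdFun
  simp [Function.update_of_ne h]

end SmoothFun

/-! ### Superfunctions: values at points and determination by coordinates. -/

namespace SuperFun

variable {Z Z' : Type*}

/-- The inclusion of the smooth functions of the even variables. -/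
def ofSmooth (d : Degrees Z) : SmoothFun {z // d.par z = 0} →ₐ[ℝ] SuperFun d :=
  (toTensor d).symm.toAlgHom.comp Algebra.TensorProduct.includeLeft

/-- The inclusion of the Grassmann algebra of the odd variables. -/
def ofExt (d : Degrees Z) : ExteriorAlgebra ℝ ({z // d.par z = 1} →₀ ℝ) →ₐ[ℝ] SuperFun d :=
  (toTensor d).symm.toAlgHom.comp Algebra.TensorProduct.includeRight

theorem ofSmooth_mul_ofExt (d : Degrees Z) (f) (a) :
    ofSmooth d f * ofExt d a = (toTensor d).symm (f ⊗ₜ a) := by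
  change (toTensor d).symm (f ⊗ₜ 1) * (toTensor d).symm (1 ⊗ₜ a) = _
  rw [← map_mul]
  simp

theorem ofSmooth_comm (d : Degrees Z) (f) (a) : Commute (ofSmooth d f) (ofExt d a) := by
  rw [Commute, SemiconjBy, ofSmooth_mul_ofExt]
  change _ = (toTensor d).symm (1 ⊗ₜ a) * (toTensor d).symm (f ⊗ₜ 1)
  rw [← map_mul]
  simp

@[elab_as_elim]
theorem induction_on {d : Degrees Z} {P : SuperFun d → Prop} (f : SuperFun d)
    (mul : ∀ g a, P (ofSmooth d g * ofExt d a)) (add : ∀ f g, P f → P g → P (f + g)) : P f := by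
  obtain ⟨t, rfl⟩ := (toTensor d).symm.surjective f
  induction t using TensorProduct.induction_on with
  | zero => simpa using mul 0 0
  | add x y hx hy => rw [map_add]; exact add _ _ hx hy
  | tmul g a => rw [← ofSmooth_mul_ofExt]; exact mul g a

theorem coord_even (d : Degrees Z) {z : Z} (h : d.par z = 0) :
    coord d z = ofSmooth d (SmoothFun.coord ⟨z, h⟩) := by
  rw [coord, dif_pos h]; rfl

theorem coord_odd (d : Degrees Z) {z : Z} (h : d.par z = 1) :
    coord d z = ofExt d (ExteriorAlgebra.ι ℝ (Finsupp.single ⟨z, h⟩ 1)) := by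
  rw [coord, dif_neg (by rw [h]; decide)]; rfl

theorem pd_even (d : Degrees Z) {z : Z} (h : d.par z = 0) (f) (a) :
    pd d z (ofSmooth d f * ofExt d a) = ofSmooth d (SmoothFun.pd ⟨z, h⟩ f) * ofExt d a := by
  rw [ofSmooth_mul_ofExt, ofSmooth_mul_ofExt, pd, dif_pos h]
  simp [LinearMap.comp_apply]

theorem pd_odd (d : Degrees Z) {z : Z} (h : d.par z = 1) (f) (a) :
    pd d z (ofSmooth d f * ofExt d a) =
      ofSmooth d f * ofExt d (CliffordAlgebra.contractLeft (Finsupp.lapply ⟨z, h⟩) a) := by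
  rw [ofSmooth_mul_ofExt, ofSmooth_mul_ofExt, pd, dif_neg (by rw [h]; decide)]
  simp [LinearMap.comp_apply]

theorem parityInv_mul (d : Degrees Z) (f) (a) :
    parityInv d (ofSmooth d f * ofExt d a) = ofSmooth d f * ofExt d (CliffordAlgebra.involute a) := by
  rw [ofSmooth_mul_ofExt, ofSmooth_mul_ofExt, parityInv]
  simp

theorem parityInv_ofSmooth (d : Degrees Z) (f) : parityInv d (ofSmooth d f) = ofSmooth d f := by
  simpa using parityInv_mul d f 1

theorem parityInv_ofExt (d : Degrees Z) (a) :
    parityInv d (ofExt d a) = ofExt d (CliffordAlgebra.involute a) := by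
  simpa using parityInv_mul d 1 a

theorem parityInv_parityInv (d : Degrees Z) (f : SuperFun d) : parityInv d (parityInv d f) = f := by
  induction f using induction_on with
  | mul g a => rw [parityInv_mul, parityInv_mul, CliffordAlgebra.involute_involute]
  | add f g hf hg => rw [map_add, map_add, hf, hg]

/-- The value at a point, an element of the Grassmann algebra. -/
def evalPt (d : Degrees Z) (q : {z // d.par z = 0} → ℝ) :
    SuperFun d →ₐ[ℝ] ExteriorAlgebra ℝ ({z // d.par z = 1} →₀ ℝ) :=
  (Algebra.TensorProduct.lid ℝ _).toAlgHom.comp ((Algebra.TensorProduct.map (SmoothFun.eval q)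
    (AlgHom.id ℝ _)).comp (toTensor d).toAlgHom)

theorem evalPt_mul (d : Degrees Z) (q) (f) (a) :
    evalPt d q (ofSmooth d f * ofExt d a) = f.1 q • a := by
  rw [ofSmooth_mul_ofExt, evalPt]
  simp

/-- Over a basis of the Grassmann algebra the coefficients of `x` are smooth functions, and their
values are the coefficients of `evalPt d q x`. -/
theorem eq_zero_of_evalPt {d : Degrees Z} {x : SuperFun d} (h : ∀ q, evalPt d q x = 0) :
    x = 0 := by
  let b := Module.Free.chooseBasis ℝ (ExteriorAlgebra ℝ ({z // d.par z = 1} →₀ ℝ))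
  let e := TensorProduct.equivFinsuppOfBasisRight (R := ℝ)
    (M := SmoothFun {z // d.par z = 0}) b
  have key : ∀ (x : SuperFun d) (q) (i), b.repr (evalPt d q x) i =
      (e (toTensor d x) i).1 q := by
    intro x q i
    induction x using induction_on with
    | mul g a =>
      rw [evalPt_mul, ofSmooth_mul_ofExt, AlgEquiv.apply_symm_apply,
        TensorProduct.equivFinsuppOfBasisRight_apply_tmul_apply]
      change _ = (b.repr a i • g.1) q
      simp [mul_comm]
    | add f g hf hg =>
      simp only [map_add, Finsupp.add_apply, hf, hg]
      rfl
  have h0 : e (toTensor d x) = 0 := by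
    ext i q
    rw [← key, h q, map_zero]
    rfl
  exact (toTensor d).injective (e.injective (h0.trans (by rw [map_zero, e.map_zero])))

/-- Expand `f` by Hadamard's lemma around a point `p`: since `L` kills constants and coordinates, `L
f` is a sum of terms `φ(e - p_e) L(g_e)`. If `p_e` is the body of `φ(e)` at `q`, the first factor
has no scalar part at `q`. Each repetition therefore gains one power of the augmentation ideal, and
the powers meet in zero. -/
theorem smooth_twistedDer_eq_zero {E : Type*} {d : Degrees Z} {φ ψ : SmoothFun E →ₐ[ℝ] SuperFun d}
    {L : SmoothFun E →ₗ[ℝ] SuperFun d} (hL : IsTwistedDer φ ψ L)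
    (h0 : ∀ e, L (SmoothFun.coord e) = 0) (f : SmoothFun E) : L f = 0 := by
  refine eq_zero_of_evalPt fun q => ExteriorAlgebra.eq_zero_of_mem_range_pow fun N => ?_
  induction N generalizing f with
  | zero => simp
  | succ N ih =>
    obtain ⟨F, g, hf⟩ := SmoothFun.exists_eq_add_sum f fun e =>
      ExteriorAlgebra.algebraMapInv (evalPt d q (φ (SmoothFun.coord e)))
    rw [hf, map_add, hL.apply_algebraMap, zero_add, map_sum, map_sum]
    refine Submodule.sum_mem _ fun e _ => ?_
    rw [hL, map_sub L, h0, hL.apply_algebraMap, sub_zero, zero_mul, add_zero, map_mul]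
    refine ExteriorAlgebra.mul_mem_range_pow ?_ (ih _)
    rw [map_sub, map_sub, map_sub, AlgHom.commutes, AlgHom.commutes, AlgHom.commutes]
    exact sub_self _

/-- A twisted derivation is determined by its values on the coordinates. -/
theorem twistedDer_eq_zero {d : Degrees Z} {d' : Degrees Z'} {φ ψ : SuperFun d →ₐ[ℝ] SuperFun d'}
    {L : SuperFun d →ₗ[ℝ] SuperFun d'} (hL : IsTwistedDer φ ψ L) (h0 : ∀ z, L (coord d z) = 0) :
    L = 0 := by
  have h1 : ∀ f, L (ofSmooth d f) = 0 := by
    refine smooth_twistedDer_eq_zero (hL.comp_algHom (ofSmooth d)) fun e => ?_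
    have := h0 e.1
    rwa [coord_even d e.2] at this
  have h2 : ∀ v, L (ofExt d (ExteriorAlgebra.ι ℝ v)) = 0 := by
    intro v
    induction v using Finsupp.induction_linear with
    | zero => simp
    | add v w hv hw => simp only [map_add, hv, hw, add_zero]
    | single z c =>
      have := h0 z.1
      rw [coord_odd d z.2] at this
      have hc : Finsupp.single z c = c • Finsupp.single z (1 : ℝ) := by simp
      rw [hc, map_smul, map_smul, map_smul, this, smul_zero]
  have h3 : ∀ a, L (ofExt d a) = 0 := by
    intro a
    induction a using CliffordAlgebra.left_induction with
    | algebraMap r =>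
      have := hL.apply_algebraMap r
      rwa [← (ofExt d).commutes r] at this
    | add x y hx hy =>
      have : L (ofExt d (x + y)) = L (ofExt d x) + L (ofExt d y) := by
        rw [← map_add, ← map_add]
      rw [this, hx, hy, add_zero]
    | ι_mul x m hx =>
      have : L (ofExt d (ExteriorAlgebra.ι ℝ m * x)) = 0 := by
        rw [map_mul, hL, hx, h2, mul_zero, zero_mul, add_zero]
      exact this
  ext f
  induction f using induction_on with
  | mul g a => rw [hL, h1, h3, mul_zero, zero_mul, add_zero]; rfl
  | add f g hf hg => rw [map_add, hf, hg]; simp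

theorem twistedDer_ext {d : Degrees Z} {d' : Degrees Z'} {φ ψ : SuperFun d →ₐ[ℝ] SuperFun d'}
    {L L' : SuperFun d →ₗ[ℝ] SuperFun d'} (hL : IsTwistedDer φ ψ L) (hL' : IsTwistedDer φ ψ L')
    (h : ∀ z, L (coord d z) = L' (coord d z)) : L = L' :=
  sub_eq_zero.1 (twistedDer_eq_zero (hL.sub hL') fun z => by simp [h z])

theorem algHom_ext {d : Degrees Z} {d' : Degrees Z'} {φ ψ : SuperFun d →ₐ[ℝ] SuperFun d'}
    (h : ∀ z, φ (coord d z) = ψ (coord d z)) : φ = ψ := by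
  have := twistedDer_eq_zero (IsTwistedDer.sub_algHom φ ψ) fun z => by simp [h z]
  ext f
  have := LinearMap.congr_fun this f
  simpa [sub_eq_zero] using this

end SuperFun

/-! ### Parity -/

/-- The sign `(-1)^a`. -/
def zsign (a : ZMod 2) : ℝ := (-1) ^ a.val

@[simp] theorem zsign_zero : zsign 0 = 1 := by simp [zsign]

@[simp] theorem zsign_one : zsign 1 = -1 := by
  simp [zsign, show (1 : ZMod 2).val = 1 from rfl]

theorem zmod_two_cases (a : ZMod 2) : a = 0 ∨ a = 1 := by
  revert a; decide

theorem zsign_add (a b : ZMod 2) : zsign (a + b) = zsign a * zsign b := by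
  rcases zmod_two_cases a with rfl | rfl <;> rcases zmod_two_cases b with rfl | rfl <;>
    simp [show (1 + 1 : ZMod 2) = 0 from rfl]

theorem zsign_mul_self (a : ZMod 2) : zsign a * zsign a = 1 := by
  rcases zmod_two_cases a with rfl | rfl <;> simp

namespace SuperFun

variable {Z Z' : Type*}

/-- `f` has Grassmann parity `a`. -/
def IsPar (d : Degrees Z) (a : ZMod 2) (f : SuperFun d) : Prop := parityInv d f = zsign a • f

/-- The power `π^k` of the parity involution `π`. -/
def parityPow (d : Degrees Z) (k : ZMod 2) : SuperFun d →ₐ[ℝ] SuperFun d :=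
  if k = 0 then AlgHom.id ℝ _ else parityInv d

@[simp] theorem parityPow_zero (d : Degrees Z) : parityPow d 0 = AlgHom.id ℝ _ := by
  simp [parityPow]

@[simp] theorem parityPow_one (d : Degrees Z) : parityPow d 1 = parityInv d := by
  simp [parityPow]

theorem parityPow_add (d : Degrees Z) (a b : ZMod 2) (f : SuperFun d) :
    parityPow d (a + b) f = parityPow d a (parityPow d b f) := by
  rcases zmod_two_cases a with rfl | rfl <;> rcases zmod_two_cases b with rfl | rfl <;>
    simp [show (1 + 1 : ZMod 2) = 0 from rfl, parityInv_parityInv]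

namespace IsPar

variable {d : Degrees Z} {a b : ZMod 2} {f g : SuperFun d}

theorem zero : IsPar d a (0 : SuperFun d) := by
  unfold IsPar; rw [map_zero, smul_zero]

theorem smul (hf : IsPar d a f) (c : ℝ) : IsPar d a (c • f) := by
  unfold IsPar at *; rw [map_smul, hf, smul_comm]

theorem one : IsPar d 0 (1 : SuperFun d) := by
  unfold IsPar; rw [map_one, zsign_zero, one_smul]

theorem sum {ι : Type*} {s : Finset ι} {f : ι → SuperFun d} (h : ∀ i ∈ s, IsPar d a (f i)) :
    IsPar d a (∑ i ∈ s, f i) := by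
  unfold IsPar at *
  rw [map_sum, Finset.smul_sum]
  exact Finset.sum_congr rfl h

theorem coord (d : Degrees Z) (z : Z) : IsPar d (d.par z) (coord d z) := by
  unfold IsPar
  rcases zmod_two_cases (d.par z) with h | h
  · rw [coord_even d h, parityInv_ofSmooth, h, zsign_zero, one_smul]
  · rw [coord_odd d h, parityInv_ofExt, h, zsign_one]
    erw [CliffordAlgebra.involute_ι]
    rw [neg_smul, one_smul]
    exact map_neg (ofExt d) _

end IsPar

theorem add_parityInv_mul (d : Degrees Z) (x f : SuperFun d) :
    (x + parityInv d x) * f = f * (x + parityInv d x) := by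
  induction x using induction_on with
  | mul g a =>
    rw [parityInv_mul, ← mul_add, ← map_add]
    induction f using induction_on with
    | mul h b =>
      rw [mul_assoc, ← mul_assoc (ofExt d _) (ofSmooth d h), ← (ofSmooth_comm d h _).eq,
        mul_assoc, mul_assoc, ← map_mul (ofExt d), ← mul_assoc (ofExt d b),
        ← (ofSmooth_comm d g b).eq, mul_assoc, ← map_mul (ofExt d), ← mul_assoc, ← mul_assoc,
        ← map_mul, ← map_mul, mul_comm g h, ExteriorAlgebra.add_involute_mul]
    | add f g hf hg => rw [mul_add, add_mul, hf, hg]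
  | add y z hy hz =>
    rw [map_add, add_add_add_comm, add_mul, mul_add, hy, hz]

theorem sub_parityInv_mul (d : Degrees Z) (x f : SuperFun d) :
    (x - parityInv d x) * f = parityInv d f * (x - parityInv d x) := by
  induction x using induction_on with
  | mul g a =>
    rw [parityInv_mul, ← mul_sub, ← map_sub]
    induction f using induction_on with
    | mul h b =>
      rw [parityInv_mul, mul_assoc, ← mul_assoc (ofExt d _) (ofSmooth d h),
        ← (ofSmooth_comm d h _).eq,
        mul_assoc, mul_assoc, ← map_mul (ofExt d), ← mul_assoc (ofExt d (_)) (ofSmooth d g),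
        ← (ofSmooth_comm d g _).eq, mul_assoc, ← map_mul (ofExt d), ← mul_assoc, ← mul_assoc,
        ← map_mul, ← map_mul, mul_comm g h, ExteriorAlgebra.sub_involute_mul]
    | add f g hf hg => rw [mul_add, map_add, add_mul, hf, hg]
  | add y z hy hz =>
    rw [map_add, add_sub_add_comm, add_mul, mul_add, hy, hz]

/-- For homogeneous `x` one of `x ± π x` is `2 x`, so halving the two preceding rules gives the sign
rule. Only `x` has to be homogeneous, which lets `parityPow` act on an arbitrary `f`. -/
protected theorem IsPar.mul_comm {d : Degrees Z} {a : ZMod 2} {x : SuperFun d} (hx : IsPar d a x)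
    (f : SuperFun d) : x * f = parityPow d a f * x := by
  unfold IsPar at hx
  rcases zmod_two_cases a with rfl | rfl
  · have := add_parityInv_mul d x f
    rw [hx, zsign_zero, one_smul, ← two_smul ℝ x, smul_mul_assoc, mul_smul_comm] at this
    simpa using (smul_right_injective _ (two_ne_zero (α := ℝ))) this
  · have := sub_parityInv_mul d x f
    rw [hx, zsign_one, neg_smul, one_smul, sub_neg_eq_add, ← two_smul ℝ x, smul_mul_assoc,
      mul_smul_comm] at this
    rw [parityPow_one]
    exact (smul_right_injective _ (two_ne_zero (α := ℝ))) this

/-! ### Vector fields -/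

theorem isTwistedDer_pd (d : Degrees Z) (z : Z) :
    IsTwistedDer (parityPow d (d.par z)) (AlgHom.id ℝ _) (pd d z) := by
  intro f g
  rw [AlgHom.id_apply]
  induction f using induction_on with
  | add f f' hf hf' => simp only [map_add, add_mul, hf, hf']; abel
  | mul h a =>
  induction g using induction_on with
  | add f f' hf hf' => simp only [map_add, mul_add, hf, hf']; abel
  | mul k b =>
    have e : ∀ h k : SmoothFun {z // d.par z = 0},
        ∀ a b : ExteriorAlgebra ℝ ({z // d.par z = 1} →₀ ℝ), ofSmooth d h * ofExt d a *
        (ofSmooth d k * ofExt d b) = ofSmooth d (h * k) * ofExt d (a * b) := by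
      intro h k a b
      rw [mul_assoc, ← mul_assoc (ofExt d a), ← (ofSmooth_comm d k a).eq, mul_assoc, ← mul_assoc,
        ← map_mul, ← map_mul]
    rcases zmod_two_cases (d.par z) with hz | hz
    · rw [e, pd_even d hz, pd_even d hz, pd_even d hz, SmoothFun.pd_mul, hz, parityPow_zero,
        AlgHom.id_apply, e, e, map_add, add_mul]
    · rw [e, pd_odd d hz, pd_odd d hz, pd_odd d hz, ExteriorAlgebra.contractLeft_mul, hz,
        parityPow_one, parityInv_mul, e, e, map_add, mul_add]

theorem pd_coord_self (d : Degrees Z) (z : Z) : pd d z (coord d z) = 1 := by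
  rcases zmod_two_cases (d.par z) with hz | hz
  · have := pd_even d hz (SmoothFun.coord ⟨z, hz⟩) 1
    rw [map_one, mul_one, mul_one] at this
    rw [coord_even d hz, this, SmoothFun.pd_coord_self, map_one]
  · have := pd_odd d hz 1 (ExteriorAlgebra.ι ℝ (Finsupp.single ⟨z, hz⟩ 1))
    rw [map_one, one_mul, one_mul] at this
    rw [coord_odd d hz, this]
    erw [CliffordAlgebra.contractLeft_ι]
    simp

theorem pd_coord_of_ne (d : Degrees Z) {z z' : Z} (h : z' ≠ z) : pd d z (coord d z') = 0 := by
  rcases zmod_two_cases (d.par z') with hz' | hz' <;> rcases zmod_two_cases (d.par z) with hz | hz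
  · have := pd_even d hz (SmoothFun.coord ⟨z', hz'⟩) 1
    rw [map_one, mul_one, mul_one] at this
    rw [coord_even d hz', this, SmoothFun.pd_coord_of_ne (by simpa using h), map_zero]
  · have := pd_odd d hz (SmoothFun.coord ⟨z', hz'⟩) 1
    rw [map_one, mul_one, CliffordAlgebra.contractLeft_one, map_zero, mul_zero] at this
    rw [coord_even d hz', this]
  · have := pd_even d hz 1 (ExteriorAlgebra.ι ℝ (Finsupp.single ⟨z', hz'⟩ 1))
    have h1 := SmoothFun.pd_mul ⟨z, hz⟩ (1 : SmoothFun {z // d.par z = 0}) 1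
    rw [mul_one, one_mul, mul_one] at h1
    rw [map_one, one_mul, left_eq_add.1 h1, map_zero, zero_mul] at this
    rw [coord_odd d hz', this]
  · have := pd_odd d hz 1 (ExteriorAlgebra.ι ℝ (Finsupp.single ⟨z', hz'⟩ 1))
    rw [map_one, one_mul, one_mul] at this
    rw [coord_odd d hz', this]
    erw [CliffordAlgebra.contractLeft_ι]
    simp [h]

theorem vectorField_apply (d : Degrees Z) (X : Z → SuperFun d) (f : SuperFun d) :
    vectorField d X f = ∑ᶠ z, X z * pd d z f := rfl

@[simp] theorem vectorField_coord (d : Degrees Z) (X : Z → SuperFun d) (z : Z) :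
    vectorField d X (coord d z) = X z := by
  rw [vectorField_apply, finsum_eq_single _ z, pd_coord_self, mul_one]
  intro z' h
  rw [pd_coord_of_ne d h.symm, mul_zero]

/-- Moving the component `X z` past `f` contributes the twist `par z + k`. The part `par z` cancels
the twist of `∂/∂z`, and `k` is left for every `z`. -/
theorem isTwistedDer_vectorField (d : Degrees Z) {X : Z → SuperFun d} {k : ZMod 2}
    (hX : ∀ z, IsPar d (d.par z + k) (X z)) :
    IsTwistedDer (parityPow d k) (AlgHom.id ℝ _) (vectorField d X) := by
  intro f g
  simp only [vectorField_apply, AlgHom.id_apply]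
  have h1 := finite_mul_pd d X f
  have h2 := finite_mul_pd d X g
  have e : ∀ z, X z * pd d z (f * g) =
      parityPow d k f * (X z * pd d z g) + X z * pd d z f * g := by
    intro z
    rw [isTwistedDer_pd d z f g, AlgHom.id_apply, mul_add, ← mul_assoc, (hX z).mul_comm,
      ← parityPow_add, mul_assoc, mul_assoc]
    congr 3
    rw [add_comm (d.par z), add_assoc, show d.par z + d.par z = 0 from CharTwo.add_self_eq_zero _,
      add_zero]
  have h1' : (Function.support fun z => X z * pd d z f * g).Finite :=
    h1.subset fun z hz h0 => hz (by simp only [h0, zero_mul])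
  have h2' : (Function.support fun z => parityPow d k f * (X z * pd d z g)).Finite :=
    h2.subset fun z hz h0 => hz (by simp only [h0, mul_zero])
  simp only [e]
  rw [finsum_add_distrib h2' h1', mul_finsum' _ _ h2, finsum_mul' _ _ h1]

/-- A derivation of parity `k`. -/
def IsSuperDer (d : Degrees Z) (k : ZMod 2) (D : SuperFun d →ₗ[ℝ] SuperFun d) : Prop :=
  IsTwistedDer (parityPow d k) (AlgHom.id ℝ _) D ∧
    ∀ f, parityInv d (D f) = zsign k • D (parityInv d f)

/-- A vector field whose components have the right parities is a superderivation. -/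
theorem isSuperDer_vectorField (d : Degrees Z) {X : Z → SuperFun d} {k : ZMod 2}
    (hX : ∀ z, IsPar d (d.par z + k) (X z)) : IsSuperDer d k (vectorField d X) := by
  have h := isTwistedDer_vectorField d hX
  refine ⟨h, fun f => ?_⟩
  have e : (parityInv d).comp (parityPow d k) = (parityPow d k).comp (parityInv d) := by
    rcases zmod_two_cases k with rfl | rfl <;> simp
  have h1 := h.algHom_comp (parityInv d)
  have h2 := (h.comp_algHom (parityInv d)).smul (zsign k)
  rw [← e] at h2
  refine LinearMap.congr_fun (twistedDer_ext h1 h2 fun z => ?_) f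
  simp only [LinearMap.comp_apply, AlgHom.toLinearMap_apply, vectorField_coord,
    LinearMap.smul_apply]
  have h3 := hX z
  have h4 := IsPar.coord d z
  unfold IsPar at h3 h4
  rw [h3, h4, map_smul, vectorField_coord, zsign_add, smul_smul, mul_comm]

namespace IsSuperDer

variable {d : Degrees Z} {k l : ZMod 2} {D D' : SuperFun d →ₗ[ℝ] SuperFun d}

theorem isPar (h : IsSuperDer d k D) {a : ZMod 2} {f : SuperFun d} (hf : IsPar d a f) :
    IsPar d (a + k) (D f) := by
  unfold IsPar at *
  rw [h.2, hf, map_smul, smul_smul, zsign_add, mul_comm]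

theorem add (h : IsSuperDer d k D) (h' : IsSuperDer d k D') : IsSuperDer d k (D + D') :=
  ⟨h.1.add h'.1, fun f => by simp [h.2 f, h'.2 f]⟩

theorem smul (h : IsSuperDer d k D) (c : ℝ) : IsSuperDer d k (c • D) :=
  ⟨h.1.smul c, fun f => by simp [h.2 f, smul_comm c]⟩

/-- The graded commutator `D D' - (-1)^{k l} D' D` of superderivations. -/
theorem commutator (h : IsSuperDer d k D) (h' : IsSuperDer d l D') :
    IsSuperDer d (k + l) (D ∘ₗ D' - zsign (k * l) • D' ∘ₗ D) := by
  have c : ∀ {k l : ZMod 2} {D : SuperFun d →ₗ[ℝ] SuperFun d}, IsSuperDer d k D → ∀ f,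
      D (parityPow d l f) = zsign (k * l) • parityPow d l (D f) := by
    intro k l D h f
    rcases zmod_two_cases l with rfl | rfl
    · simp
    · rw [parityPow_one, h.2, mul_one, smul_smul, zsign_mul_self, one_smul]
  refine ⟨fun f g => ?_, fun f => ?_⟩
  · simp only [LinearMap.sub_apply, LinearMap.comp_apply, LinearMap.smul_apply, h.1 f g,
      h'.1 f g, AlgHom.id_apply, map_add, h.1 _ _, h'.1 _ _]
    rw [c h, c h', ← parityPow_add, ← parityPow_add, add_comm l k, mul_comm l k]
    simp only [smul_add, smul_mul_assoc, mul_sub, mul_smul_comm, smul_smul, zsign_mul_self,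
      one_smul, sub_mul]
    abel
  · simp only [LinearMap.sub_apply, LinearMap.comp_apply, LinearMap.smul_apply, map_sub, map_smul,
      h.2, h'.2, smul_sub, smul_smul, zsign_add]
    congr 2
    ring

/-- The anticommutator of odd superderivations. -/
theorem anticommutator (h : IsSuperDer d 1 D) (h' : IsSuperDer d 1 D') :
    IsSuperDer d 0 (D ∘ₗ D' + D' ∘ₗ D) := by
  have := h.commutator h'
  rw [show (1 + 1 : ZMod 2) = 0 from rfl, mul_one, zsign_one] at this
  convert this using 1
  ext f
  simp

/-- Superderivations of the same parity that agree on the coordinates are equal. -/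
theorem ext (h : IsSuperDer d k D) (h' : IsSuperDer d k D')
    (e : ∀ z, D (coord d z) = D' (coord d z)) : D = D' := twistedDer_ext h.1 h'.1 e

/-- The chain rule: an algebra map intertwines two superderivations if it does so on
coordinates. -/
theorem intertwine {d' : Degrees Z'} {D' : SuperFun d' →ₗ[ℝ] SuperFun d'}
    (h : IsSuperDer d k D) (h' : IsSuperDer d' k D') (T : SuperFun d →ₐ[ℝ] SuperFun d')
    (hT : ∀ f, T (parityInv d f) = parityInv d' (T f))
    (e : ∀ z, T (D (coord d z)) = D' (T (coord d z))) (f : SuperFun d) : T (D f) = D' (T f) := by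
  have h1 := h.1.algHom_comp T
  have h2 := h'.1.comp_algHom T
  have : T.comp (parityPow d k) = (parityPow d' k).comp T := by
    ext f
    rcases zmod_two_cases k with rfl | rfl
    · simp
    · simp [hT]
  rw [← this] at h2
  exact LinearMap.congr_fun (twistedDer_ext h1 h2 e) f

end IsSuperDer

theorem map_parityInv {d : Degrees Z} {d' : Degrees Z'} (T : SuperFun d →ₐ[ℝ] SuperFun d')
    (hT : ∀ z, IsPar d' (d.par z) (T (coord d z))) (f : SuperFun d) :
    T (parityInv d f) = parityInv d' (T f) := by
  have : T.comp (parityInv d) = (parityInv d').comp T := algHom_ext fun z => by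
    have h1 := hT z
    have h2 := IsPar.coord d z
    unfold IsPar at h1 h2
    simp only [AlgHom.comp_apply, h1, h2, map_smul]
  exact AlgHom.congr_fun this f

/-! ### Homogeneous functions -/

/-- The Euler vector field that measures the ghost number. -/
def euler (d : Degrees Z) : SuperFun d →ₗ[ℝ] SuperFun d :=
  vectorField d fun z => (d.gh z : ℝ) • coord d z

theorem isSuperDer_euler (d : Degrees Z) : IsSuperDer d 0 (euler d) :=
  isSuperDer_vectorField d fun z => by rw [add_zero]; exact (IsPar.coord d z).smul _

theorem isHomog_iff {d : Degrees Z} {a : ZMod 2} {g : ℤ} {f : SuperFun d} :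
    IsHomog d a g f ↔ IsPar d a f ∧ euler d f = (g : ℝ) • f := Iff.rfl

theorem isHomog_coord (d : Degrees Z) (z : Z) : IsHomog d (d.par z) (d.gh z) (coord d z) :=
  isHomog_iff.2 ⟨IsPar.coord d z, vectorField_coord d _ z⟩

theorem IsHomog.smul {d : Degrees Z} {a : ZMod 2} {g : ℤ} {f : SuperFun d} (h : IsHomog d a g f)
    (c : ℝ) : IsHomog d a g (c • f) :=
  isHomog_iff.2 ⟨IsPar.smul h.1 c, by rw [map_smul, (isHomog_iff.1 h).2, smul_comm]⟩

/-- A superderivation which shifts the ghost number of the coordinates by `p` does so for all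
functions. -/
theorem IsSuperDer.isHomog {d : Degrees Z} {k : ZMod 2} {D : SuperFun d →ₗ[ℝ] SuperFun d}
    (h : IsSuperDer d k D) {p : ℤ}
    (hD : ∀ z, euler d (D (coord d z)) = ((d.gh z + p : ℤ) : ℝ) • D (coord d z))
    {a : ZMod 2} {g : ℤ} {f : SuperFun d} (hf : IsHomog d a g f) :
    IsHomog d (a + k) (g + p) (D f) := by
  -- The commutator of the Euler field with `D` and `p • D` are superderivations of the same parity
  -- that agree on coordinates, hence everywhere.
  have h1 := (isSuperDer_euler d).commutator h
  rw [zero_add, zero_mul, zsign_zero, one_smul] at h1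
  have h2 := IsSuperDer.ext h1 (h.smul p) fun z => by
    have : euler d (coord d z) = (d.gh z : ℝ) • coord d z := vectorField_coord d _ z
    simp only [LinearMap.sub_apply, LinearMap.comp_apply, hD, LinearMap.smul_apply, this, map_smul]
    push_cast
    rw [add_smul, add_sub_cancel_left]
  have h3 := LinearMap.congr_fun h2 f
  simp only [LinearMap.sub_apply, LinearMap.comp_apply, LinearMap.smul_apply] at h3
  refine isHomog_iff.2 ⟨h.isPar hf.1, ?_⟩
  rw [(isHomog_iff.1 hf).2, map_smul, sub_eq_iff_eq_add, ← add_smul] at h3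
  rw [h3]
  push_cast
  rw [add_comm]

theorem IsHomog.map {d : Degrees Z} {d' : Degrees Z'} (T : SuperFun d →ₐ[ℝ] SuperFun d')
    (hT : ∀ z, IsHomog d' (d.par z) (d.gh z) (T (SuperFun.coord d z)))
    {a : ZMod 2} {g : ℤ} {f : SuperFun d} (hf : IsHomog d a g f) : IsHomog d' a g (T f) := by
  have hp := map_parityInv T fun z => (hT z).1
  refine isHomog_iff.2 ⟨?_, ?_⟩
  · have := hf.1
    rw [IsPar, ← hp, this, map_smul]
    rfl
  · have := (isSuperDer_euler d).intertwine (isSuperDer_euler d') T hp (fun z => by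
      have h : euler d (SuperFun.coord d z) = (d.gh z : ℝ) • SuperFun.coord d z :=
        vectorField_coord d _ z
      rw [h, map_smul, (isHomog_iff.1 (hT z)).2]) f
    rw [← this, (isHomog_iff.1 hf).2, map_smul]

end SuperFun

/-! ### Substitution -/

namespace SmoothFun

/-- Composition of a smooth function with smooth functions. -/
def pullback {E E' : Type*} (b : E → SmoothFun E') : SmoothFun E →ₐ[ℝ] SmoothFun E' where
  toFun f := ⟨fun p => f.1 fun e => (b e).1 p, by
    classical
    obtain ⟨F, g, hg, hf⟩ := f.2
    choose G h hh e using fun i => (b i).2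
    refine ⟨F.biUnion G, fun q => g fun i => h i fun j =>
      q ⟨j, Finset.mem_biUnion.2 ⟨i, i.2, j.2⟩⟩, ?_, fun p => ?_⟩
    · exact hg.comp (contDiff_pi.2 fun i => (hh i).comp (by fun_prop))
    · change f.1 (fun e => (b e).1 p) = _
      rw [hf]
      simp only [e]⟩
  map_one' := rfl
  map_mul' _ _ := rfl
  map_zero' := rfl
  map_add' _ _ := rfl
  commutes' _ := rfl

theorem exists_rename_eq {E : Type*} (f : SmoothFun E) :
    ∃ F : Finset E, ∃ g : SmoothFun F, rename (fun i : F => (i : E)) g = f := by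
  obtain ⟨F, g, hg, hf⟩ := f.2
  exact ⟨F, ⟨g, Finset.univ, fun q => g fun i => q ⟨i, Finset.mem_univ _⟩, hg.comp (by fun_prop),
    fun p => rfl⟩, Subtype.ext (funext fun p => (hf p).symm)⟩

/-- An algebra map may be changed on one coordinate by a central element of square zero. -/
theorem exists_shift_of_sq_zero {E S : Type*} [Ring S] [Algebra ℝ S] (σ : SmoothFun E →ₐ[ℝ] S)
    (e : E) {c : S} (hc : ∀ b, c * b = b * c) (h0 : c * c = 0) :
    ∃ τ : SmoothFun E →ₐ[ℝ] S, τ (coord e) = σ (coord e) + c ∧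
      ∀ e', e' ≠ e → τ (coord e') = σ (coord e') := by
  have h1 : pd e (1 : SmoothFun E) = 0 := by
    have := pd_mul e (1 : SmoothFun E) 1
    rw [mul_one, one_mul, mul_one] at this
    exact left_eq_add.1 this
  -- The shifted map is the Taylor expansion `σ + c · σ ∘ ∂_e`. It is multiplicative because `c` is
  -- central and the quadratic term vanishes with `c²`.
  refine ⟨AlgHom.ofLinearMap (σ.toLinearMap +
    LinearMap.mulLeft ℝ c ∘ₗ σ.toLinearMap ∘ₗ pd e) ?_ ?_, ?_, fun e' he' => ?_⟩
  · simp [h1]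
  · intro f g
    simp only [LinearMap.add_apply, AlgHom.toLinearMap_apply, LinearMap.comp_apply,
      LinearMap.mulLeft_apply, map_mul, pd_mul, map_add]
    have e1 : c * σ (pd e f) * (c * σ (pd e g)) = 0 := by
      rw [← mul_assoc, mul_assoc c, ← hc, ← mul_assoc, h0, zero_mul, zero_mul]
    have e2 : σ f * (c * σ (pd e g)) = c * (σ f * σ (pd e g)) := by
      rw [← mul_assoc, ← hc, mul_assoc]
    simp only [add_mul, mul_add, e1, e2, add_zero, mul_assoc c (σ (pd e f)) (σ g)]
    abel
  · simp [pd_coord_self]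
  · simp [pd_coord_of_ne he']

/-- A sum of central elements of square zero need not have square zero, so the summands are added to
the coordinate one after the other. -/
theorem exists_shift {E S : Type*} [Ring S] [Algebra ℝ S] (e : E) {c : S}
    (hc : c ∈ AddSubmonoid.closure {c : S | (∀ b, c * b = b * c) ∧ c * c = 0})
    (σ : SmoothFun E →ₐ[ℝ] S) :
    ∃ τ : SmoothFun E →ₐ[ℝ] S, τ (coord e) = σ (coord e) + c ∧
      ∀ e', e' ≠ e → τ (coord e') = σ (coord e') := by
  induction hc using AddSubmonoid.closure_induction generalizing σ with
  | mem c hc => exact exists_shift_of_sq_zero σ e hc.1 hc.2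
  | zero => exact ⟨σ, by simp, fun _ _ => rfl⟩
  | add c c' _ _ ih ih' =>
    obtain ⟨τ, h, hn⟩ := ih σ
    obtain ⟨τ', h', hn'⟩ := ih' τ
    exact ⟨τ', by rw [h', h, add_assoc], fun e' he' => by rw [hn' e' he', hn e' he']⟩

end SmoothFun

namespace SuperFun

variable {Z Z' : Type*}

/-- An even superfunction is the sum of a smooth function and a nilpotent part. -/
theorem IsPar.exists_body {d : Degrees Z} {x : SuperFun d} (hx : IsPar d 0 x) :
    ∃ b, x - ofSmooth d b ∈
      AddSubmonoid.closure {c : SuperFun d | (∀ b, c * b = b * c) ∧ c * c = 0} := by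
  suffices ∀ y : SuperFun d, ∃ b, y + parityInv d y - ofSmooth d b ∈
      AddSubmonoid.closure {c : SuperFun d | (∀ b, c * b = b * c) ∧ c * c = 0} by
    -- For even `x`, the choice `y = x/2` gives `y + π y = x`.
    convert this ((1 / 2 : ℝ) • x) using 4
    unfold IsPar at hx
    rw [map_smul, hx, zsign_zero, one_smul, ← add_smul]
    norm_num
  intro y
  induction y using induction_on with
  | mul g a =>
    obtain ⟨r, hr⟩ := ExteriorAlgebra.even_part_mem_closure a
    refine ⟨r • g, ?_⟩
    have h1 : ofSmooth d g * ofExt d a + parityInv d (ofSmooth d g * ofExt d a) -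
        ofSmooth d (r • g) = ofSmooth d g *
          ofExt d (a + CliffordAlgebra.involute a - algebraMap ℝ _ r) := by
      rw [parityInv_mul, map_sub, map_add, mul_sub, mul_add, map_smul, AlgHom.commutes,
        Algebra.algebraMap_eq_smul_one, mul_smul_comm, mul_one]
    rw [h1]
    generalize a + CliffordAlgebra.involute a - algebraMap ℝ _ r = t at hr
    induction hr using AddSubmonoid.closure_induction with
    | mem c hc =>
      refine AddSubmonoid.subset_closure ⟨fun f => ?_, ?_⟩
      · induction f using induction_on with
        | mul h b =>
          rw [mul_assoc, ← mul_assoc (ofExt d _) (ofSmooth d h), ← (ofSmooth_comm d h _).eq,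
            mul_assoc, mul_assoc, ← map_mul (ofExt d), ← mul_assoc (ofExt d b),
            ← (ofSmooth_comm d g b).eq, mul_assoc, ← map_mul (ofExt d), ← mul_assoc, ← mul_assoc,
            ← map_mul, ← map_mul, mul_comm g h, hc.1]
        | add f g hf hg => rw [mul_add, add_mul, hf, hg]
      · rw [mul_assoc, ← mul_assoc (ofExt d _) (ofSmooth d g), ← (ofSmooth_comm d g _).eq,
          mul_assoc, ← map_mul (ofExt d), hc.2, map_zero, mul_zero, mul_zero]
    | zero => rw [map_zero, mul_zero]; exact zero_mem _
    | add c c' _ _ ih ih' => rw [map_add, mul_add]; exact add_mem ih ih'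
  | add f g hf hg =>
    obtain ⟨b, hb⟩ := hf
    obtain ⟨b', hb'⟩ := hg
    refine ⟨b + b', ?_⟩
    convert add_mem hb hb' using 1
    simp only [map_add]
    abel

/-- A smooth function of the coordinates in `F` feels an algebra map only through its values on
these coordinates. This glues the substitutions for different finite sets. -/
theorem smooth_algHom_congr {E : Type*} {d : Degrees Z} {σ τ : SmoothFun E →ₐ[ℝ] SuperFun d}
    {F : Finset E} (h : ∀ e ∈ F, σ (SmoothFun.coord e) = τ (SmoothFun.coord e))
    (g : SmoothFun F) : σ (SmoothFun.rename (fun i : F => (i : E)) g) =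
      τ (SmoothFun.rename (fun i : F => (i : E)) g) := by
  have := smooth_twistedDer_eq_zero (IsTwistedDer.sub_algHom
    (σ.comp (SmoothFun.rename fun i : F => (i : E)))
    (τ.comp (SmoothFun.rename fun i : F => (i : E)))) (fun e => sub_eq_zero.2 (h e.1 e.2)) g
  exact sub_eq_zero.1 this

theorem exists_smooth_subst_finset {E : Type*} (d : Degrees Z) {a : E → SuperFun d}
    (ha : ∀ e, IsPar d 0 (a e)) (F : Finset E) : ∃ σ : SmoothFun E →ₐ[ℝ] SuperFun d,
      ∀ e ∈ F, σ (SmoothFun.coord e) = a e := by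
  classical
  choose b hb using fun e => (ha e).exists_body
  -- The induction records that coordinates outside `F` are still mapped to their bodies, so that
  -- the next shift has a known starting value.
  suffices ∃ σ : SmoothFun E →ₐ[ℝ] SuperFun d, (∀ e ∈ F, σ (SmoothFun.coord e) = a e) ∧
      ∀ e ∉ F, σ (SmoothFun.coord e) = ofSmooth d (b e) from this.imp fun σ h => h.1
  induction F using Finset.induction_on with
  | empty =>
    exact ⟨(ofSmooth d).comp (SmoothFun.pullback b), by simp, fun e _ => rfl⟩
  | insert e F he ih =>
    obtain ⟨σ, h1, h2⟩ := ih
    obtain ⟨τ, h, hn⟩ := SmoothFun.exists_shift e (hb e) σ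
    refine ⟨τ, fun e' he' => ?_, fun e' he' => ?_⟩
    · rcases Finset.mem_insert.1 he' with rfl | hF
      · rw [h, h2 _ he]; abel
      · rw [hn e' fun h => he (h ▸ hF), h1 e' hF]
    · rw [Finset.mem_insert, not_or] at he'
      rw [hn e' he'.1, h2 e' he'.2]

/-- Infinitely many coordinates may have to be shifted, but each function depends on finitely many.
Its image is computed with a map adapted to these, and any larger finite set gives the same result.
-/
theorem exists_smooth_subst {E : Type*} (d : Degrees Z) {a : E → SuperFun d}
    (ha : ∀ e, IsPar d 0 (a e)) : ∃ σ : SmoothFun E →ₐ[ℝ] SuperFun d,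
      ∀ e, σ (SmoothFun.coord e) = a e := by
  classical
  choose σ hσ using exists_smooth_subst_finset d ha
  choose supp g hg using fun f : SmoothFun E => SmoothFun.exists_rename_eq f
  have key : ∀ f F, supp f ⊆ F → σ (supp f) f = σ F f := by
    intro f F h
    have := smooth_algHom_congr (σ := σ (supp f)) (τ := σ F)
      (fun e he => by rw [hσ _ e he, hσ _ e (h he)]) (g f)
    rwa [hg f] at this
  have sub : ∀ f f' f'', ∃ F, supp f ⊆ F ∧ supp f' ⊆ F ∧ supp f'' ⊆ F := fun f f' f'' =>
    ⟨supp f ∪ (supp f' ∪ supp f''), Finset.subset_union_left,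
      Finset.subset_union_left.trans Finset.subset_union_right,
      Finset.subset_union_right.trans Finset.subset_union_right⟩
  refine ⟨{ toFun := fun f => σ (supp f) f, map_one' := map_one _, map_zero' := map_zero _,
            commutes' := fun r => AlgHom.commutes _ r, map_mul' := fun f f' => ?_,
            map_add' := fun f f' => ?_ }, fun e => ?_⟩
  · obtain ⟨F, h1, h2, h3⟩ := sub f f' (f * f')
    rw [key f F h1, key f' F h2, key (f * f') F h3, map_mul]
  · obtain ⟨F, h1, h2, h3⟩ := sub f f' (f + f')
    rw [key f F h1, key f' F h2, key (f + f') F h3, map_add]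
  · change σ (supp (SmoothFun.coord e)) (SmoothFun.coord e) = a e
    rw [key _ (insert e (supp (SmoothFun.coord e))) (Finset.subset_insert _ _),
      hσ _ e (Finset.mem_insert_self _ _)]

/-- Superfunctions of the right parities may be substituted for the variables. -/
theorem exists_subst (d : Degrees Z) (d' : Degrees Z') {a : Z → SuperFun d'}
    (ha : ∀ z, IsPar d' (d.par z) (a z)) : ∃ T : SuperFun d →ₐ[ℝ] SuperFun d',
      ∀ z, T (coord d z) = a z := by
  obtain ⟨σ, hσ⟩ := exists_smooth_subst d' (a := fun e : {z // d.par z = 0} => a e)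
    fun e => by simpa [e.2] using ha e
  -- Composing `σ` with the parity involution does not change it on coordinates, so its image is
  -- even. Even elements are central, which yields the commutation needed to map out of the tensor
  -- product.
  have hσ' : ∀ f, IsPar d' 0 (σ f) := by
    intro f
    have := smooth_twistedDer_eq_zero (IsTwistedDer.sub_algHom ((parityInv d').comp σ) σ)
      (fun e => by
        have h := ha e
        rw [e.2, IsPar, zsign_zero, one_smul] at h
        simp [hσ, h]) f
    rw [IsPar, zsign_zero, one_smul]
    exact sub_eq_zero.1 this
  let l : ({z // d.par z = 1} →₀ ℝ) →ₗ[ℝ] SuperFun d' :=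
    Finsupp.linearCombination ℝ fun z : {z // d.par z = 1} => a z
  have hl : ∀ v, IsPar d' 1 (l v) := by
    intro v
    simp only [l, Finsupp.linearCombination_apply, Finsupp.sum]
    exact IsPar.sum fun i _ => IsPar.smul (by simpa [i.2] using ha i) _
  let τ : ExteriorAlgebra ℝ ({z // d.par z = 1} →₀ ℝ) →ₐ[ℝ] SuperFun d' :=
    ExteriorAlgebra.lift ℝ ⟨l, fun v => by
      have h1 := (hl v).mul_comm (l v)
      have h2 := hl v
      rw [IsPar, zsign_one, neg_smul, one_smul] at h2
      rw [parityPow_one, h2, neg_mul] at h1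
      have h3 : (2 : ℝ) • (l v * l v) = 0 := by
        rw [two_smul]
        exact add_eq_zero_iff_eq_neg.2 h1
      exact (smul_eq_zero.1 h3).resolve_left two_ne_zero⟩
  have hστ : ∀ f a, Commute (σ f) (τ a) := fun f a => by
    have := (hσ' f).mul_comm (τ a)
    rwa [parityPow_zero, AlgHom.id_apply] at this
  let T : SuperFun d →ₐ[ℝ] SuperFun d' :=
    (Algebra.TensorProduct.lift σ τ hστ).comp (toTensor d).toAlgHom
  have hT : ∀ g b, T (ofSmooth d g * ofExt d b) = σ g * τ b := by
    intro g b
    rw [ofSmooth_mul_ofExt]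
    exact Algebra.TensorProduct.lift_tmul σ τ hστ g b
  refine ⟨T, fun z => ?_⟩
  rcases zmod_two_cases (d.par z) with h | h
  · have := hT (SmoothFun.coord ⟨z, h⟩) 1
    rw [map_one, mul_one, map_one, mul_one] at this
    rw [coord_even d h, this, hσ]
  · have := hT 1 (ExteriorAlgebra.ι ℝ (Finsupp.single ⟨z, h⟩ 1))
    rw [map_one, one_mul, map_one, one_mul] at this
    rw [coord_odd d h, this]
    simp [τ, l]

end SuperFun

/-! ### Powers of operators -/

section Powers

variable {n : ℕ} {V W : Type*} [AddCommGroup V] [Module ℝ V] [AddCommGroup W] [Module ℝ W]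

@[simp] theorem symPow_zero (D : Fin n → V →ₗ[ℝ] V) : symPow D 0 = LinearMap.id := by
  unfold symPow
  refine List.prod_eq_one fun x hx => ?_
  obtain ⟨μ, -, rfl⟩ := List.mem_map.1 hx
  exact pow_zero _

theorem map_symPow {D : Fin n → V →ₗ[ℝ] V} {D' : Fin n → W →ₗ[ℝ] W} {T : V →ₗ[ℝ] W}
    (h : ∀ μ f, T (D μ f) = D' μ (T f)) (m : MultiIdx n) (f : V) :
    T (symPow D m f) = symPow D' m (T f) := by
  unfold symPow
  induction List.finRange n with
  | nil => rfl
  | cons μ l ih =>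
    rw [List.map_cons, List.prod_cons, List.map_cons, List.prod_cons, Module.End.mul_apply,
      Module.End.mul_apply, ← ih]
    generalize (List.map (fun μ => (D μ ^ m μ : Module.End ℝ V)) l).prod f = v
    induction m μ with
    | zero => rfl
    | succ k ihk => rw [pow_succ', pow_succ', Module.End.mul_apply, Module.End.mul_apply, h, ihk]

theorem symPow_add_single {D : Fin n → V →ₗ[ℝ] V} (hD : ∀ μ ν f, D μ (D ν f) = D ν (D μ f))
    (m : MultiIdx n) (ν : Fin n) (f : V) :
    symPow D (m + Pi.single ν 1) f = D ν (symPow D m f) := by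
  have key : ∀ l : List (Fin n), l.Nodup → ν ∈ l →
      (l.map fun μ => (D μ ^ (m + Pi.single ν 1 : MultiIdx n) μ : Module.End ℝ V)).prod =
        D ν * (l.map fun μ => (D μ ^ m μ : Module.End ℝ V)).prod := by
    intro l
    induction l with
    | nil => simp
    | cons μ l ih =>
      intro hn hν
      rw [List.nodup_cons] at hn
      simp only [List.map_cons, List.prod_cons]
      by_cases h : ν = μ
      · subst h
        have : (l.map fun μ => (D μ ^ (m + Pi.single ν 1 : MultiIdx n) μ : Module.End ℝ V)) =
            l.map fun μ => (D μ ^ m μ : Module.End ℝ V) := by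
          refine List.map_congr_left fun μ hμ => ?_
          have : μ ≠ ν := fun h => hn.1 (h ▸ hμ)
          simp [this]
        rw [this, ← mul_assoc, Pi.add_apply, Pi.single_eq_same, pow_succ']
      · rw [ih hn.2 ((List.mem_cons.1 hν).resolve_left h), ← mul_assoc, ← mul_assoc,
          Pi.add_apply, Pi.single_eq_of_ne (Ne.symm h), add_zero]
        congr 1
        have : Commute (D μ : Module.End ℝ V) (D ν) := LinearMap.ext fun f => hD μ ν f
        exact (this.pow_left _).eq
  have := key (List.finRange n) (List.nodup_finRange n) (List.mem_finRange ν)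
  exact LinearMap.congr_fun this f

/-- Along a family on which each `D μ` just raises the index, no commutativity of the operators has
to be assumed. -/
theorem symPow_add {D : Fin n → V →ₗ[ℝ] V} (C : MultiIdx n → V)
    (hC : ∀ μ k, D μ (C k) = C (k + Pi.single μ 1)) (m k : MultiIdx n) :
    symPow D m (C k) = C (k + m) := by
  have h1 : ∀ (μ : Fin n) (a : ℕ) k, (D μ ^ a : Module.End ℝ V) (C k) =
      C (k + Pi.single μ a) := by
    intro μ a
    induction a with
    | zero => intro k; simp
    | succ a ih =>
      intro k
      rw [pow_succ', Module.End.mul_apply, ih, hC, add_assoc, ← Pi.single_add]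
  have key : ∀ l : List (Fin n),
      (l.map fun μ => (D μ ^ m μ : Module.End ℝ V)).prod (C k) =
        C (k + (l.map fun μ => (Pi.single μ (m μ) : MultiIdx n)).sum) := by
    intro l
    induction l with
    | nil => simp
    | cons μ l ih =>
      rw [List.map_cons, List.prod_cons, Module.End.mul_apply, ih, h1, List.map_cons,
        List.sum_cons, add_assoc, add_comm (List.sum _)]
  unfold symPow
  rw [key, ← List.ofFn_eq_map, List.sum_ofFn, Finset.univ_sum_single]

@[simp] theorem skewPow_empty (D : Fin n → V →ₗ[ℝ] V) : skewPow D ∅ = LinearMap.id := by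
  simp [skewPow]
  rfl

theorem length_filter_finRange (N : Finset (Fin n)) :
    ((List.finRange n).filter (· ∈ N)).length = N.card := by
  rw [← List.toFinset_card_of_nodup ((List.nodup_finRange n).filter _)]
  congr 1
  ext
  simp

/-- Each index contributes one factor `c`; the values `1` and `-1` cover operators that commute and
anticommute with `T`. -/
theorem map_skewPow {D : Fin n → V →ₗ[ℝ] V} {D' : Fin n → W →ₗ[ℝ] W} {T : V →ₗ[ℝ] W} {c : ℝ}
    (h : ∀ μ f, T (D μ f) = c • D' μ (T f)) (N : Finset (Fin n)) (f : V) :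
    T (skewPow D N f) = c ^ N.card • skewPow D' N (T f) := by
  rw [← length_filter_finRange]
  unfold skewPow
  induction (List.finRange n).filter (· ∈ N) with
  | nil => simp
  | cons μ l ih =>
    rw [List.map_cons, List.prod_cons, List.map_cons, List.prod_cons, Module.End.mul_apply,
      Module.End.mul_apply, h, ih, map_smul, smul_smul, List.length_cons, pow_succ']

/-- `D ν` must be moved past the factors with smaller index to reach its place, and `orderSign`
counts them. The induction runs over sorted lists. -/
theorem skewPow_insert {D : Fin n → V →ₗ[ℝ] V} (hD : ∀ μ ν f, D μ (D ν f) = -D ν (D μ f))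
    {ν : Fin n} {N : Finset (Fin n)} (hν : ν ∉ N) (f : V) :
    D ν (skewPow D N f) = BRSTTheory.orderSign ν N • skewPow D (insert ν N) f := by
  have key : ∀ l : List (Fin n), l.Pairwise (· < ·) → ν ∈ l →
      D ν (((l.filter (· ∈ N)).map fun ν => (D ν : Module.End ℝ V)).prod f) =
        (-1 : ℝ) ^ (l.filter (· ∈ N.filter (· < ν))).length •
          ((l.filter (· ∈ insert ν N)).map fun ν => (D ν : Module.End ℝ V)).prod f := by
    intro l
    induction l with
    | nil => simp
    | cons μ l ih =>
      intro hl hm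
      rw [List.pairwise_cons] at hl
      by_cases h : ν = μ
      · subst h
        have h1 : l.filter (· ∈ insert ν N) = l.filter (· ∈ N) := by
          refine List.filter_congr fun a ha => ?_
          have := (hl.1 a ha).ne'
          simp [this]
        have h2 : l.filter (· ∈ N.filter (· < ν)) = [] := by
          refine List.filter_eq_nil_iff.2 fun a ha => ?_
          have := (hl.1 a ha).le
          simp [this]
        rw [List.filter_cons_of_neg (by simpa using hν), List.filter_cons_of_neg (by simp),
          List.filter_cons_of_pos (by simp), h1, h2]
        simp
      · have hl' := (List.mem_cons.1 hm).resolve_left h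
        have hlt := hl.1 ν hl'
        have ih := ih hl.2 hl'
        by_cases hμ : μ ∈ N
        · rw [List.filter_cons_of_pos (by simpa using hμ),
            List.filter_cons_of_pos (by simp [hμ, hlt]),
            List.filter_cons_of_pos (by simp [hμ]), List.map_cons, List.prod_cons,
            Module.End.mul_apply, hD, ih, map_smul, List.length_cons, pow_succ, List.map_cons,
            List.prod_cons, Module.End.mul_apply, mul_neg_one, neg_smul]
        · rw [List.filter_cons_of_neg (by simpa using hμ),
            List.filter_cons_of_neg (by simp [hμ]),
            List.filter_cons_of_neg (by simp [hμ, Ne.symm h]), ih]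
  have h1 := key (List.finRange n) (List.pairwise_lt_finRange n) (List.mem_finRange ν)
  rw [length_filter_finRange] at h1
  exact h1

/-- `D ν` travels to its second copy, and anticommutativity forces `2 (D ν)² = 0`. -/
theorem skewPow_mem {D : Fin n → V →ₗ[ℝ] V} (hD : ∀ μ ν f, D μ (D ν f) = -D ν (D μ f))
    {ν : Fin n} {N : Finset (Fin n)} (hν : ν ∈ N) (f : V) : D ν (skewPow D N f) = 0 := by
  have key : ∀ l : List (Fin n), ν ∈ l →
      D ν ((l.map fun ν => (D ν : Module.End ℝ V)).prod f) = 0 := by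
    intro l
    induction l with
    | nil => simp
    | cons μ l ih =>
      intro hm
      rw [List.map_cons, List.prod_cons, Module.End.mul_apply]
      by_cases h : ν = μ
      · subst h
        have h2 : (2 : ℝ) • D ν (D ν ((l.map fun ν => (D ν : Module.End ℝ V)).prod f)) = 0 := by
          rw [two_smul]
          exact add_eq_zero_iff_eq_neg.2 (hD _ _ _)
        exact (smul_eq_zero.1 h2).resolve_left two_ne_zero
      · rw [hD, ih ((List.mem_cons.1 hm).resolve_left h), map_zero, neg_zero]
  exact key _ (by simp [hν])

theorem orderSign_mul_self (ν : Fin n) (N : Finset (Fin n)) :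
    BRSTTheory.orderSign ν N * BRSTTheory.orderSign ν N = 1 := by
  unfold BRSTTheory.orderSign
  rw [← mul_pow]
  simp

theorem skewPow_insert' {D : Fin n → V →ₗ[ℝ] V} (hD : ∀ μ ν f, D μ (D ν f) = -D ν (D μ f))
    {ν : Fin n} {N : Finset (Fin n)} (hν : ν ∉ N) (f : V) :
    skewPow D (insert ν N) f = BRSTTheory.orderSign ν N • D ν (skewPow D N f) := by
  rw [skewPow_insert hD hν, smul_smul, orderSign_mul_self, one_smul]

theorem orderSign_insert_self (ν : Fin n) (N : Finset (Fin n)) :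
    BRSTTheory.orderSign ν (insert ν N) = BRSTTheory.orderSign ν N := by
  unfold BRSTTheory.orderSign
  rw [Finset.filter_insert, if_neg (lt_irrefl _)]

theorem orderSign_erase_self (ν : Fin n) (N : Finset (Fin n)) :
    BRSTTheory.orderSign ν (N.erase ν) = BRSTTheory.orderSign ν N := by
  unfold BRSTTheory.orderSign
  rw [Finset.filter_erase, Finset.erase_eq_of_notMem (by simp)]

theorem orderSign_insert {μ ν : Fin n} {N : Finset (Fin n)} (hν : ν ∉ N) :
    BRSTTheory.orderSign μ (insert ν N) =
      (if ν < μ then -1 else 1) * BRSTTheory.orderSign μ N := by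
  unfold BRSTTheory.orderSign
  rw [Finset.filter_insert]
  split_ifs with h
  · rw [Finset.card_insert_of_notMem (by simp [hν]), pow_succ']
  · rw [one_mul]

/-- Exactly one of `ν < μ` and `μ < ν` holds, so exactly one of the two insertions changes the
count. This sign makes the `∂^F/∂θ^ν` anticommute. -/
theorem orderSign_swap {μ ν : Fin n} {N : Finset (Fin n)} (hμ : μ ∉ N) (hν : ν ∉ N)
    (h : μ ≠ ν) : BRSTTheory.orderSign ν N * BRSTTheory.orderSign μ (insert ν N) =
      -(BRSTTheory.orderSign μ N * BRSTTheory.orderSign ν (insert μ N)) := by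
  rw [orderSign_insert hν, orderSign_insert hμ]
  rcases lt_or_gt_of_ne h with h | h
  · rw [if_neg h.not_gt, if_pos h]; ring
  · rw [if_neg h.not_gt, if_pos h]; ring

/-- The analogue for inserting `ν` and removing `μ`; it cancels the off-diagonal terms in
`shift_anticomm_thetaD`. -/
theorem orderSign_erase_swap {μ ν : Fin n} {N : Finset (Fin n)} (hμ : μ ∈ N) (hν : ν ∉ N) :
    BRSTTheory.orderSign ν N * BRSTTheory.orderSign μ (insert ν N) =
      -(BRSTTheory.orderSign μ N * BRSTTheory.orderSign ν (N.erase μ)) := by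
  have h : μ ≠ ν := fun h => hν (h ▸ hμ)
  have h1 := orderSign_insert (μ := ν) (Finset.notMem_erase μ N)
  rw [Finset.insert_erase hμ] at h1
  rw [orderSign_insert hν, h1]
  rcases lt_or_gt_of_ne h with h | h
  · rw [if_neg h.not_gt, if_pos h]; ring
  · rw [if_neg h.not_gt, if_pos h]; ring

end Powers

/-! ### Vector fields over the superspace with coordinates `x`, `θ` -/

namespace SuperFun

variable {Z Z' : Type*}

theorem pd_eq_vectorField [DecidableEq Z] (d : Degrees Z) (z : Z) :
    pd d z = vectorField d (Pi.single z 1) := by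
  ext f
  rw [vectorField_apply, finsum_eq_single _ z, Pi.single_eq_same, one_mul]
  intro z' h
  rw [Pi.single_eq_of_ne h, zero_mul]

theorem isSuperDer_pd (d : Degrees Z) {z : Z} {k : ZMod 2} (hk : d.par z = k) :
    IsSuperDer d k (pd d z) := by
  classical
  subst hk
  rw [pd_eq_vectorField]
  refine isSuperDer_vectorField d fun z' => ?_
  by_cases h : z' = z
  · subst h
    rw [Pi.single_eq_same, CharTwo.add_self_eq_zero]
    exact IsPar.one
  · rw [Pi.single_eq_of_ne h]
    exact IsPar.zero

theorem rename_coord {d : Degrees Z} {d' : Degrees Z'} (i : Z → Z')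
    (h : ∀ z, d'.par (i z) = d.par z) (z : Z) :
    rename d d' i h (coord d z) = coord d' (i z) := by
  have key : ∀ g a, rename d d' i h (ofSmooth d g * ofExt d a) =
      ofSmooth d' (SmoothFun.rename (fun z : {z // d.par z = 0} => ⟨i z, (h z).trans z.2⟩) g) *
      ofExt d' (ExteriorAlgebra.map (Finsupp.lmapDomain ℝ ℝ
      fun z : {z // d.par z = 1} => (⟨i z, (h z).trans z.2⟩ : {z // d'.par z = 1})) a) := by
    intro g a
    rw [ofSmooth_mul_ofExt, ofSmooth_mul_ofExt]
    rfl
  rcases zmod_two_cases (d.par z) with hz | hz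
  · have := key (SmoothFun.coord ⟨z, hz⟩) 1
    rw [map_one, mul_one, map_one, map_one, mul_one] at this
    rw [coord_even d hz, this, coord_even d' ((h z).trans hz)]
    rfl
  · have := key 1 (ExteriorAlgebra.ι ℝ (Finsupp.single ⟨z, hz⟩ 1))
    rw [map_one, one_mul, map_one, map_one, one_mul, ExteriorAlgebra.map_apply_ι] at this
    rw [coord_odd d hz, this, coord_odd d' ((h z).trans hz), Finsupp.lmapDomain_apply,
      Finsupp.mapDomain_single]

theorem isHomog_zero (d : Degrees Z) (a : ZMod 2) (g : ℤ) : IsHomog d a g (0 : SuperFun d) :=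
  isHomog_iff.2 ⟨IsPar.zero, by rw [map_zero, smul_zero]⟩

end SuperFun


section Fibred

variable {n : ℕ} {J J' : Type*} {d : Degrees J} {d' : Degrees J'}

@[simp] theorem fibVF_x (a b : Fin n → FibFun n d) (c : J → FibFun n d) (μ : Fin n) :
    fibVF d a b c (xVar d μ) = a μ := vectorField_coord _ _ _

@[simp] theorem fibVF_th (a b : Fin n → FibFun n d) (c : J → FibFun n d) (μ : Fin n) :
    fibVF d a b c (thVar d μ) = b μ := vectorField_coord _ _ _

@[simp] theorem fibVF_fib (a b : Fin n → FibFun n d) (c : J → FibFun n d) (j : J) :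
    fibVF d a b c (fibVar n d j) = c j := vectorField_coord _ _ _

theorem isPar_thVar (d : Degrees J) (μ : Fin n) : IsPar (d.withBase n) 1 (thVar d μ) :=
  IsPar.coord (d.withBase n) (.th μ)

theorem isPar_fibVar (d : Degrees J) (j : J) : IsPar (d.withBase n) (d.par j) (fibVar n d j) :=
  IsPar.coord (d.withBase n) (.fib j)

theorem isHomog_fibVar (d : Degrees J) (j : J) :
    IsHomog (d.withBase n) (d.par j) (d.gh j) (fibVar n d j) :=
  isHomog_coord (d.withBase n) (.fib j)

theorem isSuperDer_fibVF {k : ZMod 2} {a b : Fin n → FibFun n d} {c : J → FibFun n d}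
    (ha : ∀ μ, IsPar (d.withBase n) k (a μ)) (hb : ∀ μ, IsPar (d.withBase n) (1 + k) (b μ))
    (hc : ∀ j, IsPar (d.withBase n) (d.par j + k) (c j)) :
    IsSuperDer (d.withBase n) k (fibVF d a b c) := by
  refine isSuperDer_vectorField _ fun z => ?_
  rcases z with μ | μ | j
  · simpa [Degrees.withBase] using ha μ
  · exact hb μ
  · exact hc j

theorem SuperFun.IsSuperDer.ext_fib {k : ZMod 2} {D D' : FibFun n d →ₗ[ℝ] FibFun n d}
    (h : IsSuperDer (d.withBase n) k D) (h' : IsSuperDer (d.withBase n) k D')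
    (hx : ∀ μ, D (xVar d μ) = D' (xVar d μ)) (ht : ∀ μ, D (thVar d μ) = D' (thVar d μ))
    (hf : ∀ j, D (fibVar n d j) = D' (fibVar n d j)) : D = D' :=
  h.ext h' fun z => match z with
    | .x μ => hx μ
    | .th μ => ht μ
    | .fib j => hf j

/-- An algebra map intertwines two superderivations if it does so on the coordinates. -/
theorem SuperFun.IsSuperDer.intertwine_fib {k : ZMod 2} {D : FibFun n d →ₗ[ℝ] FibFun n d}
    {D' : FibFun n d' →ₗ[ℝ] FibFun n d'} (h : IsSuperDer (d.withBase n) k D)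
    (h' : IsSuperDer (d'.withBase n) k D') (T : FibFun n d →ₐ[ℝ] FibFun n d')
    (hT : ∀ f, T (parityInv _ f) = parityInv _ (T f))
    (hx : ∀ μ, T (D (xVar d μ)) = D' (T (xVar d μ)))
    (ht : ∀ μ, T (D (thVar d μ)) = D' (T (thVar d μ)))
    (hf : ∀ j, T (D (fibVar n d j)) = D' (T (fibVar n d j))) (f : FibFun n d) :
    T (D f) = D' (T f) :=
  h.intertwine h' T hT (fun z => match z with
    | .x μ => hx μ
    | .th μ => ht μ
    | .fib j => hf j) f

theorem fib_algHom_ext {φ ψ : FibFun n d →ₐ[ℝ] FibFun n d'}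
    (hx : ∀ μ, φ (xVar d μ) = ψ (xVar d μ)) (ht : ∀ μ, φ (thVar d μ) = ψ (thVar d μ))
    (hf : ∀ j, φ (fibVar n d j) = ψ (fibVar n d j)) : φ = ψ :=
  algHom_ext fun z => match z with
    | .x μ => hx μ
    | .th μ => ht μ
    | .fib j => hf j

/-- Algebra maps over the superspace with coordinates `x`, `θ`, which respect parity. -/
structure IsOverBase (T : FibFun n d →ₐ[ℝ] FibFun n d') : Prop where
  map_x : ∀ μ, T (xVar d μ) = xVar d' μ
  map_th : ∀ μ, T (thVar d μ) = thVar d' μ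
  isPar : ∀ j, IsPar (d'.withBase n) (d.par j) (T (fibVar n d j))

namespace IsOverBase

variable {T : FibFun n d →ₐ[ℝ] FibFun n d'}

theorem map_parityInv (h : IsOverBase T) (f : FibFun n d) :
    T (parityInv _ f) = parityInv _ (T f) :=
  SuperFun.map_parityInv T (fun z => match z with
    | .x μ => by erw [h.map_x]; exact IsPar.coord (d'.withBase n) (.x μ)
    | .th μ => by erw [h.map_th]; exact IsPar.coord (d'.withBase n) (.th μ)
    | .fib j => h.isPar j) f

theorem map_isPar (h : IsOverBase T) {a : ZMod 2} {f : FibFun n d}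
    (hf : IsPar (d.withBase n) a f) : IsPar (d'.withBase n) a (T f) := by
  unfold IsPar at *
  rw [← h.map_parityInv, hf, map_smul]

theorem map_isHomog (h : IsOverBase T)
    (hg : ∀ j, IsHomog (d'.withBase n) (d.par j) (d.gh j) (T (fibVar n d j)))
    {a : ZMod 2} {g : ℤ} {f : FibFun n d} (hf : IsHomog (d.withBase n) a g f) :
    IsHomog (d'.withBase n) a g (T f) :=
  hf.map T fun z => match z with
    | .x μ => by erw [h.map_x]; exact isHomog_coord (d'.withBase n) (.x μ)
    | .th μ => by erw [h.map_th]; exact isHomog_coord (d'.withBase n) (.th μ)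
    | .fib j => hg j

end IsOverBase

theorem exists_fib_subst (d : Degrees J) (d' : Degrees J') {a : J → FibFun n d'}
    (ha : ∀ j, IsPar (d'.withBase n) (d.par j) (a j)) :
    ∃ T : FibFun n d →ₐ[ℝ] FibFun n d', IsOverBase T ∧ ∀ j, T (fibVar n d j) = a j := by
  obtain ⟨T, hT⟩ := exists_subst (d.withBase n) (d'.withBase n)
    (a := fun | .x μ => xVar d' μ | .th μ => thVar d' μ | .fib j => a j)
    (fun z => match z with
      | .x μ => IsPar.coord (d'.withBase n) (.x μ)
      | .th μ => IsPar.coord (d'.withBase n) (.th μ)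
      | .fib j => ha j)
  exact ⟨T, ⟨fun μ => hT (.x μ), fun μ => hT (.th μ), fun j => by
    rw [show T (fibVar n d j) = a j from hT (.fib j)]; exact ha j⟩, fun j => hT (.fib j)⟩

theorem fibRename_coord (i : J → J') (h : ∀ j, d'.par (i j) = d.par j) (z : BaseFib n J) :
    fibRename n d d' i h (coord (d.withBase n) z) = coord (d'.withBase n)
      (match z with | .x μ => .x μ | .th μ => .th μ | .fib j => .fib (i j)) := by
  unfold fibRename
  rw [rename_coord]
  cases z <;> rfl

theorem fibRename_fib (i : J → J') (h : ∀ j, d'.par (i j) = d.par j) (j : J) :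
    fibRename n d d' i h (fibVar n d j) = fibVar n d' (i j) :=
  fibRename_coord i h (.fib j)

theorem isOverBase_fibRename (i : J → J') (h : ∀ j, d'.par (i j) = d.par j) :
    IsOverBase (fibRename n d d' i h) :=
  ⟨fun μ => fibRename_coord i h (.x μ), fun μ => fibRename_coord i h (.th μ), fun j => by
    rw [fibRename_fib, ← h]; exact isPar_fibVar d' (i j)⟩

theorem pd_th_x (μ ν : Fin n) : pd (d.withBase n) (.th ν) (xVar d μ) = 0 :=
  pd_coord_of_ne _ (by simp)

theorem pd_th_th (μ ν : Fin n) :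
    pd (d.withBase n) (.th ν) (thVar d μ) = if μ = ν then 1 else 0 := by
  split_ifs with h
  · subst h; exact pd_coord_self _ _
  · exact pd_coord_of_ne _ (by simpa using h)

theorem pd_th_fib (j : J) (ν : Fin n) : pd (d.withBase n) (.th ν) (fibVar n d j) = 0 :=
  pd_coord_of_ne _ (by simp)

theorem pd_x_x (μ ν : Fin n) :
    pd (d.withBase n) (.x ν) (xVar d μ) = if μ = ν then 1 else 0 := by
  split_ifs with h
  · subst h; exact pd_coord_self _ _
  · exact pd_coord_of_ne _ (by simpa using h)

theorem pd_x_th (μ ν : Fin n) : pd (d.withBase n) (.x ν) (thVar d μ) = 0 :=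
  pd_coord_of_ne _ (by simp)

theorem pd_x_fib (j : J) (ν : Fin n) : pd (d.withBase n) (.x ν) (fibVar n d j) = 0 :=
  pd_coord_of_ne _ (by simp)

theorem isSuperDer_pd_th (d : Degrees J) (ν : Fin n) :
    IsSuperDer (d.withBase n) 1 (pd (d.withBase n) (.th ν)) := by
  have h : (d.withBase n).par (.th ν) = 1 := by rfl
  exact isSuperDer_pd _ h

theorem isSuperDer_pd_x (d : Degrees J) (ν : Fin n) :
    IsSuperDer (d.withBase n) 0 (pd (d.withBase n) (.x ν)) := by
  have h : (d.withBase n).par (.x ν) = 0 := by rfl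
  exact isSuperDer_pd _ h

end Fibred

/-! ### Total derivatives -/

section Jets

variable {n : ℕ} {F F' : Type*} {d : Degrees F}

theorem isSuperDer_totalD (d : Degrees F) (μ : Fin n) :
    IsSuperDer ((d.jet n).withBase n) 0 (totalD d μ) := by
  refine isSuperDer_fibVF (fun ν => ?_) (fun _ => IsPar.zero) fun z => ?_
  · by_cases h : ν = μ
    · subst h; rw [Pi.single_eq_same]; exact IsPar.one
    · rw [Pi.single_eq_of_ne h]; exact IsPar.zero
  · rw [add_zero]
    exact isPar_fibVar (d.jet n) (z.1, z.2 + Pi.single μ 1)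

@[simp] theorem totalD_x (μ ν : Fin n) :
    totalD d μ (xVar (d.jet n) ν) = if ν = μ then 1 else 0 := by
  rw [totalD, fibVF_x, Pi.single_apply]

@[simp] theorem totalD_th (μ ν : Fin n) : totalD d μ (thVar (d.jet n) ν) = 0 := by
  rw [totalD, fibVF_th]; rfl

@[simp] theorem totalD_fib (μ : Fin n) (f : F) (m : MultiIdx n) :
    totalD d μ (fibVar n (d.jet n) (f, m)) = fibVar n (d.jet n) (f, m + Pi.single μ 1) := by
  rw [totalD, fibVF_fib]

/-- Superderivations commute in the graded sense if their graded commutator vanishes on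
coordinates. -/
theorem SuperFun.IsSuperDer.graded_commute {J : Type*} {d : Degrees J} {k l : ZMod 2}
    {D D' : FibFun n d →ₗ[ℝ] FibFun n d}
    (h : IsSuperDer (d.withBase n) k D) (h' : IsSuperDer (d.withBase n) l D')
    (hx : ∀ μ, D (D' (xVar d μ)) = zsign (k * l) • D' (D (xVar d μ)))
    (ht : ∀ μ, D (D' (thVar d μ)) = zsign (k * l) • D' (D (thVar d μ)))
    (hf : ∀ j, D (D' (fibVar n d j)) = zsign (k * l) • D' (D (fibVar n d j)))
    (f : FibFun n d) : D (D' f) = zsign (k * l) • D' (D f) := by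
  have := IsSuperDer.ext_fib (D' := 0) (h.commutator h') ⟨fun f g => by simp, fun f => by simp⟩
    (fun μ => sub_eq_zero.2 (hx μ)) (fun μ => sub_eq_zero.2 (ht μ)) fun j => sub_eq_zero.2 (hf j)
  exact sub_eq_zero.1 (LinearMap.congr_fun this f)

theorem SuperFun.IsSuperDer.commute {J : Type*} {d : Degrees J} {l : ZMod 2}
    {D D' : FibFun n d →ₗ[ℝ] FibFun n d}
    (h : IsSuperDer (d.withBase n) 0 D) (h' : IsSuperDer (d.withBase n) l D')
    (hx : ∀ μ, D (D' (xVar d μ)) = D' (D (xVar d μ)))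
    (ht : ∀ μ, D (D' (thVar d μ)) = D' (D (thVar d μ)))
    (hf : ∀ j, D (D' (fibVar n d j)) = D' (D (fibVar n d j)))
    (f : FibFun n d) : D (D' f) = D' (D f) := by
  have := h.graded_commute h' (by simpa using hx) (by simpa using ht) (by simpa using hf) f
  simpa using this

theorem SuperFun.IsSuperDer.anticommute {J : Type*} {d : Degrees J}
    {D D' : FibFun n d →ₗ[ℝ] FibFun n d}
    (h : IsSuperDer (d.withBase n) 1 D) (h' : IsSuperDer (d.withBase n) 1 D')
    (hx : ∀ μ, D (D' (xVar d μ)) = -D' (D (xVar d μ)))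
    (ht : ∀ μ, D (D' (thVar d μ)) = -D' (D (thVar d μ)))
    (hf : ∀ j, D (D' (fibVar n d j)) = -D' (D (fibVar n d j)))
    (f : FibFun n d) : D (D' f) = -D' (D f) := by
  have := h.graded_commute h' (by simpa using hx) (by simpa using ht) (by simpa using hf) f
  simpa using this

theorem SuperFun.IsSuperDer.apply_ite {Z : Type*} {d : Degrees Z} {k : ZMod 2}
    {D : SuperFun d →ₗ[ℝ] SuperFun d} (h : IsSuperDer d k D) (p : Prop) [Decidable p] :
    D (if p then 1 else 0) = 0 := by
  split_ifs
  · exact h.1.apply_one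
  · exact map_zero D

theorem totalD_comm (μ ν : Fin n) (f : LocFun n d) :
    totalD d μ (totalD d ν f) = totalD d ν (totalD d μ f) := by
  refine (isSuperDer_totalD d μ).commute (isSuperDer_totalD d ν) (fun k => ?_) (fun k => ?_)
    (fun z => ?_) f
  · simp only [totalD_x, (isSuperDer_totalD d _).apply_ite]
  · simp
  · obtain ⟨f, m⟩ := z
    rw [totalD_fib, totalD_fib, totalD_fib, totalD_fib, add_right_comm]

theorem symPow_totalD_fib (f : F) (m k : MultiIdx n) :
    symPow (totalD d) m (fibVar n (d.jet n) (f, k)) = fibVar n (d.jet n) (f, k + m) :=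
  symPow_add (fun k => fibVar n (d.jet n) (f, k)) (fun μ k => totalD_fib μ f k) m k

theorem isHomog_totalD (μ : Fin n) {a : ZMod 2} {g : ℤ} {f : LocFun n d}
    (hf : IsHomog ((d.jet n).withBase n) a g f) :
    IsHomog ((d.jet n).withBase n) a g (totalD d μ f) := by
  have h := (isSuperDer_totalD d μ).isHomog (p := 0) (fun z => ?_) hf
  · simpa using h
  rcases z with ν | ν | ⟨f, m⟩
  · change euler _ (totalD d μ (xVar (d.jet n) ν)) = (((0 : ℤ) + 0 : ℤ) : ℝ) •
      (totalD d μ (xVar (d.jet n) ν))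
    rw [totalD_x, (isSuperDer_euler _).apply_ite]
    simp
  · change euler _ (totalD d μ (thVar (d.jet n) ν)) = _ • (totalD d μ (thVar (d.jet n) ν))
    rw [totalD_th, map_zero, smul_zero]
  · change euler _ (totalD d μ (fibVar n (d.jet n) (f, m))) = _ •
      (totalD d μ (fibVar n (d.jet n) (f, m)))
    rw [totalD_fib, add_zero]
    exact (isHomog_iff.1 (isHomog_fibVar (d.jet n) (f, m + Pi.single μ 1))).2

theorem symPow_induction {V : Type*} [AddCommGroup V] [Module ℝ V] {D : Fin n → V →ₗ[ℝ] V}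
    {P : V → Prop} (h : ∀ μ f, P f → P (D μ f)) (m : MultiIdx n) {f : V} (hf : P f) :
    P (symPow D m f) := by
  unfold symPow
  induction List.finRange n with
  | nil => exact hf
  | cons μ l ih =>
    rw [List.map_cons, List.prod_cons, Module.End.mul_apply]
    generalize (List.map (fun μ => (D μ ^ m μ : Module.End ℝ V)) l).prod f = v at ih
    induction m μ with
    | zero => exact ih
    | succ k ihk => rw [pow_succ', Module.End.mul_apply]; exact h _ _ ihk

end Jets

/-! ### The fields of the parent theory -/

section Theta

variable {n : ℕ} {J J' : Type*} (d : Degrees J)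

/-- The vector field `c ∂/∂θ^ν + ∂^F/∂θ^ν`. -/
def thetaD (c : ℝ) (ν : Fin n) : LocFun n (d.theta n) →ₗ[ℝ] LocFun n (d.theta n) :=
  c • pd _ (.th ν) + fibVF ((d.theta n).jet n) 0 0 fun z =>
    if ν ∈ z.1.2 then 0 else (zsign (d.par z.1.1) * BRSTTheory.orderSign ν z.1.2) •
      fibVar n ((d.theta n).jet n) ((z.1.1, insert ν z.1.2), z.2)

theorem theta_par_insert {ν : Fin n} {j : J} {N : Finset (Fin n)} (h : ν ∉ N) :
    (d.theta n).par (j, insert ν N) = (d.theta n).par (j, N) + 1 := by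
  simp only [Degrees.theta]
  rw [Finset.card_insert_of_notMem h, Nat.cast_succ, add_assoc]

theorem theta_gh_insert {ν : Fin n} {j : J} {N : Finset (Fin n)} (h : ν ∉ N) :
    (d.theta n).gh (j, insert ν N) = (d.theta n).gh (j, N) + -1 := by
  simp only [Degrees.theta]
  rw [Finset.card_insert_of_notMem h]
  push_cast
  ring

theorem isSuperDer_thetaD (c : ℝ) (ν : Fin n) :
    IsSuperDer (((d.theta n).jet n).withBase n) 1 (thetaD d c ν) := by
  refine IsSuperDer.add ((isSuperDer_pd_th _ ν).smul c)
    (isSuperDer_fibVF (fun _ => IsPar.zero) (fun _ => IsPar.zero) fun z => ?_)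
  obtain ⟨⟨j, N⟩, m⟩ := z
  change IsPar _ _ (if ν ∈ N then 0 else _)
  split_ifs with h
  · exact IsPar.zero
  · refine IsPar.smul ?_ _
    have := isPar_fibVar (n := n) ((d.theta n).jet n) ((j, insert ν N), m)
    rwa [show ((d.theta n).jet n).par ((j, insert ν N), m) =
      ((d.theta n).jet n).par ((j, N), m) + 1 from theta_par_insert d h] at this

variable {d} {c c' : ℝ}

@[simp] theorem thetaD_x (μ ν : Fin n) : thetaD d c ν (xVar _ μ) = 0 := by
  rw [thetaD, LinearMap.add_apply, fibVF_x, LinearMap.smul_apply, pd_th_x, smul_zero, zero_add]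
  rfl

@[simp] theorem thetaD_th (μ ν : Fin n) :
    thetaD d c ν (thVar _ μ) = c • if μ = ν then 1 else 0 := by
  rw [thetaD, LinearMap.add_apply, fibVF_th, LinearMap.smul_apply, pd_th_th]
  exact add_zero _

theorem thetaD_fib (ν : Fin n) (j : J) (N : Finset (Fin n)) (m : MultiIdx n) :
    thetaD d c ν (fibVar n _ ((j, N), m)) =
      if ν ∈ N then 0 else (zsign (d.par j) * BRSTTheory.orderSign ν N) •
        fibVar n _ ((j, insert ν N), m) := by
  rw [thetaD, LinearMap.add_apply, fibVF_fib, LinearMap.smul_apply, pd_th_fib, smul_zero, zero_add]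

/-- The constants may differ: `0` gives `∂^F/∂θ^ν` and `1` gives `∂^θ_ν`. The mixed case is what
later isolates the explicit `∂/∂θ^ν`. -/
theorem thetaD_anticomm (μ ν : Fin n) (f : LocFun n (d.theta n)) :
    thetaD d c μ (thetaD d c' ν f) = -thetaD d c' ν (thetaD d c μ f) := by
  have h := isSuperDer_thetaD (n := n) d
  refine (h c μ).anticommute (h c' ν) (fun k => ?_) (fun k => ?_) (fun z => ?_) f
  · simp
  · simp only [thetaD_th, map_smul, (h _ _).apply_ite, smul_zero, neg_zero]
  · obtain ⟨⟨j, N⟩, m⟩ := z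
    rw [thetaD_fib, thetaD_fib]
    by_cases h1 : ν ∈ N <;> by_cases h2 : μ ∈ N
    · rw [if_pos h1, if_pos h2, map_zero, map_zero, neg_zero]
    · rw [if_pos h1, if_neg h2, map_zero, map_smul, thetaD_fib,
        if_pos (Finset.mem_insert_of_mem h1), smul_zero, neg_zero]
    · rw [if_neg h1, if_pos h2, map_zero, map_smul, thetaD_fib,
        if_pos (Finset.mem_insert_of_mem h2), smul_zero, neg_zero]
    · rw [if_neg h1, if_neg h2, map_smul, map_smul, thetaD_fib, thetaD_fib]
      by_cases h3 : μ = ν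
      · subst h3
        rw [if_pos (Finset.mem_insert_self _ _), smul_zero, neg_zero]
      · rw [if_neg (by simp [h2, h3]), if_neg (by simp [h1, Ne.symm h3]), smul_smul, smul_smul,
          ← neg_smul, Finset.insert_comm]
        congr 1
        linear_combination (zsign (d.par j) * zsign (d.par j)) * orderSign_swap h2 h1 h3

theorem totalD_thetaD (μ ν : Fin n) (f : LocFun n (d.theta n)) :
    totalD (d.theta n) μ (thetaD d c ν f) = thetaD d c ν (totalD (d.theta n) μ f) := by
  refine (isSuperDer_totalD (d.theta n) μ).commute (isSuperDer_thetaD d c ν) (fun k => ?_)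
    (fun k => ?_) (fun z => ?_) f
  · rw [thetaD_x, totalD_x, (isSuperDer_thetaD d c ν).apply_ite, map_zero]
  · rw [thetaD_th, totalD_th, map_smul, (isSuperDer_totalD _ μ).apply_ite, map_zero, smul_zero]
  · obtain ⟨⟨j, N⟩, m⟩ := z
    rw [thetaD_fib, totalD_fib, thetaD_fib]
    split_ifs
    · exact map_zero _
    · rw [map_smul, totalD_fib]

/-- The ordering sign of `∂^θ_ν` on a coordinate cancels the one from inserting `ν` into the
product, so each index leaves only the factor `(-1)^{|ψ|}`. -/
theorem skewPow_thetaD_fib (j : J) (N : Finset (Fin n)) (m : MultiIdx n) :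
    skewPow (thetaD d c) N (fibVar n _ ((j, ∅), m)) =
      zsign (d.par j) ^ N.card • fibVar n _ ((j, N), m) := by
  induction N using Finset.induction_on with
  | empty => simp
  | insert ν N h ih =>
    rw [skewPow_insert' thetaD_anticomm h, ih, map_smul, thetaD_fib, if_neg h, smul_smul, smul_smul,
      Finset.card_insert_of_notMem h]
    congr 1
    rw [pow_succ]
    linear_combination (zsign (d.par j) ^ N.card * zsign (d.par j)) * orderSign_mul_self ν N

theorem isHomog_thetaD_one (ν : Fin n) {a : ZMod 2} {g : ℤ} {f : LocFun n (d.theta n)}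
    (hf : IsHomog _ a g f) : IsHomog _ (a + 1) (g + -1) (thetaD d 1 ν f) := by
  refine (isSuperDer_thetaD d 1 ν).isHomog (fun z => ?_) hf
  rcases z with μ | μ | ⟨⟨j, N⟩, m⟩
  · change euler _ (thetaD d 1 ν (xVar _ μ)) = _ • thetaD d 1 ν (xVar _ μ)
    rw [thetaD_x, map_zero, smul_zero]
  · change euler _ (thetaD d 1 ν (thVar _ μ)) = (((1 : ℤ) + -1 : ℤ) : ℝ) •
      thetaD d 1 ν (thVar _ μ)
    rw [thetaD_th, one_smul, (isSuperDer_euler _).apply_ite]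
    simp
  · change euler _ (thetaD d 1 ν (fibVar n _ ((j, N), m))) = (((d.theta n).gh (j, N) + -1 : ℤ) : ℝ) •
      thetaD d 1 ν (fibVar n _ ((j, N), m))
    rw [thetaD_fib]
    split_ifs with h
    · rw [map_zero, smul_zero]
    · rw [map_smul, smul_comm, (isHomog_iff.1 (isHomog_fibVar ((d.theta n).jet n)
        ((j, insert ν N), m))).2, ← theta_gh_insert d h]
      rfl

theorem isHomog_skewPow (N : Finset (Fin n)) {a : ZMod 2} {g : ℤ} {f : LocFun n (d.theta n)}
    (hf : IsHomog _ a g f) :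
    IsHomog _ (a + N.card) (g - N.card) (skewPow (thetaD d 1) N f) := by
  induction N using Finset.induction_on with
  | empty => simpa using hf
  | insert ν N h ih =>
    rw [skewPow_insert' thetaD_anticomm h]
    refine IsHomog.smul ?_ _
    have := isHomog_thetaD_one ν ih
    rw [Finset.card_insert_of_notMem h]
    push_cast
    rw [← add_assoc, ← sub_sub]
    exact this

theorem isPar_skewPow (N : Finset (Fin n)) {a : ZMod 2} {f : LocFun n (d.theta n)}
    (hf : IsPar _ a f) : IsPar _ (a + N.card) (skewPow (thetaD d c) N f) := by
  induction N using Finset.induction_on with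
  | empty => simpa using hf
  | insert ν N h ih =>
    rw [skewPow_insert' thetaD_anticomm h]
    refine IsPar.smul ?_ _
    rw [Finset.card_insert_of_notMem h, Nat.cast_succ, ← add_assoc]
    exact (isSuperDer_thetaD d c ν).isPar ih

end Theta

/-! ### Prolongation of coordinate changes to the parent theory -/

section Prolongation

variable {n : ℕ} {J J' J'' F' : Type*}

/-- Functions of `x`, `θ`, `ψ` as functions of `x`, `θ`, `ψ_{()[]}`. -/
def parentIncl (n : ℕ) (d : Degrees J) : FibFun n d →ₐ[ℝ] LocFun n (d.theta n) :=
  fibRename n d ((d.theta n).jet n) (fun j => ((j, ∅), 0)) fun j => by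
    simp [Degrees.jet, Degrees.theta]

variable {d : Degrees J} {d' : Degrees J'} {d'' : Degrees J''}

theorem isOverBase_parentIncl : IsOverBase (parentIncl n d) := isOverBase_fibRename _ _

theorem parentIncl_fib (j : J) :
    parentIncl n d (fibVar n d j) = fibVar n _ ((j, ∅), 0) := fibRename_fib _ _ j

theorem isHomog_parentIncl {a : ZMod 2} {g : ℤ} {f : FibFun n d} (hf : IsHomog _ a g f) :
    IsHomog _ a g (parentIncl n d f) := by
  refine isOverBase_parentIncl.map_isHomog (fun j => ?_) hf
  rw [parentIncl_fib]
  convert isHomog_fibVar (n := n) ((d.theta n).jet n) ((j, ∅), 0) using 1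
  · simp [Degrees.jet, Degrees.theta]
  · simp [Degrees.jet, Degrees.theta]

/-- The coordinate `ψ_{(m)[N]}` as a descendant of `ψ`. -/
theorem fibVar_eq_descendant (j : J) (N : Finset (Fin n)) (m : MultiIdx n) :
    fibVar n ((d.theta n).jet n) ((j, N), m) = zsign (d.par j) ^ N.card •
      symPow (totalD (d.theta n)) m (skewPow (thetaD d 1) N (parentIncl n d (fibVar n d j))) := by
  rw [parentIncl_fib, skewPow_thetaD_fib, map_smul, symPow_totalD_fib, zero_add, smul_smul,
    ← mul_pow, zsign_mul_self, one_pow, one_smul]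

/-- `P` is the prolongation of the map `T`. -/
structure IsProlongation (T : FibFun n d' →ₐ[ℝ] FibFun n d)
    (P : LocFun n (d'.theta n) →ₐ[ℝ] LocFun n (d.theta n)) : Prop where
  map_x : ∀ μ, P (xVar _ μ) = xVar _ μ
  map_th : ∀ μ, P (thVar _ μ) = thVar _ μ
  incl : ∀ f, P (parentIncl n d' f) = parentIncl n d (T f)
  totalD : ∀ μ f, P (totalD _ μ f) = totalD _ μ (P f)
  thetaD : ∀ ν f, P (thetaD d' 1 ν f) = thetaD d 1 ν (P f)

namespace IsProlongation

theorem map_descendant {T : FibFun n d' →ₐ[ℝ] FibFun n d}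
    {P : LocFun n (d'.theta n) →ₐ[ℝ] LocFun n (d.theta n)} (h : IsProlongation T P)
    (N : Finset (Fin n)) (m : MultiIdx n) (f : FibFun n d') :
    P (symPow (_root_.totalD (d'.theta n)) m (skewPow (_root_.thetaD d' 1) N
      (parentIncl n d' f))) =
      symPow (_root_.totalD (d.theta n)) m (skewPow (_root_.thetaD d 1) N
        (parentIncl n d (T f))) := by
  have h1 := map_symPow (T := P.toLinearMap) h.totalD m
    (skewPow (_root_.thetaD d' 1) N (parentIncl n d' f))
  have h2 := map_skewPow (T := P.toLinearMap) (c := 1)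
    (fun ν f => by rw [one_smul]; exact h.thetaD ν f) N (parentIncl n d' f)
  rw [one_pow, one_smul] at h2
  simp only [AlgHom.toLinearMap_apply] at h1 h2
  rw [h1, h2, h.incl]

/-- By `fibVar_eq_descendant` every fibre coordinate is, up to sign, a descendant of some `ψ`, and
the image of a descendant is forced. -/
theorem unique {T : FibFun n d' →ₐ[ℝ] FibFun n d}
    {P P' : LocFun n (d'.theta n) →ₐ[ℝ] LocFun n (d.theta n)} (h : IsProlongation T P)
    (h' : IsProlongation T P') : P = P' := by
  refine fib_algHom_ext (fun μ => by rw [h.map_x, h'.map_x])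
    (fun μ => by rw [h.map_th, h'.map_th]) fun z => ?_
  obtain ⟨⟨j, N⟩, m⟩ := z
  rw [fibVar_eq_descendant, map_smul, map_smul, h.map_descendant, h'.map_descendant]

theorem comp {T : FibFun n d' →ₐ[ℝ] FibFun n d}
    {P : LocFun n (d'.theta n) →ₐ[ℝ] LocFun n (d.theta n)} {T' : FibFun n d'' →ₐ[ℝ] FibFun n d'}
    {P' : LocFun n (d''.theta n) →ₐ[ℝ] LocFun n (d'.theta n)} (h : IsProlongation T P)
    (h' : IsProlongation T' P') : IsProlongation (T.comp T') (P.comp P') where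
  map_x μ := by rw [AlgHom.comp_apply, h'.map_x, h.map_x]
  map_th μ := by rw [AlgHom.comp_apply, h'.map_th, h.map_th]
  incl f := by rw [AlgHom.comp_apply, h'.incl, h.incl]; rfl
  totalD μ f := by rw [AlgHom.comp_apply, h'.totalD, h.totalD]; rfl
  thetaD μ f := by rw [AlgHom.comp_apply, h'.thetaD, h.thetaD]; rfl

theorem id : IsProlongation (AlgHom.id ℝ (FibFun n d)) (AlgHom.id ℝ _) where
  map_x _ := rfl
  map_th _ := rfl
  incl _ := rfl
  totalD _ _ := rfl
  thetaD _ _ := rfl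

end IsProlongation

/-- The images of the coordinates are forced by `fibVar_eq_descendant`. Substitution supplies an
algebra map with these values, and the chain rule on coordinates shows that it intertwines the
derivatives. -/
theorem exists_prolongation {T : FibFun n d' →ₐ[ℝ] FibFun n d} (hT : IsOverBase T) :
    ∃ P : LocFun n (d'.theta n) →ₐ[ℝ] LocFun n (d.theta n), IsProlongation T P := by
  obtain ⟨P, hP, h⟩ := exists_fib_subst (n := n) ((d'.theta n).jet n) ((d.theta n).jet n)
    (a := fun z => zsign (d'.par z.1.1) ^ z.1.2.card • symPow (totalD (d.theta n)) z.2
      (skewPow (thetaD d 1) z.1.2 (parentIncl n d (T (fibVar n d' z.1.1)))))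
    (fun z => IsPar.smul (symPow_induction (P := IsPar _ (((d'.theta n).jet n).par z))
      (fun μ f hf => by simpa using (isSuperDer_totalD (d.theta n) μ).isPar hf) _
      (isPar_skewPow _ (isOverBase_parentIncl.map_isPar (hT.isPar _)))) _)
  have hD : ∀ μ f, P (totalD _ μ f) = totalD _ μ (P f) := by
    intro μ
    refine (isSuperDer_totalD _ μ).intertwine_fib (isSuperDer_totalD _ μ) P hP.map_parityInv
      (fun ν => ?_) (fun ν => ?_) fun z => ?_
    · rw [hP.map_x, totalD_x, totalD_x]
      split_ifs <;> simp
    · rw [hP.map_th, totalD_th, totalD_th, map_zero]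
    · obtain ⟨⟨j, N⟩, m⟩ := z
      rw [totalD_fib, h, h, map_smul]
      dsimp only
      rw [symPow_add_single totalD_comm]
  refine ⟨P, hP.map_x, hP.map_th, fun f => ?_, hD, fun ν f => ?_⟩
  · have : P.comp (parentIncl n d') = (parentIncl n d).comp T := by
      refine fib_algHom_ext (fun μ => ?_) (fun μ => ?_) fun j => ?_
      · simp only [AlgHom.comp_apply, isOverBase_parentIncl.map_x, hP.map_x, hT.map_x]
      · simp only [AlgHom.comp_apply, isOverBase_parentIncl.map_th, hP.map_th, hT.map_th]
      · simp only [AlgHom.comp_apply, parentIncl_fib, h]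
        simp
    exact AlgHom.congr_fun this f
  · refine (isSuperDer_thetaD d' 1 ν).intertwine_fib (isSuperDer_thetaD d 1 ν) P hP.map_parityInv
      (fun μ => ?_) (fun μ => ?_) (fun z => ?_) f
    · rw [hP.map_x, thetaD_x, thetaD_x, map_zero]
    · rw [hP.map_th, thetaD_th, thetaD_th, map_smul]
      split_ifs <;> simp
    · obtain ⟨⟨j, N⟩, m⟩ := z
      rw [thetaD_fib, h, map_smul]
      dsimp only
      have hc : ∀ m f, thetaD d 1 ν (symPow (totalD (d.theta n)) m f) =
          symPow (totalD (d.theta n)) m (thetaD d 1 ν f) := fun m f =>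
        map_symPow (fun μ f => (totalD_thetaD μ ν f).symm) m f
      rw [hc]
      split_ifs with hν
      · rw [skewPow_mem thetaD_anticomm hν, map_zero, map_zero, smul_zero]
      · rw [skewPow_insert thetaD_anticomm hν, map_smul, map_smul, h, smul_smul, smul_smul]
        dsimp only
        congr 1
        rw [Finset.card_insert_of_notMem hν, pow_succ]
        linear_combination (zsign (d'.par j) ^ N.card * BRSTTheory.orderSign ν N) *
          zsign_mul_self (d'.par j)

theorem CoordChange.isOverBase (T : CoordChange n d' d) :
    IsOverBase (T.equiv : FibFun n d' →ₐ[ℝ] FibFun n d) :=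
  ⟨T.map_x, T.map_th, fun j => (T.map_homog j).1⟩

theorem CoordChange.isOverBase_symm (T : CoordChange n d' d) :
    IsOverBase (T.equiv.symm : FibFun n d →ₐ[ℝ] FibFun n d') := by
  refine ⟨fun μ => ?_, fun μ => ?_, fun j => ?_⟩
  · exact T.equiv.symm_apply_eq.2 (T.map_x μ).symm
  · exact T.equiv.symm_apply_eq.2 (T.map_th μ).symm
  · refine T.equiv.injective ?_
    have h1 := T.isOverBase.map_parityInv (T.equiv.symm (fibVar n d j))
    have h2 := isPar_fibVar (n := n) d j
    unfold IsPar at h2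
    simp only [AlgEquiv.coe_toAlgHom, AlgEquiv.apply_symm_apply] at h1 ⊢
    rw [h1, map_smul, AlgEquiv.apply_symm_apply, h2]

/-- Coordinate changes over the base may be prolonged to the parent theory. -/
theorem CoordChange.exists_prolongation (T : CoordChange n d' d) :
    ∃ P : LocFun n (d'.theta n) ≃ₐ[ℝ] LocFun n (d.theta n),
      IsProlongation (T.equiv : FibFun n d' →ₐ[ℝ] FibFun n d)
        (P : LocFun n (d'.theta n) →ₐ[ℝ] LocFun n (d.theta n)) := by
  obtain ⟨P, hP⟩ := _root_.exists_prolongation T.isOverBase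
  obtain ⟨P', hP'⟩ := _root_.exists_prolongation T.isOverBase_symm
  -- Both composites prolong the identity, so by uniqueness they are the identity.
  have h1 := hP.comp hP'
  have h2 := hP'.comp hP
  rw [AlgEquiv.comp_symm] at h1
  rw [AlgEquiv.symm_comp] at h2
  exact ⟨AlgEquiv.ofAlgHom P P' (h1.unique .id) (h2.unique .id), hP⟩

/-- Relabelling of the fields of the parent theory, with the signs that turn the coordinates
`ψ_{[N]}` into descendants. -/
theorem exists_relabel {dF : Degrees F'} (e : F' ≃ J' × Finset (Fin n))
    (hp : ∀ f, dF.par f = (d'.theta n).par (e f)) :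
    ∃ R : LocFun n dF ≃ₐ[ℝ] LocFun n (d'.theta n), (∀ μ, R (xVar _ μ) = xVar _ μ) ∧
      (∀ μ, R (thVar _ μ) = thVar _ μ) ∧ ∀ f m, R (fibVar n _ (f, m)) =
        zsign (d'.par (e f).1) ^ (e f).2.card • fibVar n ((d'.theta n).jet n) (e f, m) := by
  obtain ⟨R, hR, h⟩ := exists_fib_subst (n := n) (dF.jet n) ((d'.theta n).jet n)
    (a := fun z => zsign (d'.par (e z.1).1) ^ (e z.1).2.card •
      fibVar n ((d'.theta n).jet n) (e z.1, z.2))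
    (fun z => IsPar.smul (by
      rw [show (dF.jet n).par z = ((d'.theta n).jet n).par (e z.1, z.2) from hp z.1]
      exact isPar_fibVar _ _) _)
  obtain ⟨R', hR', h'⟩ := exists_fib_subst (n := n) ((d'.theta n).jet n) (dF.jet n)
    (a := fun z => zsign (d'.par z.1.1) ^ z.1.2.card • fibVar n (dF.jet n) (e.symm z.1, z.2))
    (fun z => IsPar.smul (by
      have := hp (e.symm z.1)
      rw [e.apply_symm_apply] at this
      rw [show ((d'.theta n).jet n).par z = (dF.jet n).par (e.symm z.1, z.2) from this.symm]
      exact isPar_fibVar _ _) _)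
  have sq : ∀ (a : ZMod 2) (k : ℕ), zsign a ^ k * zsign a ^ k = 1 := fun a k => by
    rw [← mul_pow, zsign_mul_self, one_pow]
  refine ⟨AlgEquiv.ofAlgHom R R' ?_ ?_, hR.map_x, hR.map_th, fun f m => h (f, m)⟩
  · refine fib_algHom_ext (fun μ => ?_) (fun μ => ?_) fun z => ?_
    · rw [AlgHom.comp_apply, hR'.map_x, hR.map_x]; rfl
    · rw [AlgHom.comp_apply, hR'.map_th, hR.map_th]; rfl
    · rw [AlgHom.comp_apply, h', map_smul, h, smul_smul, AlgHom.id_apply]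
      dsimp only
      rw [e.apply_symm_apply, sq, one_smul]
  · refine fib_algHom_ext (fun μ => ?_) (fun μ => ?_) fun z => ?_
    · rw [AlgHom.comp_apply, hR.map_x, hR'.map_x]; rfl
    · rw [AlgHom.comp_apply, hR.map_th, hR'.map_th]; rfl
    · rw [AlgHom.comp_apply, h, map_smul, h', smul_smul, AlgHom.id_apply]
      dsimp only
      rw [e.symm_apply_apply, sq, one_smul]

/-- A change of coordinates over the base induces a change of fields of the parent theory: the new
fields are the descendants of the new coordinates. -/
theorem CoordChange.exists_fieldChange (T : CoordChange n d' d) {dF : Degrees F'}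
    (e : F' ≃ J' × Finset (Fin n)) (hp : ∀ f, dF.par f = (d'.theta n).par (e f))
    (hg : ∀ f, dF.gh f = (d'.theta n).gh (e f)) :
    ∃ T' : FieldChange n dF (d.theta n), ∀ f, T'.field f =
      skewPow (thetaD d 1) (e f).2 (parentIncl n d (T.new (e f).1)) := by
  obtain ⟨P, hP⟩ := T.exists_prolongation
  obtain ⟨R, hx, ht, hR⟩ := exists_relabel e hp
  -- The relabelling carries the sign that relates `ψ_{(m)[N]}` to a descendant; the two copies of
  -- it cancel, so the new fields are descendants without signs.
  have key : ∀ f m, P (R (fibVar n (dF.jet n) (f, m))) = symPow (totalD (d.theta n)) m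
      (skewPow (thetaD d 1) (e f).2 (parentIncl n d (T.new (e f).1))) := by
    intro f m
    have h1 := hP.map_descendant (e f).2 m (fibVar n d' (e f).1)
    have h2 := fibVar_eq_descendant (d := d') (e f).1 (e f).2 m
    rw [hR, h2, smul_smul, ← mul_pow, zsign_mul_self, one_pow, one_smul]
    exact h1
  refine ⟨⟨⟨R.trans P, fun μ => ?_, fun μ => ?_, fun z => ?_⟩, fun f m => ?_⟩, fun f => ?_⟩
  · rw [AlgEquiv.trans_apply, hx]; exact hP.map_x μ
  · rw [AlgEquiv.trans_apply, ht]; exact hP.map_th μ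
  · obtain ⟨f, m⟩ := z
    rw [AlgEquiv.trans_apply, key]
    have h1 := isHomog_skewPow (e f).2 (isHomog_parentIncl (T.map_homog (e f).1))
    rw [show (dF.jet n).par (f, m) = d'.par (e f).1 + (e f).2.card from hp f,
      show (dF.jet n).gh (f, m) = d'.gh (e f).1 - (e f).2.card from hg f]
    exact symPow_induction (fun μ f hf => isHomog_totalD μ hf) m h1
  · rw [AlgEquiv.trans_apply, AlgEquiv.trans_apply, key, key, symPow_zero, LinearMap.id_apply]
  · refine (key f 0).trans ?_
    rw [symPow_zero, LinearMap.id_apply]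

end Prolongation

/-! ### The differential of the extended parent theory -/

section Shift

variable {n : ℕ} {J : Type*} {d : Degrees J}

/-- The graded commutator of `∂^θ_ν` with an operator that moves an index from `[ν]` to another
place. -/
theorem shift_anticomm_thetaD {c : ℝ} {X : LocFun n (d.theta n) →ₗ[ℝ] LocFun n (d.theta n)}
    {E : Fin n → LocFun n (d.theta n) →ₗ[ℝ] LocFun n (d.theta n)} {e : Fin n → J → J}
    {g : Fin n → MultiIdx n → MultiIdx n} (he : ∀ ν j, d.par (e ν j) = d.par j)
    (hX : IsSuperDer _ 1 X) (hE : ∀ ν, IsSuperDer _ 0 (E ν))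
    (hXx : ∀ μ, X (xVar _ μ) = 0) (hXt : ∀ μ, X (thVar _ μ) = 0)
    (hEx : ∀ ν μ, E ν (xVar _ μ) = 0) (hEt : ∀ ν μ, E ν (thVar _ μ) = 0)
    (hEf : ∀ ν j N m, E ν (fibVar n _ ((j, N), m)) = fibVar n _ ((e ν j, N), g ν m))
    (hXf : ∀ j N m, X (fibVar n _ ((j, N), m)) = ∑ ν ∈ N,
      (zsign (d.par j) * BRSTTheory.orderSign ν N) • fibVar n _ ((e ν j, N.erase ν), g ν m))
    (ν : Fin n) (f : LocFun n (d.theta n)) :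
    X (thetaD d c ν f) = E ν f - thetaD d c ν (X f) := by
  have h := hX.anticommutator (isSuperDer_thetaD (n := n) d c ν)
  have := IsSuperDer.ext_fib h (hE ν) (fun μ => ?_) (fun μ => ?_) fun z => ?_
  · rw [← this]
    simp
  · simp [hXx, hEx]
  · simp only [LinearMap.add_apply, LinearMap.comp_apply, hXt, hEt, thetaD_th, map_smul,
      hX.apply_ite, map_zero, smul_zero, add_zero]
  · obtain ⟨⟨j, N⟩, m⟩ := z
    have hθ : ∀ μ, thetaD d c ν ((zsign (d.par j) * BRSTTheory.orderSign μ N) •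
        fibVar n _ ((e μ j, N.erase μ), g μ m)) = (zsign (d.par j) * BRSTTheory.orderSign μ N) •
        if ν ∈ N.erase μ then 0 else (zsign (d.par j) * BRSTTheory.orderSign ν (N.erase μ)) •
          fibVar n _ ((e μ j, insert ν (N.erase μ)), g μ m) := fun μ => by
      rw [map_smul, thetaD_fib, he]
    rw [LinearMap.add_apply, LinearMap.comp_apply, LinearMap.comp_apply, thetaD_fib, hXf, hEf,
      map_sum]
    simp only [hθ]
    -- If `ν ∈ N`, only the summand that first removes `ν` survives the reinsertion. Otherwise
    -- removing the freshly inserted `ν` gives `E ν`, and the remaining terms cancel in pairs.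
    by_cases hν : ν ∈ N
    · rw [if_pos hν, map_zero, zero_add, Finset.sum_eq_single_of_mem ν hν]
      · rw [if_neg (Finset.notMem_erase _ _), smul_smul, Finset.insert_erase hν,
          orderSign_erase_self, mul_mul_mul_comm, zsign_mul_self, orderSign_mul_self, one_mul,
          one_smul]
      · intro μ _ hμ
        rw [if_pos (Finset.mem_erase.2 ⟨hμ.symm, hν⟩), smul_zero]
    · rw [if_neg hν, map_smul, hXf, Finset.sum_insert hν, smul_add, Finset.erase_insert hν,
        smul_smul, orderSign_insert_self, mul_mul_mul_comm, zsign_mul_self, orderSign_mul_self,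
        one_mul, one_smul, add_assoc, add_eq_left, Finset.smul_sum, ← Finset.sum_add_distrib]
      refine Finset.sum_eq_zero fun μ hμ => ?_
      have hμν : μ ≠ ν := fun h => hν (h ▸ hμ)
      rw [if_neg (fun h => hν (Finset.mem_of_mem_erase h)), smul_smul, smul_smul,
        Finset.erase_insert_of_ne hμν.symm, ← add_smul]
      convert zero_smul ℝ _
      linear_combination (zsign (d.par j) * zsign (d.par j)) * orderSign_erase_swap hμ hν

end Shift

/-! ### Commutation relations of the parent differential. -/

namespace BRSTTheory

variable {n : ℕ} {A : Type*} (B : BRSTTheory n A)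

theorem dthF_eq (ν : Fin n) : B.dthF ν = thetaD (B.deg.jet n) 0 ν := by
  rw [thetaD, zero_smul, zero_add]
  rfl

theorem dthTotal_eq (ν : Fin n) : B.dthTotal ν = thetaD (B.deg.jet n) 1 ν := by
  rw [thetaD, one_smul]
  rfl

theorem dthTotal_eq_add (ν : Fin n) (f : B.ParentFun) :
    B.dthTotal ν f = B.dthExplicit ν f + B.dthF ν f := rfl

theorem isSuperDer_parentVF {k : ZMod 2} {c} (hc : ∀ A m l N,
    IsPar _ (B.parentDeg.par ((A, l), N) + k) (c A m l N)) : IsSuperDer _ k (B.parentVF c) :=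
  isSuperDer_fibVF (fun _ => IsPar.zero) (fun _ => IsPar.zero) fun z => hc z.1.1.1 z.2 z.1.1.2 z.1.2

@[simp] theorem parentVF_x (c) (μ : Fin n) : B.parentVF c (xVar _ μ) = 0 := fibVF_x _ _ _ μ

@[simp] theorem parentVF_th (c) (μ : Fin n) : B.parentVF c (thVar _ μ) = 0 := fibVF_th _ _ _ μ

@[simp] theorem parentVF_fib (c) (A : A) (l m : MultiIdx n) (N : Finset (Fin n)) :
    B.parentVF c (fibVar n (B.parentDeg.jet n) (((A, l), N), m)) = c A m l N := fibVF_fib _ _ _ _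

theorem isPar_psi (A : A) (m l : MultiIdx n) (N : Finset (Fin n)) :
    IsPar _ (B.parentDeg.par ((A, l), N)) (B.psi A m l N) :=
  isPar_fibVar (B.parentDeg.jet n) (((A, l), N), m)

theorem isSuperDer_dyF (μ : Fin n) : IsSuperDer _ 0 (B.dyF μ) :=
  B.isSuperDer_parentVF fun A m l N => by
    rw [add_zero]; exact B.isPar_psi A m (l + Pi.single μ 1) N

theorem isSuperDer_dyTotal (μ : Fin n) : IsSuperDer _ 0 (B.dyTotal μ) :=
  (isSuperDer_pd_x _ μ).add (B.isSuperDer_dyF μ)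

@[simp] theorem dyTotal_x (μ ν : Fin n) :
    B.dyTotal μ (xVar _ ν) = if ν = μ then 1 else 0 := by
  rw [dyTotal, LinearMap.add_apply, dxExplicit, dyF, parentVF_x, pd_x_x, add_zero]

@[simp] theorem dyTotal_th (μ ν : Fin n) : B.dyTotal μ (thVar _ ν) = 0 := by
  rw [dyTotal, LinearMap.add_apply, dxExplicit, dyF, parentVF_th, pd_x_th, add_zero]

@[simp] theorem dyTotal_fib (μ : Fin n) (A : A) (l m : MultiIdx n) (N : Finset (Fin n)) :
    B.dyTotal μ (fibVar n (B.parentDeg.jet n) (((A, l), N), m)) =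
      fibVar n (B.parentDeg.jet n) (((A, l + Pi.single μ 1), N), m) := by
  rw [dyTotal, LinearMap.add_apply, dxExplicit, dyF, parentVF_fib, pd_x_fib, zero_add, psi]

theorem isSuperDer_dthTotal (ν : Fin n) : IsSuperDer _ 1 (B.dthTotal ν) := by
  rw [dthTotal_eq]
  exact isSuperDer_thetaD (B.deg.jet n) 1 ν

@[simp] theorem dthTotal_x (μ ν : Fin n) : B.dthTotal ν (xVar _ μ) = 0 := by
  rw [dthTotal_eq]
  exact thetaD_x μ ν

@[simp] theorem dthTotal_th (μ ν : Fin n) :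
    B.dthTotal ν (thVar _ μ) = if μ = ν then 1 else 0 := by
  rw [dthTotal_eq]
  exact (thetaD_th μ ν).trans (one_smul _ _)

theorem dthTotal_fib (ν : Fin n) (A : A) (l m : MultiIdx n) (N : Finset (Fin n)) :
    B.dthTotal ν (fibVar n (B.parentDeg.jet n) (((A, l), N), m)) =
      if ν ∈ N then 0 else (zsign (B.deg.par A) * orderSign ν N) •
        fibVar n (B.parentDeg.jet n) (((A, l), insert ν N), m) := by
  rw [dthTotal_eq]
  exact thetaD_fib ν (A, l) N m

theorem dyTotal_dthTotal (μ ν : Fin n) (f : B.ParentFun) :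
    B.dyTotal μ (B.dthTotal ν f) = B.dthTotal ν (B.dyTotal μ f) := by
  have h1 := B.isSuperDer_dyTotal μ
  have h2 := B.isSuperDer_dthTotal ν
  refine h1.commute h2 (fun k => ?_) (fun k => ?_) (fun z => ?_) f
  · rw [dthTotal_x, dyTotal_x, h2.apply_ite, map_zero]
  · rw [dthTotal_th, dyTotal_th, h1.apply_ite, map_zero]
  · obtain ⟨⟨⟨A, l⟩, N⟩, m⟩ := z
    rw [dthTotal_fib, dyTotal_fib, dthTotal_fib]
    split_ifs
    · exact map_zero _
    · rw [map_smul, dyTotal_fib]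

theorem dyTotal_dthExplicit (μ ν : Fin n) (f : B.ParentFun) :
    B.dyTotal μ (B.dthExplicit ν f) = B.dthExplicit ν (B.dyTotal μ f) := by
  have h1 := B.isSuperDer_dyTotal μ
  have h2 := isSuperDer_pd_th (n := n) (B.parentDeg.jet n) ν
  refine h1.commute h2 (fun k => ?_) (fun k => ?_) (fun z => ?_) f
  · rw [pd_th_x, dyTotal_x, h2.apply_ite, map_zero]
  · rw [pd_th_th, dyTotal_th, h1.apply_ite, map_zero]
  · obtain ⟨⟨⟨A, l⟩, N⟩, m⟩ := z
    rw [dyTotal_fib, pd_th_fib, pd_th_fib, map_zero]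

theorem bar_totalD (μ : Fin n) (f : LocFun n B.deg) :
    B.bar (totalD B.deg μ f) = B.dyTotal μ (B.bar f) := by
  -- `bar` is definitionally `parentIncl` with the jet coordinates `Ψ_(λ)` as fibre coordinates, so
  -- the prolongation results apply to it.
  have hb : IsOverBase B.bar := isOverBase_parentIncl (d := B.deg.jet n)
  refine (isSuperDer_totalD B.deg μ).intertwine_fib (B.isSuperDer_dyTotal μ) B.bar
    hb.map_parityInv (fun ν => ?_) (fun ν => ?_) (fun z => ?_) f
  · rw [totalD_x, hb.map_x, dyTotal_x]
    split_ifs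
    · exact map_one _
    · exact map_zero _
  · rw [totalD_th, hb.map_th, dyTotal_th, map_zero]
  · obtain ⟨A, l⟩ := z
    rw [totalD_fib]
    erw [parentIncl_fib, parentIncl_fib]
    exact (B.dyTotal_fib μ A l 0 ∅).symm

theorem bar_symPow (m : MultiIdx n) (f : LocFun n B.deg) :
    B.bar (symPow (totalD B.deg) m f) = symPow B.dyTotal m (B.bar f) :=
  map_symPow (T := B.bar.toLinearMap) B.bar_totalD m f

theorem bar_pd_th (ν : Fin n) (f : LocFun n B.deg) :
    B.bar (pd _ (.th ν) f) = B.dthExplicit ν (B.bar f) := by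
  have hb : IsOverBase B.bar := isOverBase_parentIncl (d := B.deg.jet n)
  refine (isSuperDer_pd_th (B.deg.jet n) ν).intertwine_fib
    (isSuperDer_pd_th (B.parentDeg.jet n) ν) B.bar
    hb.map_parityInv (fun μ => ?_) (fun μ => ?_) (fun z => ?_) f
  · rw [pd_th_x, hb.map_x, pd_th_x, map_zero]
  · rw [pd_th_th, hb.map_th, pd_th_th]
    split_ifs
    · exact map_one _
    · exact map_zero _
  · rw [pd_th_fib, map_zero]
    erw [parentIncl_fib, pd_th_fib]

theorem par_erase {A : A} {l : MultiIdx n} {N : Finset (Fin n)} {ν : Fin n} (h : ν ∈ N) :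
    B.parentDeg.par ((A, l), N.erase ν) = B.parentDeg.par ((A, l), N) + 1 := by
  have := theta_par_insert (B.deg.jet n) (j := (A, l)) (Finset.notMem_erase ν N)
  rw [Finset.insert_erase h] at this
  change _ = ((B.deg.jet n).theta n).par ((A, l), N) + 1
  rw [this, add_assoc, show (1 + 1 : ZMod 2) = 0 from rfl, add_zero]
  rfl

theorem isSuperDer_dF : IsSuperDer _ 1 B.dF :=
  B.isSuperDer_parentVF fun A m l N => IsPar.sum fun ν hν => IsPar.smul (by
    rw [← B.par_erase hν]; exact B.isPar_psi A (m + Pi.single ν 1) l (N.erase ν)) _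

theorem isSuperDer_sigmaF : IsSuperDer _ 1 B.sigmaF :=
  B.isSuperDer_parentVF fun A m l N => IsPar.sum fun ν hν => IsPar.smul (by
    rw [← B.par_erase hν]; exact B.isPar_psi A m (l + Pi.single ν 1) (N.erase ν)) _

/-- `∂^θ_ν` creates the index `ν` and `σ^F` moves it to `(λ)`, which together is `∂^F/∂y^ν`. For
`d^F` the target is `(μ)` and the result is `∂^F/∂x^ν`. -/
theorem sigmaF_dthTotal (ν : Fin n) (f : B.ParentFun) :
    B.sigmaF (B.dthTotal ν f) = B.dyF ν f - B.dthTotal ν (B.sigmaF f) := by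
  rw [dthTotal_eq]
  exact shift_anticomm_thetaD (e := fun ν j => (j.1, j.2 + Pi.single ν 1)) (g := fun _ m => m)
    (fun _ _ => rfl) B.isSuperDer_sigmaF B.isSuperDer_dyF (fun μ => B.parentVF_x _ μ)
    (fun μ => B.parentVF_th _ μ) (fun ν μ => B.parentVF_x _ μ) (fun ν μ => B.parentVF_th _ μ)
    (fun ν j N m => B.parentVF_fib _ j.1 j.2 m N) (fun j N m => B.parentVF_fib _ j.1 j.2 m N) ν f

/-- `∂^F/∂x^μ`. -/
def dxF (μ : Fin n) : B.ParentFun →ₗ[ℝ] B.ParentFun :=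
  B.parentVF fun A m l N => B.psi A (m + Pi.single μ 1) l N

theorem isSuperDer_dxF (μ : Fin n) : IsSuperDer _ 0 (B.dxF μ) :=
  B.isSuperDer_parentVF fun A m l N => by
    rw [add_zero]; exact B.isPar_psi A (m + Pi.single μ 1) l N

theorem totalD_eq_add (μ : Fin n) : totalD B.parentDeg μ = B.dxExplicit μ + B.dxF μ := by
  refine (isSuperDer_totalD B.parentDeg μ).ext_fib
    ((isSuperDer_pd_x _ μ).add (B.isSuperDer_dxF μ)) (fun ν => ?_) (fun ν => ?_) fun z => ?_
  · rw [LinearMap.add_apply, dxExplicit, totalD_x, pd_x_x, dxF, parentVF_x, add_zero]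
  · rw [LinearMap.add_apply, dxExplicit, totalD_th, pd_x_th, dxF, parentVF_th, add_zero]
  · obtain ⟨⟨⟨A, l⟩, N⟩, m⟩ := z
    rw [LinearMap.add_apply, dxExplicit, totalD_fib, pd_x_fib, dxF, parentVF_fib, zero_add, psi]

theorem dF_dthTotal (ν : Fin n) (f : B.ParentFun) :
    B.dF (B.dthTotal ν f) = B.dxF ν f - B.dthTotal ν (B.dF f) := by
  rw [dthTotal_eq]
  exact shift_anticomm_thetaD (e := fun ν j => j) (g := fun ν m => m + Pi.single ν 1)
    (fun _ _ => rfl) B.isSuperDer_dF B.isSuperDer_dxF (fun μ => B.parentVF_x _ μ)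
    (fun μ => B.parentVF_th _ μ) (fun ν μ => B.parentVF_x _ μ) (fun ν μ => B.parentVF_th _ μ)
    (fun ν j N m => B.parentVF_fib _ j.1 j.2 m N) (fun j N m => B.parentVF_fib _ j.1 j.2 m N) ν f

theorem isSuperDer_sBar : IsSuperDer _ 1 B.sBar := by
  refine B.isSuperDer_parentVF fun A m l N => IsPar.smul ?_ _
  have hS : IsPar _ (B.deg.par A + 1) (B.bar (B.S A)) :=
    (isOverBase_parentIncl (d := B.deg.jet n)).map_isPar (B.S_homog A).1
  have h1 : IsPar _ (B.deg.par A + 1) (symPow B.dyTotal l (B.bar (B.S A))) :=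
    symPow_induction (P := IsPar _ (B.deg.par A + 1))
      (fun μ f hf => by simpa using (B.isSuperDer_dyTotal μ).isPar hf) l hS
  have h2 := isPar_skewPow (d := B.deg.jet n) (c := 0) N h1
  rw [show B.dthF = thetaD (B.deg.jet n) 0 from funext B.dthF_eq,
    show B.parentDeg.par ((A, l), N) + 1 = B.deg.par A + 1 + (N.card : ZMod 2) from
      add_right_comm _ _ _]
  exact symPow_induction (P := IsPar _ (B.deg.par A + 1 + (N.card : ZMod 2)))
      (fun μ f hf => by simpa using (isSuperDer_totalD B.parentDeg μ).isPar hf) m h2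

theorem dthF_anticomm (μ ν : Fin n) (f : B.ParentFun) :
    B.dthF μ (B.dthF ν f) = -B.dthF ν (B.dthF μ f) := by
  rw [dthF_eq, dthF_eq]
  exact thetaD_anticomm (d := B.deg.jet n) μ ν f

theorem dthTotal_anticomm (μ ν : Fin n) (f : B.ParentFun) :
    B.dthTotal μ (B.dthTotal ν f) = -B.dthTotal ν (B.dthTotal μ f) := by
  rw [dthTotal_eq, dthTotal_eq]
  exact thetaD_anticomm (d := B.deg.jet n) μ ν f

theorem dthExplicit_dthF (μ ν : Fin n) (f : B.ParentFun) :
    B.dthExplicit μ (B.dthF ν f) = -B.dthF ν (B.dthExplicit μ f) := by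
  have h1 : B.dthTotal μ (B.dthF ν f) = -B.dthF ν (B.dthTotal μ f) := by
    rw [dthTotal_eq, dthF_eq]
    exact thetaD_anticomm (d := B.deg.jet n) μ ν f
  rw [dthTotal_eq_add, dthTotal_eq_add, map_add, neg_add, B.dthF_anticomm] at h1
  exact add_right_cancel h1

theorem totalD_dthTotal (μ ν : Fin n) (f : B.ParentFun) :
    totalD B.parentDeg μ (B.dthTotal ν f) = B.dthTotal ν (totalD B.parentDeg μ f) := by
  rw [dthTotal_eq]
  exact totalD_thetaD (d := B.deg.jet n) μ ν f

/-- `S^A` is independent of `θ`, and `∂/∂θ^ν` commutes with `∂^y_λ` and anticommutes with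
`∂^F/∂θ^μ`, so it can be moved inward to `S^A`. -/
theorem dthExplicit_sBar_component (ν : Fin n) (A : A) (l : MultiIdx n) (N : Finset (Fin n)) :
    B.dthExplicit ν (skewPow B.dthF N (symPow B.dyTotal l (B.bar (B.S A)))) = 0 := by
  have h1 := map_skewPow (T := B.dthExplicit ν) (c := -1)
    (fun μ f => by rw [neg_one_smul]; exact B.dthExplicit_dthF ν μ f) N
    (symPow B.dyTotal l (B.bar (B.S A)))
  have h2 := map_symPow (T := B.dthExplicit ν) (fun μ f => (B.dyTotal_dthExplicit μ ν f).symm) l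
    (B.bar (B.S A))
  rw [h1, h2, ← B.bar_pd_th, B.S_theta, map_zero, map_zero, map_zero, smul_zero]

/-- The components of `s̄` are built with `∂^F/∂θ`, but they have no explicit `θ`-dependence, so
`∂^θ_ν` acts on them as `∂^F/∂θ^ν`. The factor `(-(-1)^{|Ψ|})^{|N|}` in `s̄` gives the sign of
anticommutation. -/
theorem sBar_dthTotal (ν : Fin n) (f : B.ParentFun) :
    B.sBar (B.dthTotal ν f) = -B.dthTotal ν (B.sBar f) := by
  have h1 := B.isSuperDer_sBar
  have h2 := B.isSuperDer_dthTotal ν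
  have hs : ∀ A l N m, B.sBar (fibVar n (B.parentDeg.jet n) (((A, l), N), m)) =
      (-zsign (B.deg.par A)) ^ N.card • symPow (totalD B.parentDeg) m
        (skewPow B.dthF N (symPow B.dyTotal l (B.bar (B.S A)))) := fun A l N m =>
    B.parentVF_fib _ A l m N
  refine h1.anticommute h2 (fun k => ?_) (fun k => ?_) (fun z => ?_) f
  · rw [dthTotal_x, sBar, parentVF_x, map_zero, map_zero, neg_zero]
  · rw [dthTotal_th, h1.apply_ite, sBar, parentVF_th, map_zero, neg_zero]
  · obtain ⟨⟨⟨A, l⟩, N⟩, m⟩ := z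
    have hc := map_symPow (T := B.dthTotal ν) (fun μ f => (B.totalD_dthTotal μ ν f).symm) m
      (skewPow B.dthF N (symPow B.dyTotal l (B.bar (B.S A))))
    rw [dthTotal_fib, hs, map_smul, hc, dthTotal_eq_add, dthExplicit_sBar_component, zero_add]
    split_ifs with hν
    · rw [skewPow_mem B.dthF_anticomm hν, map_zero, map_zero, smul_zero, neg_zero]
    · rw [skewPow_insert B.dthF_anticomm hν, map_smul, map_smul, hs, smul_smul, smul_smul,
        ← neg_smul, Finset.card_insert_of_notMem hν]
      congr 1
      rw [pow_succ]
      linear_combination (-(-zsign (B.deg.par A)) ^ N.card * orderSign ν N) *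
        zsign_mul_self (B.deg.par A)

theorem sTildeParent_apply (f : B.ParentFun) : B.sTildeParent f =
    ∑ μ, thVar _ μ * B.dyTotal μ f + (B.dF f - B.sigmaF f + B.sBar f) := by
  simp [sTildeParent, sParent]

/-- The graded commutator of the parent differential with `∂^θ_ν` is the total derivative
`∂_ν`. -/
theorem sTildeParent_dthTotal (ν : Fin n) (f : B.ParentFun) :
    B.sTildeParent (B.dthTotal ν f) =
      totalD B.parentDeg ν f - B.dthTotal ν (B.sTildeParent f) := by
  have hθ : ∀ μ, B.dthTotal ν (thVar _ μ * B.dyTotal μ f) =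
      -(thVar _ μ * B.dthTotal ν (B.dyTotal μ f)) + (if μ = ν then B.dyTotal μ f else 0) := by
    intro μ
    have h3 := isPar_thVar (n := n) (B.parentDeg.jet n) μ
    rw [IsPar, zsign_one, neg_one_smul] at h3
    rw [(B.isSuperDer_dthTotal ν).1, parityPow_one, AlgHom.id_apply, h3, dthTotal_th, neg_mul]
    split_ifs
    · rw [one_mul]
    · rw [zero_mul]
  rw [sTildeParent_apply, sTildeParent_apply, map_add, map_add, map_sub, map_sum]
  simp only [hθ]
  -- Differentiating `θ^ν` leaves `∂/∂x^ν + ∂^F/∂y^ν`; with `-∂^F/∂y^ν` from `-σ^F` and `∂^F/∂x^ν`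
  -- from `d^F` this adds up to the total derivative.
  rw [Finset.sum_add_distrib, Finset.sum_ite_eq' Finset.univ ν, if_pos (Finset.mem_univ ν),
    dF_dthTotal, sigmaF_dthTotal, sBar_dthTotal, totalD_eq_add, Finset.sum_neg_distrib]
  simp only [dyTotal_dthTotal]
  simp only [dyTotal, LinearMap.add_apply]
  abel

theorem isSuperDer_s : IsSuperDer _ 1 B.s :=
  isSuperDer_fibVF (fun _ => IsPar.zero) (fun _ => IsPar.zero) fun z =>
    symPow_induction (P := IsPar _ (B.deg.par z.1 + 1))
      (fun μ f hf => by simpa using (isSuperDer_totalD B.deg μ).isPar hf) _ (B.S_homog z.1).1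

theorem s_totalD (μ : Fin n) (f : LocFun n B.deg) :
    totalD B.deg μ (B.s f) = B.s (totalD B.deg μ f) := by
  refine (isSuperDer_totalD B.deg μ).commute B.isSuperDer_s (fun ν => ?_) (fun ν => ?_)
    (fun z => ?_) f
  · rw [totalD_x, B.isSuperDer_s.apply_ite, s, fibVF_x, Pi.zero_apply, map_zero]
  · rw [totalD_th, map_zero, s, fibVF_th, Pi.zero_apply, map_zero]
  · obtain ⟨A, l⟩ := z
    rw [totalD_fib, s, fibVF_fib, fibVF_fib]
    exact (symPow_add_single totalD_comm l μ _).symm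

theorem sTilde_apply (f : LocFun n B.deg) :
    B.sTilde f = ∑ μ, thVar _ μ * totalD B.deg μ f + B.s f := by
  simp [sTilde]

theorem sTilde_totalD (μ : Fin n) (f : LocFun n B.deg) :
    totalD B.deg μ (B.sTilde f) = B.sTilde (totalD B.deg μ f) := by
  rw [sTilde_apply, sTilde_apply, map_add, s_totalD, map_sum]
  congr 1
  refine Finset.sum_congr rfl fun ν _ => ?_
  rw [(isSuperDer_totalD B.deg μ).1, totalD_th, zero_mul, add_zero, parityPow_zero,
    AlgHom.id_apply, totalD_comm]

theorem sBar_bar (f : LocFun n B.deg) : B.bar (B.s f) = B.sBar (B.bar f) := by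
  have hb : IsOverBase B.bar := isOverBase_parentIncl (d := B.deg.jet n)
  refine B.isSuperDer_s.intertwine_fib B.isSuperDer_sBar B.bar
    hb.map_parityInv (fun ν => ?_) (fun ν => ?_) (fun z => ?_) f
  · rw [hb.map_x, sBar, parentVF_x, s, fibVF_x, Pi.zero_apply, map_zero]
  · rw [hb.map_th, sBar, parentVF_th, s, fibVF_th, Pi.zero_apply, map_zero]
  · obtain ⟨A, l⟩ := z
    rw [s, fibVF_fib, bar_symPow]
    erw [parentIncl_fib]
    refine Eq.trans ?_ (B.parentVF_fib _ A l 0 ∅).symm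
    simp

/-- Meant for `d^F` and `σ^F`: functions in the image of `bar` contain no `[ν]`-index that could be
moved. -/
theorem bar_shift_eq_zero {X : B.ParentFun →ₗ[ℝ] B.ParentFun} (hX : IsSuperDer _ 1 X)
    (hx : ∀ μ, X (xVar _ μ) = 0) (ht : ∀ μ, X (thVar _ μ) = 0)
    (hf : ∀ A l, X (fibVar n (B.parentDeg.jet n) (((A, l), ∅), 0)) = 0) (f : LocFun n B.deg) :
    X (B.bar f) = 0 := by
  have hb : IsOverBase B.bar := isOverBase_parentIncl (d := B.deg.jet n)
  refine ((show IsSuperDer _ 1 (0 : LocFun n B.deg →ₗ[ℝ] LocFun n B.deg) from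
    ⟨fun f g => by simp, fun f => by simp⟩).intertwine_fib hX B.bar
    hb.map_parityInv (fun ν => ?_) (fun ν => ?_) (fun z => ?_) f).symm.trans (map_zero _)
  · rw [hb.map_x, hx, LinearMap.zero_apply, map_zero]
  · rw [hb.map_th, ht, LinearMap.zero_apply, map_zero]
  · obtain ⟨A, l⟩ := z
    rw [LinearMap.zero_apply, map_zero]
    erw [parentIncl_fib]
    exact (hf A l).symm

/-- The parent differential restricts to `s̃`. -/
theorem sTildeParent_bar (f : LocFun n B.deg) : B.sTildeParent (B.bar f) = B.bar (B.sTilde f) := by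
  have hb : IsOverBase B.bar := isOverBase_parentIncl (d := B.deg.jet n)
  have h1 : B.dF (B.bar f) = 0 := B.bar_shift_eq_zero B.isSuperDer_dF (fun μ => B.parentVF_x _ μ)
    (fun μ => B.parentVF_th _ μ) (fun A l => B.parentVF_fib _ A l 0 ∅) f
  have h2 : B.sigmaF (B.bar f) = 0 := B.bar_shift_eq_zero B.isSuperDer_sigmaF
    (fun μ => B.parentVF_x _ μ) (fun μ => B.parentVF_th _ μ)
    (fun A l => B.parentVF_fib _ A l 0 ∅) f
  rw [sTildeParent_apply, sTilde_apply, h1, h2, sub_zero, zero_add, map_add, sBar_bar, map_sum]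
  simp only [map_mul, hb.map_th, bar_totalD]

end BRSTTheory

/-! ### Trivial pairs and generalized auxiliary fields -/

/-- If `Q Θ_ν + Θ_ν Q = D_ν` for anticommuting `Θ_ν` that commute with the `D_ν`, then `Q`
commutes in the graded sense with `Θ_N` up to terms `D_ν Θ_M`. -/
theorem skewPow_commutator_mem {n : ℕ} {V : Type*} [AddCommGroup V] [Module ℝ V]
    {Q : V →ₗ[ℝ] V} {Θ D : Fin n → V →ₗ[ℝ] V} (hΘ : ∀ μ ν f, Θ μ (Θ ν f) = -Θ ν (Θ μ f))
    (hD : ∀ μ ν f, D μ (Θ ν f) = Θ ν (D μ f)) (hQ : ∀ ν f, Q (Θ ν f) = D ν f - Θ ν (Q f))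
    (N : Finset (Fin n)) (f : V) : Q (skewPow Θ N f) - (-1 : ℝ) ^ N.card • skewPow Θ N (Q f) ∈
      Submodule.span ℝ (Set.range fun z : Fin n × Finset (Fin n) => D z.1 (skewPow Θ z.2 f)) := by
  induction N using Finset.induction_on with
  | empty => simp
  | insert ν N h ih =>
    have e : Q (skewPow Θ (insert ν N) f) -
        (-1 : ℝ) ^ (insert ν N).card • skewPow Θ (insert ν N) (Q f) =
        BRSTTheory.orderSign ν N • (D ν (skewPow Θ N f) -
          Θ ν (Q (skewPow Θ N f) - (-1 : ℝ) ^ N.card • skewPow Θ N (Q f))) := by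
      rw [skewPow_insert' hΘ h, skewPow_insert' hΘ h, map_smul, hQ, map_sub, map_smul,
        Finset.card_insert_of_notMem h, pow_succ]
      module
    rw [e]
    refine Submodule.smul_mem _ _ (Submodule.sub_mem _ (Submodule.subset_span ⟨(ν, N), rfl⟩) ?_)
    generalize Q (skewPow Θ N f) - (-1 : ℝ) ^ N.card • skewPow Θ N (Q f) = y at ih
    induction ih using Submodule.span_induction with
    | mem y hy =>
      obtain ⟨⟨μ, M⟩, rfl⟩ := hy
      dsimp only
      -- `Θ ν` passes through `D μ`, so it sends a generator of the span to zero or to plus or minus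
      -- another generator.
      rw [← hD]
      by_cases hM : ν ∈ M
      · rw [skewPow_mem hΘ hM, map_zero]
        exact Submodule.zero_mem _
      · rw [skewPow_insert hΘ hM, map_smul]
        exact Submodule.smul_mem _ _ (Submodule.subset_span ⟨(μ, insert ν M), rfl⟩)
    | zero => rw [map_zero]; exact Submodule.zero_mem _
    | add x y _ _ hx hy => rw [map_add]; exact Submodule.add_mem _ hx hy
    | smul c x _ hx => rw [map_smul]; exact Submodule.smul_mem _ _ hx

/-- Let `w`, `v` be coordinates with `s̃ w = v`. Then the descendants of `w`, `v` are generalized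
auxiliary fields of the extended parent theory. -/
theorem BRSTTheory.exists_isGenAuxiliary {n : ℕ} {A : Type*} (B : BRSTTheory n A)
    {J' L I₁ : Type*} {d' : Degrees J'} (T : CoordChange n d' (B.deg.jet n)) {w v : L → J'}
    (hwv : ∀ a, B.sTilde (T.new (w a)) = T.new (v a)) (dI₁ : Degrees I₁)
    (dK₁ : Degrees (L × Finset (Fin n)))
    (e : Split I₁ (L × Finset (Fin n)) ≃ J' × Finset (Fin n))
    (hp : ∀ f, (dI₁.split dK₁).par f = (d'.theta n).par (e f))
    (hg : ∀ f, (dI₁.split dK₁).gh f = (d'.theta n).gh (e f))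
    (hw : ∀ a N, e (.w (a, N)) = (w a, N)) (hv : ∀ a N, e (.v (a, N)) = (v a, N)) :
    ∃ T' : FieldChange n (dI₁.split dK₁) B.parentDeg, IsGenAuxiliary B.sTildeParent T' ∧
      ∀ f, T'.field f = skewPow B.dthTotal (e f).2 (B.bar (T.new (e f).1)) := by
  obtain ⟨T', hT⟩ : ∃ T' : FieldChange n (dI₁.split dK₁) B.parentDeg,
      ∀ f, T'.field f = skewPow B.dthTotal (e f).2 (B.bar (T.new (e f).1)) := by
    rw [show B.dthTotal = thetaD (B.deg.jet n) 1 from funext B.dthTotal_eq]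
    exact T.exists_fieldChange e hp hg
  -- The choice `V = 0` works: the terms beside the descendants of `v̄` are total derivatives of
  -- descendants of `w̄`, which already lie in the ideal.
  refine ⟨T', ⟨0, fun a => isHomog_zero _ _ _, ?_⟩, hT⟩
  set W := Set.range fun z : (L × Finset (Fin n)) × MultiIdx n =>
    symPow (totalD B.parentDeg) z.2 (T'.field (.w z.1)) with hW
  have key : ∀ a N m, symPow (totalD B.parentDeg) m (B.sTildeParent (T'.field (.w (a, N)))) -
      (-1 : ℝ) ^ N.card • symPow (totalD B.parentDeg) m (T'.field (.v (a, N))) ∈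
        Ideal.span W := by
    intro a N m
    have h1 := skewPow_commutator_mem B.dthTotal_anticomm B.totalD_dthTotal
      B.sTildeParent_dthTotal N (B.bar (T.new (w a)))
    rw [B.sTildeParent_bar, hwv] at h1
    rw [hT, hT, hw, hv, ← map_smul, ← map_sub]
    dsimp only
    generalize B.sTildeParent (skewPow B.dthTotal N (B.bar (T.new (w a)))) -
      (-1 : ℝ) ^ N.card • skewPow B.dthTotal N (B.bar (T.new (v a))) = y at h1
    induction h1 using Submodule.span_induction with
    | mem y hy =>
      obtain ⟨⟨μ, M⟩, rfl⟩ := hy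
      -- The extra derivative `∂_μ` is absorbed into the multi-index, so the term is one of the
      -- generators in `W`.
      refine Ideal.subset_span ⟨((a, M), m + Pi.single μ 1), ?_⟩
      dsimp only
      rw [hT, hw, symPow_add_single totalD_comm]
      exact map_symPow (T := totalD B.parentDeg μ) (totalD_comm μ) m _
    | zero => rw [map_zero]; exact Submodule.zero_mem _
    | add x y _ _ hx hy => rw [map_add]; exact Submodule.add_mem _ hx hy
    | smul c x _ hx =>
      rw [map_smul, Algebra.smul_def]
      exact Ideal.mul_mem_left _ _ hx
  have hV : ∀ z : L × Finset (Fin n), T'.field (.v z) - T'.equiv (phiInclLoc n dI₁ dK₁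
      ((0 : L × Finset (Fin n) → LocFun n dI₁) z)) = T'.field (.v z) := fun z => by
    rw [Pi.zero_apply, map_zero, map_zero, sub_zero]
  simp only [hV]
  refine le_antisymm (Ideal.span_le.2 (Set.union_subset ?_ ?_))
    (Ideal.span_le.2 (Set.union_subset ?_ ?_))
  · exact Set.subset_union_left.trans Ideal.subset_span
  · rintro _ ⟨⟨⟨a, N⟩, m⟩, rfl⟩
    have h1 := Ideal.span_mono (Set.subset_union_left (t := Set.range
      fun z : (L × Finset (Fin n)) × MultiIdx n =>
        symPow (totalD B.parentDeg) z.2 (T'.field (.v z.1)))) (key a N m)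
    refine (Submodule.sub_mem_iff_left _ ?_).1 h1
    rw [Algebra.smul_def]
    exact Ideal.mul_mem_left _ _ (Ideal.subset_span (Or.inr ⟨((a, N), m), rfl⟩))
  · exact Set.subset_union_left.trans Ideal.subset_span
  · rintro _ ⟨⟨⟨a, N⟩, m⟩, rfl⟩
    have h1 := Ideal.span_mono (Set.subset_union_left (t := Set.range
      fun z : (L × Finset (Fin n)) × MultiIdx n =>
        symPow (totalD B.parentDeg) z.2 (B.sTildeParent (T'.field (.w z.1))))) (key a N m)
    have h0 : symPow (totalD B.parentDeg) m (B.sTildeParent (T'.field (.w (a, N)))) ∈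
        Ideal.span (W ∪ Set.range fun z : (L × Finset (Fin n)) × MultiIdx n =>
          symPow (totalD B.parentDeg) z.2 (B.sTildeParent (T'.field (.w z.1)))) :=
      Ideal.subset_span (Or.inr ⟨((a, N), m), rfl⟩)
    have h2 := (Submodule.sub_mem_iff_right _ h0).1 h1
    -- The sign `(-1)^{|N|}` is its own inverse, so a second multiplication removes it.
    have h3 := Ideal.mul_mem_left _ (algebraMap ℝ _ ((-1 : ℝ) ^ N.card)) h2
    rw [← Algebra.smul_def, smul_smul, ← mul_pow, neg_one_mul, neg_neg, one_pow, one_smul] at h3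
    exact h3

/-- The labels of the descendants of `φ`, `w`, `v`. -/
def Split.prodEquiv (I K X : Type*) : Split (I × X) (K × X) ≃ Split I K × X where
  toFun
    | .phi z => (.phi z.1, z.2)
    | .w z => (.w z.1, z.2)
    | .v z => (.v z.1, z.2)
  invFun
    | (.phi i, x) => .phi (i, x)
    | (.w a, x) => .w (a, x)
    | (.v a, x) => .v (a, x)
  left_inv z := by rcases z with z | z | z <;> rfl
  right_inv z := by rcases z with ⟨z | z | z, x⟩ <;> rfl

theorem split_theta_par {n : ℕ} {I K : Type*} (dI : Degrees I) (dK : Degrees K) (f) :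
    ((dI.theta n).split (dK.theta n)).par f =
      ((dI.split dK).theta n).par (Split.prodEquiv _ _ _ f) := by
  rcases f with f | f | f
  · rfl
  · rfl
  · exact add_right_comm _ _ _

theorem split_theta_gh {n : ℕ} {I K : Type*} (dI : Degrees I) (dK : Degrees K) (f) :
    ((dI.theta n).split (dK.theta n)).gh f =
      ((dI.split dK).theta n).gh (Split.prodEquiv _ _ _ f) := by
  rcases f with f | f | f
  · rfl
  · rfl
  · exact sub_add_eq_add_sub _ _ _

theorem FieldChange.new_eq {n : ℕ} {F F' : Type*} {d' : Degrees F'} {d : Degrees F}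
    (T : FieldChange n d' d) (f : F') (m : MultiIdx n) :
    T.new (f, m) = symPow (totalD d) m (T.field f) := T.map_jet f m

end

theorem proposition2p8 {n : ℕ} {A : Type*} (B : BRSTTheory n A) :
    (∀ {I K : Type*} (dI : Degrees I) (dK : Degrees K)
        (T : FieldChange n (dI.split dK) B.deg), IsAlgTrivialPairs B.sTilde T →
      ∃ T' : FieldChange n (((dI.jet n).theta n).split ((dK.jet n).theta n)) B.parentDeg,
        IsGenAuxiliary B.sTildeParent T' ∧
        (∀ a l N, T'.field (.w ((a, l), N)) =
          skewPow B.dthTotal N (symPow B.dyTotal l (B.bar (T.field (.w a))))) ∧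
        (∀ a l N, T'.field (.v ((a, l), N)) =
          skewPow B.dthTotal N (symPow B.dyTotal l (B.bar (T.field (.v a))))) ∧
        (∀ i l N, T'.field (.phi ((i, l), N)) =
          skewPow B.dthTotal N (symPow B.dyTotal l (B.bar (T.field (.phi i)))))) ∧
    (∀ {I K : Type*} (dI : Degrees I) (dK : Degrees K)
        (T : CoordChange n (dI.split dK) (B.deg.jet n)), IsTrivialPairs B.sTilde T →
      ∃ T' : FieldChange n ((dI.theta n).split (dK.theta n)) B.parentDeg,
        IsGenAuxiliary B.sTildeParent T' ∧
        (∀ a N, T'.field (.w (a, N)) = skewPow B.dthTotal N (B.bar (T.new (.w a)))) ∧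
        (∀ a N, T'.field (.v (a, N)) = skewPow B.dthTotal N (B.bar (T.new (.v a)))) ∧
        (∀ i N, T'.field (.phi (i, N)) = skewPow B.dthTotal N (B.bar (T.new (.phi i))))) := by
  refine ⟨fun {I K} dI dK T hT => ?_, fun {I K} dI dK T hT => ?_⟩
  -- The total derivatives of `w` and `v` are treated as independent coordinates labelled by `K ×
  -- MultiIdx n`; they satisfy the pair relation because `s̃` commutes with `∂_μ`.
  · obtain ⟨T', haux, h⟩ := B.exists_isGenAuxiliary T.toCoordChange
      (w := fun z : K × MultiIdx n => (.w z.1, z.2)) (v := fun z => (.v z.1, z.2))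
      (fun z => by
        rw [FieldChange.new_eq, FieldChange.new_eq, ← hT.1]
        exact map_symPow (fun μ f => (B.sTilde_totalD μ f).symm) z.2 _)
      ((dI.jet n).theta n) ((dK.jet n).theta n)
      ((Split.prodEquiv _ _ _).trans ((Split.prodEquiv _ _ _).prodCongr (Equiv.refl _)))
      (fun f => by rcases f with f | f | f <;> first | rfl | exact add_right_comm _ _ _)
      (fun f => by rcases f with f | f | f <;> first | rfl | exact sub_add_eq_add_sub _ _ _)
      (fun _ _ => rfl) (fun _ _ => rfl)
    refine ⟨T', haux, fun a l N => ?_, fun a l N => ?_, fun i l N => ?_⟩ <;>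
    -- `bar` converts the total derivatives hidden in the jet label into `∂^y_λ`.
    · rw [h, ← B.bar_symPow, ← FieldChange.new_eq]
      rfl
  · obtain ⟨T', haux, h⟩ := B.exists_isGenAuxiliary T hT.1 (dI.theta n) (dK.theta n)
      (Split.prodEquiv _ _ _) (split_theta_par dI dK) (split_theta_gh dI dK) (fun _ _ => rfl)
      (fun _ _ => rfl)
    exact ⟨T', haux, fun _ _ => h _, fun _ _ => h _, fun _ _ => h _⟩
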